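/- **Setting.** Let $\Gamma$ be a finite group, $\Gamma'\subseteq\Gamma$ a subgroup, $K_0$ a number field. A $\Gamma$-extension of $K_0$ is an isomorphism class of pairs $(L,\tau)$ with $L/K_0$ finite Galois and $\tau:\mathrm{Gal}(L/K_0)\cong\Gamma$ (an isomorphism $(L,\tau)\to(L',\tau')$ is a $K_0$-isomorphism $\alpha:L\to L'$ with $\tau'(\alpha\phi\alpha^{-1})=\tau(\phi)$ for all $\phi$). *Idempotents and characters.* Let $e_1=|\Gamma|^{-1}\sum_{\sigma\in\Gamma}\sigma,e_2,\dots,e_m$ be the irreducible central idempotents of $\mathbb Q[\Gamma]$, $\chi_i$ the $\mathbb Q$-irreducible character belonging to $e_i$, $\varphi_i$ a fixed absolutely irreducible character contained in $\chi_i$, and $h_i^2$ the dimension of $e_i\mathbb Q[\Gamma]$ over its center. For a subgroup $H$ put $a_{\Gamma/H}=\mathrm{Ind}_H^\Gamma 1-1$ and $a_\Gamma=a_{\Gamma/1}$. Let $e=e_{\Gamma/\Gamma'}$ be the minimal central idempotent of $\mathbb Q[\Gamma]$ acting as the identity on a representation with character $a_{\Gamma/\Gamma'}$; number the $e_i$ so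 that $e=e_2+\dots+e_k$. Let $e_1'=|\Gamma'|^{-1}\sum_{\sigma\in\Gamma'}\sigma$. *Good primes.* For a set $S$ of primes let $\mathbb Z_S\subseteq\mathbb Q$ be the ring of fractions whose denominators are prime to every $p\in S$, and $\mathbb Z_{(p)}=\mathbb Z_{\{p\}}$. A prime $p$ is good for $e$ if $e\in\mathbb Z_{(p)}[\Gamma]$ and $e\mathbb Z_{(p)}[\Gamma]$ is a maximal $\mathbb Z_{(p)}$-order in $e\mathbb Q[\Gamma]$. Assume that every $p\in S$ is good for $e$. Let $\mathfrak o={}^{\Gamma'}(e\mathbb Z_S[\Gamma]e_1')$ be the ring of elements of $e\mathbb Z_S[\Gamma]e_1'$ fixed by left multiplication with $\Gamma'$, an order in $e_1'e\mathbb Q[\Gamma]e_1'$. For an $e\mathbb Z_S[\Gamma]$-module $G$ the group ${}^{\Gamma'}G$ of $\Gamma'$-fixed elements is an $\mathfrak o$-module: $\sigma e_1'\in\mathfrak o$ with $\sigma\in e\mathbb Z_S[\Gamma]$ acts as $\sigma$. *Ranks.* For a $\Gamma$-extension $L/K_0$ with decomposition groups $\Gamma_v$ put $\chi_L=-1+\sum_{v\mid\infty}\mathrm{Ind}_{\Gamma_v}^\Gamma1$,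 the sum over the infinite places of $K_0$. The rank of $L/K_0$ is $(u_2,\dots,u_m)$ with $u_i=\langle\chi_L,\varphi_i\rangle/h_i$. Let $\underline u$ be the rank of some $\Gamma$-extension of $K_0$, and for $2\le i\le k$ let $v_i=\frac{\langle\varphi_i,a_\Gamma\rangle}{\langle\varphi_i,a_{\Gamma/\Gamma'}\rangle}u_i$ (the rank of the fixed field of $\Gamma'$). Assume that $S$ is finite or that $u_i>0$ for $2\le i\le k$. *Random modules.* Let $X$ be the random finite $e\mathbb Z_S[\Gamma]$-module which is isomorphic to $G$ with probability proportional to $\big(\prod_{i=2}^k|e_iG|^{u_i}\cdot|\mathrm{Aut}(G)|\big)^{-1}$, and $Y$ the random finite $\mathfrak o$-module which is isomorphic to $H$ with probability proportional to $\big(\prod_{i=2}^k|e_ie_1'H|^{v_i}\cdot|\mathrm{Aut}_{\mathfrak o}(H)|\big)^{-1}$. *Class groups.* For a $\Gamma$-extension $L/K_0$ let $K=L^{\Gamma'}$, let $\mathrm{Cl}_L^S$ be the $S$-part of the class group of $L$ (a $\mathbb Z_S[\Gamma]$-module), and $\mathrm{Cl}^S_{K/K_0}$ the $S$-part of the kernel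 of the norm $\mathrm{Cl}_K\to\mathrm{Cl}_{K_0}$. **Theorem.** (a) For every $\Gamma$-extension $L/K_0$, extension of ideals induces an isomorphism $i_*:\mathrm{Cl}^S_{K/K_0}\to{}^{\Gamma'}(e\,\mathrm{Cl}_L^S)$. Through $i_*$ the group $\mathrm{Cl}^S_{K/K_0}$ is an $\mathfrak o$-module. (b) Let $f$ be a non-negative real function on the isomorphism classes of finite $\mathfrak o$-modules, and let $J$ be a set of indices with $\{2,\dots,k\}\subseteq J\subseteq\{2,\dots,m\}$. All sums below are over the $\Gamma$-extensions $L/K_0$ whose rank agrees with $\underline u$ at the coordinates in $J$ and whose absolute discriminant $d_L$ satisfies $|d_L|\le x$; limits and expected values are taken in $[0,\infty]$. If the prediction of Cohen and Martinet holds for $e$ and the function $G\mapsto f({}^{\Gamma'}G)$, that is, if $$\lim_{x\to\infty}\frac{\sum_{|d_L|\le x}f\big({}^{\Gamma'}(e\,\mathrm{Cl}^S_L)\big)}{\sum_{|d_L|\le x}1}=\mathbb E\big(f({}^{\Gamma'}X)\big),$$ then $$\lim_{x\to\infty}\frac{\sum_{|d_L|\le x}f\big(\mathrm{Cl}^S_{L^{\Gamma'}/K_0}\big)}{\sum_{|d_L|\le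 x}1}=\mathbb E\big(f(Y)\big).$$ (For $J=\{2,\dots,k\}$ the hypothesis is the Cohen–Martinet conjecture for $e$, where only the coordinates of the rank belonging to $e$ are prescribed; for $J=\{2,\dots,m\}$ the whole rank is prescribed.) -/

import Mathlib

open scoped ENNReal NNReal
open NumberField Filter Topology

set_option linter.unusedSectionVars false
set_option linter.unusedVariables false

universe u

noncomputable section

namespace CohenMartinet

section GroupAlgebra

variable {Γ : Type u} [Group Γ] [Fintype Γ]

/-- `x` is a central idempotent of the ring `A`. -/
structure IsCentralIdempotent {A : Type*} [Ring A] (x : A) : Prop where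
  idem : IsIdempotentElem x
  central : ∀ y : A, x * y = y * x

/-- `x` is an irreducible central idempotent of `A`: a nonzero central idempotent which is not the
sum of two nonzero orthogonal central idempotents. -/
structure IsIrreducibleCentralIdempotent {A : Type*} [Ring A] (x : A) : Prop
    extends IsCentralIdempotent x where
  ne_zero : x ≠ 0
  minimal : ∀ f : A, IsCentralIdempotent f → f * x = f → f = 0 ∨ f = x

variable (Γ) in
/-- The irreducible central idempotents `e₁, …, e_m` of `ℚ[Γ]`. -/
def IrrIdem : Type u :=
  {x : MonoidAlgebra ℚ Γ // IsIrreducibleCentralIdempotent x}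

theorem IsCentralIdempotent.mul {A : Type*} [Ring A] {x y : A} (hx : IsCentralIdempotent x)
    (hy : IsCentralIdempotent y) : IsCentralIdempotent (x * y) where
  idem := by
    have h : x * y * (x * y) = (x * x) * (y * y) := by
      rw [mul_assoc, ← mul_assoc y x y, ← hx.central y, mul_assoc, mul_assoc]
    rw [IsIdempotentElem, h, hx.idem.eq, hy.idem.eq]
  central z := by rw [mul_assoc, hy.central, ← mul_assoc, hx.central, mul_assoc]

theorem IsCentralIdempotent.zero {A : Type*} [Ring A] : IsCentralIdempotent (0 : A) :=
  ⟨by simp [IsIdempotentElem], by simp⟩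


theorem IrrIdem.mul_self (i : IrrIdem Γ) : i.1 * i.1 = i.1 := i.2.idem.eq

theorem IrrIdem.mul_eq_zero {i j : IrrIdem Γ} (h : i ≠ j) : i.1 * j.1 = 0 := by
  have hi := i.2.toIsCentralIdempotent
  have hj := j.2.toIsCentralIdempotent
  rcases j.2.minimal _ (hi.mul hj) (by rw [mul_assoc, j.mul_self]) with h0 | h1
  · exact h0
  · rcases i.2.minimal _ (hi.mul hj)
      (by rw [hi.central j.1, mul_assoc, i.mul_self]) with h0 | h2
    · exact h0
    · exact absurd (Subtype.ext (h2.symm.trans h1)) h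

instance : Finite (IrrIdem Γ) := by
  have hli : LinearIndependent ℚ (fun i : IrrIdem Γ => i.1) := by
    rw [linearIndependent_iff']
    intro s c hc j hj
    have h1 : (∑ i ∈ s, c i • i.1) * j.1 = c j • j.1 := by
      rw [Finset.sum_mul, Finset.sum_eq_single j]
      · rw [smul_mul_assoc, j.mul_self]
      · intro i _ hij
        rw [smul_mul_assoc, IrrIdem.mul_eq_zero hij, smul_zero]
      · intro h; exact absurd hj h
    rw [hc, zero_mul] at h1
    exact (smul_eq_zero.mp h1.symm).resolve_right j.2.ne_zero
  exact hli.finite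

instance : Fintype (IrrIdem Γ) := Fintype.ofFinite _

/-- The idempotent `|H|⁻¹ ∑_{h ∈ H} h` of `ℚ[Γ]` attached to the unit character of a subgroup `H`.
For `H = ⊤` it is `e₁`, for `H = Γ'` it is `e₁'`. -/
def unitIdem (H : Subgroup Γ) : MonoidAlgebra ℚ Γ :=
  open Classical in ∑ h : H, MonoidAlgebra.single (h : Γ) ((Nat.card H : ℚ)⁻¹)

theorem single_mul_unitIdem (H : Subgroup Γ) (g : Γ) (hg : g ∈ H) :
    MonoidAlgebra.single g (1 : ℚ) * unitIdem H = unitIdem H := by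
  classical
  unfold unitIdem
  rw [Finset.mul_sum]
  simp only [MonoidAlgebra.single_mul_single, one_mul]
  exact Fintype.sum_equiv (Equiv.mulLeft (⟨g, hg⟩ : H)) _ _ (fun h => rfl)

theorem unitIdem_idem (H : Subgroup Γ) : unitIdem H * unitIdem H = unitIdem H := by
  classical
  have hs : ∀ h : H, MonoidAlgebra.single (h : Γ) ((Nat.card H : ℚ)⁻¹) * unitIdem H
      = ((Nat.card H : ℚ)⁻¹) • unitIdem H := by
    intro h
    have : MonoidAlgebra.single (h : Γ) ((Nat.card H : ℚ)⁻¹)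
        = ((Nat.card H : ℚ)⁻¹) • MonoidAlgebra.single (h : Γ) (1 : ℚ) := by
      simp
    rw [this, smul_mul_assoc, single_mul_unitIdem H _ h.2]
  conv_lhs => rw [show unitIdem H * unitIdem H =
    (∑ h : H, MonoidAlgebra.single (h : Γ) ((Nat.card H : ℚ)⁻¹)) * unitIdem H from rfl]
  rw [Finset.sum_mul, Finset.sum_congr rfl (fun h _ => hs h), Finset.sum_const, Finset.card_univ,
    ← Nat.card_eq_fintype_card, ← Nat.cast_smul_eq_nsmul ℚ, smul_smul,
    mul_inv_cancel₀ (by exact_mod_cast Nat.card_pos.ne'), one_smul]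

/-- The action of `ℚ[Γ]` on the permutation module `ℚ[Γ/Γ']`. -/
def cosetAction (Γ' : Subgroup Γ) :
    MonoidAlgebra ℚ Γ →ₐ[ℚ] Module.End ℚ (MonoidAlgebra ℚ (Γ ⧸ Γ')) :=
  (Representation.ofMulAction ℚ Γ (Γ ⧸ Γ')).asAlgebraHom

/-- The augmentation representation `V` of `Γ` acting on the cosets of `Γ'`: the elements of
`ℚ[Γ/Γ']` of coefficient sum zero. Its character is `a_{Γ/Γ'} = Ind_{Γ'}^Γ 1 - 1`. -/
def augModule (Γ' : Subgroup Γ) : Submodule ℚ (MonoidAlgebra ℚ (Γ ⧸ Γ')) where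
  carrier := {w | (w.coeff.sum fun _ c => c) = 0}
  zero_mem' := by simp
  add_mem' {a b} ha hb := by
    simp only [Set.mem_ofPred_eq] at *
    rw [MonoidAlgebra.coeff_add, Finsupp.sum_add_index' (by simp) (by simp), ha, hb, add_zero]
  smul_mem' c x hx := by
    simp only [Set.mem_ofPred_eq] at *
    rw [MonoidAlgebra.coeff_smul, Finsupp.sum_smul_index (by simp), ← Finsupp.mul_sum, hx, mul_zero]

/-- The central idempotent `e_{Γ/Γ'}` of `ℚ[Γ]` attached to `a_{Γ/Γ'}`: the sum of those
irreducible central idempotents which act non-trivially on the augmentation representation. -/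
def augIdem (Γ' : Subgroup Γ) : MonoidAlgebra ℚ Γ :=
  open Classical in
  ∑ i : IrrIdem Γ, if ∃ w ∈ augModule Γ', cosetAction Γ' i.1 w ≠ 0 then i.1 else 0

theorem isCentralIdempotent_sum (P : IrrIdem Γ → Prop) [DecidablePred P] :
    IsCentralIdempotent (∑ i : IrrIdem Γ, if P i then i.1 else 0) where
  idem := by
    rw [IsIdempotentElem, Finset.sum_mul]
    refine Finset.sum_congr rfl fun i _ => ?_
    rw [Finset.mul_sum, Finset.sum_eq_single i]
    · split_ifs
      · exact i.mul_self
      · simp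
    · intro j _ hj
      split_ifs <;> simp [IrrIdem.mul_eq_zero hj.symm]
    · simp
  central y := by
    rw [Finset.sum_mul, Finset.mul_sum]
    refine Finset.sum_congr rfl fun i _ => ?_
    split_ifs
    · exact i.2.central y
    · simp

theorem augIdem_central (Γ' : Subgroup Γ) : IsCentralIdempotent (augIdem Γ') :=
  open Classical in isCentralIdempotent_sum _

/-- The irreducible central idempotents add up to `1`. -/
theorem sum_irrIdem : ∑ i : IrrIdem Γ, i.1 = (1 : MonoidAlgebra ℚ Γ) := by
  classical
  by_contra hne
  set r : MonoidAlgebra ℚ Γ := 1 - ∑ i : IrrIdem Γ, i.1 with hr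
  have hr0 : r ≠ 0 := fun h => hne (sub_eq_zero.mp h).symm
  have hs : IsCentralIdempotent (∑ i : IrrIdem Γ, i.1) := by
    simpa using isCentralIdempotent_sum (Γ := Γ) (fun _ => True)
  have hrc : IsCentralIdempotent r :=
    ⟨hs.idem.one_sub, fun y => by rw [hr, sub_mul, mul_sub, hs.central y, one_mul, mul_one]⟩
  let T : Set (MonoidAlgebra ℚ Γ) := {f | IsCentralIdempotent f ∧ f ≠ 0 ∧ f * r = f}
  let d : MonoidAlgebra ℚ Γ → ℕ :=
    fun f => Module.finrank ℚ (LinearMap.range (LinearMap.mulLeft ℚ f))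
  have hT : T.Nonempty := ⟨r, hrc, hr0, hrc.idem.eq⟩
  obtain ⟨f, ⟨hfc, hf0, hfr⟩, hmin⟩ := (measure d).wf.has_min T hT
  have hfirr : IsIrreducibleCentralIdempotent f := by
    refine ⟨hfc, hf0, fun g hg hgf => ?_⟩
    by_contra hcon
    push Not at hcon
    have hgT : g ∈ T := ⟨hg, hcon.1, by rw [← hgf, mul_assoc, hfr]⟩
    have hle : LinearMap.range (LinearMap.mulLeft ℚ g) ≤
        LinearMap.range (LinearMap.mulLeft ℚ f) := by
      rintro _ ⟨x, rfl⟩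
      refine ⟨g * x, ?_⟩
      simp only [LinearMap.mulLeft_apply]
      rw [← mul_assoc, hfc.central, hgf]
    have hlt : LinearMap.range (LinearMap.mulLeft ℚ g) <
        LinearMap.range (LinearMap.mulLeft ℚ f) := by
      refine lt_of_le_of_ne hle fun heq => hcon.2 ?_
      have : f ∈ LinearMap.range (LinearMap.mulLeft ℚ g) := by
        rw [heq]; exact ⟨1, by simp⟩
      obtain ⟨x, hx⟩ := this
      simp only [LinearMap.mulLeft_apply] at hx
      calc g = g * f := hgf.symm
        _ = g * (g * x) := by rw [hx]
        _ = f := by rw [← mul_assoc, hg.idem.eq, hx]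
    exact hmin g hgT (Submodule.finrank_lt_finrank_of_lt hlt)
  let i₀ : IrrIdem Γ := ⟨f, hfirr⟩
  have h1 : f * (∑ i : IrrIdem Γ, i.1) = f := by
    rw [Finset.mul_sum, Finset.sum_eq_single i₀]
    · exact hfc.idem.eq
    · intro j _ hj
      exact IrrIdem.mul_eq_zero (i := i₀) hj.symm
    · simp
  have : f * r = 0 := by rw [hr, mul_sub, mul_one, h1, sub_self]
  exact hf0 (hfr.symm.trans this)

/-- `e_{Γ/Γ'}` is the minimal central idempotent acting as the identity on the augmentation
representation. -/
theorem augIdem_spec (Γ' : Subgroup Γ) :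
    (∀ w ∈ augModule Γ', cosetAction Γ' (augIdem Γ') w = w) ∧
    ∀ f : MonoidAlgebra ℚ Γ, IsCentralIdempotent f →
      (∀ w ∈ augModule Γ', cosetAction Γ' f w = w) → f * augIdem Γ' = augIdem Γ' := by
  classical
  constructor
  · intro w hw
    conv_rhs => rw [show w = cosetAction Γ' 1 w by simp, ← sum_irrIdem]
    unfold augIdem
    rw [map_sum, map_sum, LinearMap.sum_apply, LinearMap.sum_apply]
    refine Finset.sum_congr rfl fun i _ => ?_
    split_ifs with h
    · rfl
    · push Not at h
      rw [h w hw]; simp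
  · intro f hf hw
    unfold augIdem
    rw [Finset.mul_sum]
    refine Finset.sum_congr rfl fun i _ => ?_
    split_ifs with h
    · obtain ⟨w, hwm, hne⟩ := h
      rcases i.2.minimal (f * i.1) (hf.mul i.2.toIsCentralIdempotent)
        (by rw [mul_assoc, i.mul_self]) with h0 | h1
      · exfalso
        apply hne
        have : cosetAction Γ' (i.1 * f) w = 0 := by
          rw [i.2.central, h0]; simp
        rwa [map_mul, Module.End.mul_apply, hw w hwm] at this
      · exact h1
    · simp

end GroupAlgebra

section Orders

/-- The localization `ℤ_S` of `ℤ` at the integers not divisible by any prime in `S`, as a subring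
of `ℚ`. -/
def ZS (S : Set Nat.Primes) : Subring ℚ where
  carrier := {q | ∀ p ∈ S, ¬ (p : ℕ) ∣ q.den}
  one_mem' := fun p _ h => p.2.one_lt.ne' (Nat.dvd_one.mp (by simpa using h))
  zero_mem' := fun p _ h => p.2.one_lt.ne' (Nat.dvd_one.mp (by simpa using h))
  mul_mem' {a b} ha hb := fun p hp h => by
    rcases p.2.dvd_mul.mp (h.trans (Rat.mul_den_dvd a b)) with h | h
    exacts [ha p hp h, hb p hp h]
  add_mem' {a b} ha hb := fun p hp h => by
    rcases p.2.dvd_mul.mp (h.trans (Rat.add_den_dvd a b)) with h | h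
    exacts [ha p hp h, hb p hp h]
  neg_mem' {a} ha := fun p hp h => ha p hp (by simpa using h)

variable {Γ : Type u} [Group Γ] [Fintype Γ]

variable (Γ) in
/-- The group ring `R[Γ]`, as a subring of `ℚ[Γ]`. -/
def intGroupRing (R : Subring ℚ) : Subring (MonoidAlgebra ℚ Γ) :=
  (MonoidAlgebra.mapRingHom Γ R.subtype).range

theorem mem_intGroupRing {R : Subring ℚ} {x : MonoidAlgebra ℚ Γ} :
    x ∈ intGroupRing Γ R ↔ ∀ g, x.coeff g ∈ R := by
  constructor
  · rintro ⟨y, rfl⟩ g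
    simp
  · intro h
    refine ⟨MonoidAlgebra.ofCoeff (Finsupp.equivFunOnFinite.symm fun g => ⟨x.coeff g, h g⟩), ?_⟩
    ext g
    simp

theorem single_mem_intGroupRing (R : Subring ℚ) (g : Γ) :
    MonoidAlgebra.single g (1 : ℚ) ∈ intGroupRing Γ R :=
  ⟨MonoidAlgebra.single g 1, by simp⟩

/-- `Λ` is an `R`-order, with identity element `e`, in the `ℚ`-algebra `eAe`
(which is `eA` if `e` is central). -/
structure IsOrderIn (R : Subring ℚ) {A : Type*} [Ring A] [Algebra ℚ A] (e : A)
    (Λ : Submodule R A) : Prop where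
  le_corner : ∀ x ∈ Λ, e * x = x ∧ x * e = x
  one_mem : e ∈ Λ
  mul_mem : ∀ x ∈ Λ, ∀ y ∈ Λ, x * y ∈ Λ
  fg : Λ.FG
  span_top : ∀ x : A, e * x * e = x → x ∈ Submodule.span ℚ (Λ : Set A)

/-- `Λ` is a maximal `R`-order in `eAe`. -/
structure IsMaximalOrderIn (R : Subring ℚ) {A : Type*} [Ring A] [Algebra ℚ A] (e : A)
    (Λ : Submodule R A) : Prop extends IsOrderIn R e Λ where
  maximal : ∀ Λ' : Submodule R A, IsOrderIn R e Λ' → Λ ≤ Λ' → Λ' = Λ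

/-- `eR[Γ]` as an `R`-submodule of `ℚ[Γ]`. -/
def idemLattice (R : Subring ℚ) (e : MonoidAlgebra ℚ Γ) : Submodule R (MonoidAlgebra ℚ Γ) where
  carrier := {y | ∃ x ∈ intGroupRing Γ R, y = e * x}
  zero_mem' := ⟨0, zero_mem _, by simp⟩
  add_mem' := by
    rintro _ _ ⟨x, hx, rfl⟩ ⟨y, hy, rfl⟩
    exact ⟨x + y, add_mem hx hy, by rw [mul_add]⟩
  smul_mem' := by
    rintro c _ ⟨x, hx, rfl⟩
    refine ⟨c • x, ?_, by rw [mul_smul_comm]⟩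
    rw [mem_intGroupRing] at hx ⊢
    exact fun g => R.mul_mem c.2 (hx g)

/-- The prime `p` is good for `e`: `e ∈ ℤ_(p)[Γ]` and `eℤ_(p)[Γ]` is a maximal `ℤ_(p)`-order
in `eℚ[Γ]`. -/
def IsGoodPrime (p : Nat.Primes) (e : MonoidAlgebra ℚ Γ) : Prop :=
  e ∈ intGroupRing Γ (ZS {p}) ∧ IsMaximalOrderIn (ZS {p}) e (idemLattice (ZS {p}) e)

theorem mem_of_good {S : Set Nat.Primes} {e : MonoidAlgebra ℚ Γ}
    (h : ∀ p ∈ S, IsGoodPrime p e) : e ∈ intGroupRing Γ (ZS S) := by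
  rw [mem_intGroupRing]
  intro g p hp
  exact mem_intGroupRing.mp (h p hp).1 g p rfl

/-- The ring `eR[Γ]`, a subring of the ring `eℚ[Γ]` (whose identity element is `e`). -/
def idemOrder (R : Subring ℚ) {e : MonoidAlgebra ℚ Γ} (he : IsCentralIdempotent e) :
    Subring he.idem.Corner where
  carrier := {y | ∃ x ∈ intGroupRing Γ R, y.1 = e * x}
  one_mem' := ⟨1, one_mem _, by rw [mul_one]; rfl⟩
  zero_mem' := ⟨0, zero_mem _, by rw [mul_zero]; rfl⟩
  add_mem' := by
    rintro a b ⟨x, hx, ha⟩ ⟨y, hy, hb⟩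
    exact ⟨x + y, add_mem hx hy, by rw [mul_add, ← ha, ← hb]; rfl⟩
  neg_mem' := by
    rintro a ⟨x, hx, ha⟩
    exact ⟨-x, neg_mem hx, by rw [mul_neg, ← ha]; rfl⟩
  mul_mem' := by
    rintro a b ⟨x, hx, ha⟩ ⟨y, hy, hb⟩
    refine ⟨x * y, mul_mem hx hy, ?_⟩
    change a.1 * b.1 = _
    rw [ha, hb, mul_assoc, ← mul_assoc x, ← he.central x, ← mul_assoc, ← mul_assoc, he.idem.eq,
      mul_assoc]

/-- The underlying element of `ℚ[Γ]`. -/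
def ambient {R : Subring ℚ} {e : MonoidAlgebra ℚ Γ} {he : IsCentralIdempotent e}
    (y : idemOrder R he) : MonoidAlgebra ℚ Γ := y.1.1

/-- The projection `R[Γ] → eR[Γ]`, `x ↦ ex`. -/
def toIdemOrder (R : Subring ℚ) {e : MonoidAlgebra ℚ Γ} (he : IsCentralIdempotent e) :
    intGroupRing Γ R →+* idemOrder R he where
  toFun x := ⟨⟨e * x.1, (Subsemigroup.mem_corner_iff he.idem).mpr
    ⟨by rw [← mul_assoc, he.idem.eq], by rw [← he.central, ← mul_assoc, he.idem.eq]⟩⟩,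
    ⟨x.1, x.2, rfl⟩⟩
  map_one' := Subtype.ext (Subtype.ext (mul_one e))
  map_zero' := Subtype.ext (Subtype.ext (mul_zero e))
  map_add' x y := Subtype.ext (Subtype.ext (mul_add e _ _))
  map_mul' x y := Subtype.ext (Subtype.ext (by
    change e * (x.1 * y.1) = (e * x.1) * (e * y.1)
    rw [mul_assoc, ← mul_assoc x.1, ← he.central x.1, ← mul_assoc e (e * x.1), ← mul_assoc e e,
      he.idem.eq, mul_assoc]))

theorem unitProd_idem {e : MonoidAlgebra ℚ Γ} (he : IsCentralIdempotent e) (Γ' : Subgroup Γ) :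
    IsIdempotentElem (e * unitIdem Γ') := by
  rw [IsIdempotentElem, mul_assoc, ← mul_assoc (unitIdem Γ'), ← he.central (unitIdem Γ'),
    mul_assoc e (unitIdem Γ'), unitIdem_idem, ← mul_assoc, he.idem.eq]

theorem unitIdem_mul_of_invariant {Γ' : Subgroup Γ} {y : MonoidAlgebra ℚ Γ}
    (h : ∀ γ ∈ Γ', MonoidAlgebra.single γ (1 : ℚ) * y = y) : unitIdem Γ' * y = y := by
  classical
  have hs : ∀ γ : Γ', MonoidAlgebra.single (γ : Γ) ((Nat.card Γ' : ℚ)⁻¹) * y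
      = ((Nat.card Γ' : ℚ)⁻¹) • y := by
    intro γ
    have : MonoidAlgebra.single (γ : Γ) ((Nat.card Γ' : ℚ)⁻¹)
        = ((Nat.card Γ' : ℚ)⁻¹) • MonoidAlgebra.single (γ : Γ) (1 : ℚ) := by simp
    rw [this, smul_mul_assoc, h _ γ.2]
  unfold unitIdem
  rw [Finset.sum_mul, Finset.sum_congr rfl (fun γ _ => hs γ), Finset.sum_const, Finset.card_univ,
    ← Nat.card_eq_fintype_card, ← Nat.cast_smul_eq_nsmul ℚ, smul_smul,
    mul_inv_cancel₀ (by exact_mod_cast Nat.card_pos.ne'), one_smul]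

/-- The ring `𝔬 = {}^{Γ'}(eR[Γ]e₁')` of elements of the form `exe₁'`, `x ∈ R[Γ]`, that are fixed by
left multiplication with `Γ'`. It is a subring of the `ℚ`-algebra `e₁'eℚ[Γ]e₁'`, whose identity
element is `ee₁'`. -/
def heckeOrder (R : Subring ℚ) {e : MonoidAlgebra ℚ Γ} (he : IsCentralIdempotent e)
    (Γ' : Subgroup Γ) : Subring (unitProd_idem he Γ').Corner where
  carrier := {y | (∃ x ∈ intGroupRing Γ R, y.1 = e * x * unitIdem Γ') ∧
    ∀ γ ∈ Γ', MonoidAlgebra.single γ (1 : ℚ) * y.1 = y.1}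
  one_mem' := ⟨⟨1, one_mem _, by rw [mul_one]; rfl⟩, fun γ hγ => by
    change _ * (e * unitIdem Γ') = e * unitIdem Γ'
    rw [← mul_assoc, ← he.central, mul_assoc, single_mul_unitIdem Γ' γ hγ]⟩
  zero_mem' := ⟨⟨0, zero_mem _, by rw [mul_zero, zero_mul]; rfl⟩, fun γ hγ => mul_zero _⟩
  add_mem' := by
    rintro a b ⟨⟨x, hx, ha⟩, ha'⟩ ⟨⟨y, hy, hb⟩, hb'⟩
    refine ⟨⟨x + y, add_mem hx hy, ?_⟩, fun γ hγ => ?_⟩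
    · rw [mul_add, add_mul, ← ha, ← hb]; rfl
    · change _ * (a.1 + b.1) = a.1 + b.1
      rw [mul_add, ha' γ hγ, hb' γ hγ]
  neg_mem' := by
    rintro a ⟨⟨x, hx, ha⟩, ha'⟩
    refine ⟨⟨-x, neg_mem hx, ?_⟩, fun γ hγ => ?_⟩
    · rw [mul_neg, neg_mul, ← ha]; rfl
    · change _ * (-a.1) = -a.1
      rw [mul_neg, ha' γ hγ]
  mul_mem' := by
    rintro a b ⟨⟨x, hx, ha⟩, ha'⟩ ⟨⟨y, hy, hb⟩, hb'⟩
    refine ⟨⟨x * y, mul_mem hx hy, ?_⟩, fun γ hγ => ?_⟩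
    · change a.1 * b.1 = _
      rw [ha, mul_assoc, unitIdem_mul_of_invariant hb', hb]
      have : e * x * (e * y * unitIdem Γ') = (e * e) * (x * y) * unitIdem Γ' := by
        simp only [mul_assoc]
        rw [← mul_assoc x e, ← he.central x, mul_assoc]
      rw [this, he.idem.eq]
    · change _ * (a.1 * b.1) = a.1 * b.1
      rw [← mul_assoc, ha' γ hγ]

end Orders

section SPart

variable {S : Set Nat.Primes} {G H : Type*} [AddCommGroup G] [AddCommGroup H]

variable (S G) in
/-- The `S`-part `G^S` of an abelian group: the elements killed by a positive integer all of whose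
prime factors lie in `S`. For finite `G` it is generated by the Sylow `p`-subgroups, `p ∈ S`. -/
def SPart : AddSubgroup G where
  carrier := {x | ∃ n : ℕ, n ≠ 0 ∧ (∀ p : Nat.Primes, (p : ℕ) ∣ n → p ∈ S) ∧ n • x = 0}
  zero_mem' := ⟨1, one_ne_zero, fun p h => absurd (Nat.dvd_one.mp h) p.2.one_lt.ne', by simp⟩
  add_mem' := by
    rintro a b ⟨n, hn, hnS, hna⟩ ⟨m, hm, hmS, hmb⟩
    refine ⟨n * m, mul_ne_zero hn hm, fun p h => ?_, ?_⟩
    · rcases p.2.dvd_mul.mp h with h | h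
      exacts [hnS p h, hmS p h]
    · rw [smul_add, mul_comm n m, mul_smul, hna, smul_zero, mul_comm m n, mul_smul, hmb,
        smul_zero, add_zero]
  neg_mem' := by
    rintro a ⟨n, hn, hnS, hna⟩
    exact ⟨n, hn, hnS, by rw [smul_neg, hna, neg_zero]⟩

/-- The homomorphism induced on `S`-parts. -/
def SPart.map (f : G →+ H) : SPart S G →+ SPart S H :=
  (f.comp (SPart S G).subtype).codRestrict (SPart S H) (by
    rintro ⟨x, n, hn, hnS, hx⟩
    exact ⟨n, hn, hnS, by
      rw [AddMonoidHom.comp_apply, ← map_nsmul]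
      simp [hx]⟩)

theorem SPart.coprime {n : ℕ} (hnS : ∀ p : Nat.Primes, (p : ℕ) ∣ n → p ∈ S) (q : ZS S) :
    Nat.Coprime n (q : ℚ).den := by
  rw [Nat.coprime_iff_gcd_eq_one]
  by_contra h
  obtain ⟨p, hp, hpd⟩ := Nat.exists_prime_and_dvd h
  exact q.2 ⟨p, hp⟩ (hnS ⟨p, hp⟩ (hpd.trans (Nat.gcd_dvd_left _ _)))
    (hpd.trans (Nat.gcd_dvd_right _ _))

theorem SPart.cancel (q : ZS S) {x y : SPart S G}
    (h : (q : ℚ).den • x = (q : ℚ).den • y) : x = y := by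
  obtain ⟨n, hn, hnS, hz⟩ := (x - y).2
  have hd : (q : ℚ).den • (x - y) = 0 := by rw [smul_sub, h, sub_self]
  have hn' : n • (x - y) = 0 := Subtype.ext (by simpa using hz)
  have h1 := addOrderOf_dvd_of_nsmul_eq_zero hd
  have h2 := addOrderOf_dvd_of_nsmul_eq_zero hn'
  have h3 : addOrderOf (x - y) = 1 :=
    Nat.eq_one_of_dvd_coprimes (SPart.coprime hnS q) h2 h1
  exact sub_eq_zero.mp (AddMonoid.addOrderOf_eq_one_iff.mp h3)

theorem SPart.exists_smul (q : ZS S) (x : SPart S G) :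
    ∃ y : SPart S G, (q : ℚ).den • y = (q : ℚ).num • x := by
  obtain ⟨n, hn, hnS, hz⟩ := x.2
  have hn' : (n : ℤ) • x = 0 := Subtype.ext (by simpa using hz)
  obtain ⟨a, b, hab⟩ := (Nat.isCoprime_iff_coprime.mpr (SPart.coprime hnS q))
  refine ⟨(b * (q : ℚ).num) • x, ?_⟩
  rw [← natCast_zsmul, smul_smul]
  have h2 : ((q : ℚ).den : ℤ) * (b * (q : ℚ).num)
      = (q : ℚ).num - ((q : ℚ).num * a) * (n : ℤ) := by
    linear_combination (q : ℚ).num * hab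
  rw [h2, sub_smul, mul_smul _ (n : ℤ), hn', smul_zero, sub_zero]

/-- The `ℤ_S`-module structure of an `S`-part: `(a/b)x` is the unique `y` with `by = ax`. -/
instance : SMul (ZS S) (SPart S G) := ⟨fun q x => (SPart.exists_smul q x).choose⟩

theorem SPart.smul_spec (q : ZS S) (x : SPart S G) :
    (q : ℚ).den • (q • x) = (q : ℚ).num • x := (SPart.exists_smul q x).choose_spec

theorem SPart.eq_smul {q : ZS S} {x y : SPart S G}
    (h : (q : ℚ).den • y = (q : ℚ).num • x) : y = q • x :=
  SPart.cancel q (h.trans (SPart.smul_spec q x).symm)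

instance : Module (ZS S) (SPart S G) where
  one_smul x := (SPart.eq_smul (by simp)).symm
  zero_smul x := (SPart.eq_smul (by simp)).symm
  smul_zero q := (SPart.eq_smul (by simp)).symm
  smul_add q x y := (SPart.eq_smul (by
    rw [smul_add, SPart.smul_spec, SPart.smul_spec, smul_add])).symm
  mul_smul q r x := by
    symm
    apply SPart.eq_smul
    apply SPart.cancel q
    apply SPart.cancel r
    have h1 := SPart.smul_spec q (r • x)
    have h2 := SPart.smul_spec r x
    have h3 := Rat.mul_num_den' (q : ℚ) (r : ℚ)
    simp only [← natCast_zsmul] at h1 h2 ⊢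
    calc ((r : ℚ).den : ℤ) • ((q : ℚ).den : ℤ) • (((q * r : ZS S) : ℚ).den : ℤ) • q • r • x
        = (((q * r : ZS S) : ℚ).den : ℤ) • ((r : ℚ).den : ℤ) • (((q : ℚ).den : ℤ) • q • r • x) := by
          simp only [smul_smul]; congr 1; ring
      _ = (((q * r : ZS S) : ℚ).den : ℤ) • (q : ℚ).num • (((r : ℚ).den : ℤ) • r • x) := by
          rw [h1]; simp only [smul_smul]; congr 1; ring
      _ = _ := by
          rw [h2]; simp only [smul_smul]; congr 1
          push_cast at h3 ⊢
          linarith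
  add_smul q r x := by
    symm
    apply SPart.eq_smul
    apply SPart.cancel q
    apply SPart.cancel r
    have h1 := SPart.smul_spec q x
    have h2 := SPart.smul_spec r x
    have h3 := Rat.add_num_den' (q : ℚ) (r : ℚ)
    simp only [← natCast_zsmul] at h1 h2 ⊢
    calc ((r : ℚ).den : ℤ) • ((q : ℚ).den : ℤ) • (((q + r : ZS S) : ℚ).den : ℤ) • (q • x + r • x)
        = (((q + r : ZS S) : ℚ).den : ℤ) • (((r : ℚ).den : ℤ) • (((q : ℚ).den : ℤ) • q • x)
            + ((q : ℚ).den : ℤ) • (((r : ℚ).den : ℤ) • r • x)) := by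
          simp only [smul_smul, smul_add]; congr 2 <;> ring
      _ = _ := by
          rw [h1, h2]; simp only [smul_smul, ← add_smul]; congr 1
          push_cast at h3 ⊢
          linarith

theorem SPart.map_smul (f : G →+ H) (q : ZS S) (x : SPart S G) :
    SPart.map f (q • x) = q • SPart.map f x :=
  SPart.eq_smul (by rw [← map_nsmul, SPart.smul_spec, map_zsmul])

end SPart

section Modules

variable {Γ : Type u} [Group Γ] [Fintype Γ] {R : Subring ℚ}

variable (Γ R) in
/-- The two descriptions of `R[Γ]`. -/
def groupRingEquiv : MonoidAlgebra R Γ ≃+* intGroupRing Γ R :=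
  RingEquiv.ofBijective (MonoidAlgebra.mapRingHom Γ R.subtype).rangeRestrict
    ⟨fun x y h => by
      ext g
      have h1 : MonoidAlgebra.mapRingHom Γ R.subtype x = MonoidAlgebra.mapRingHom Γ R.subtype y :=
        congrArg Subtype.val h
      simpa using congrArg (fun z => z.coeff g) h1, RingHom.rangeRestrict_surjective _⟩

/-- The `R[Γ]`-module attached to an `R`-linear action of `Γ`. -/
abbrev intGroupRingModule {M : Type*} [AddCommGroup M] [Module R M] (ρ : Representation R Γ M) :
    Module (intGroupRing Γ R) M :=
  Module.compHom M ((ρ.asAlgebraHom : MonoidAlgebra R Γ →+* Module.End R M).comp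
    (groupRingEquiv Γ R).symm.toRingHom)

variable {e : MonoidAlgebra ℚ Γ}

/-- The subgroup `eM` of an `R[Γ]`-module `M`, where `e ∈ R[Γ]`. -/
def idemPart (he : e ∈ intGroupRing Γ R) (M : Type*) [AddCommGroup M]
    [Module (intGroupRing Γ R) M] : AddSubgroup M :=
  (DistribSMul.toAddMonoidHom M (⟨e, he⟩ : intGroupRing Γ R)).range

/-- The inclusion of `eR[Γ]` in `R[Γ]`, where `e ∈ R[Γ]`. -/
def toGroupRing (he : e ∈ intGroupRing Γ R) {hc : IsCentralIdempotent e}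
    (y : idemOrder R hc) : intGroupRing Γ R :=
  ⟨ambient y, by
    obtain ⟨y, x, hx, hy⟩ := y
    change y.1 ∈ _
    rw [hy]
    exact mul_mem he hx⟩

theorem idemPart_smul_mem (he : e ∈ intGroupRing Γ R) (hc : IsCentralIdempotent e) {M : Type*}
    [AddCommGroup M] [Module (intGroupRing Γ R) M] (y : intGroupRing Γ R) {m : M}
    (hm : m ∈ idemPart he M) : y • m ∈ idemPart he M := by
  obtain ⟨m, rfl⟩ := hm
  refine ⟨y • m, ?_⟩
  simp only [DistribSMul.toAddMonoidHom_apply, smul_smul]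
  congr 1
  exact Subtype.ext (hc.central _)

/-- `eM` as a module over the ring `eR[Γ]`: elements of `eR[Γ] ⊆ R[Γ]` act as they do on `M`. -/
abbrev idemPartModule (he : e ∈ intGroupRing Γ R) (hc : IsCentralIdempotent e) (M : Type*)
    [AddCommGroup M] [Module (intGroupRing Γ R) M] : Module (idemOrder R hc) (idemPart he M) where
  smul y m := ⟨toGroupRing he y • m.1, idemPart_smul_mem he hc _ m.2⟩
  one_smul m := Subtype.ext (by
    obtain ⟨_, m, rfl⟩ := m
    change toGroupRing he (1 : idemOrder R hc) • ((⟨e, he⟩ : intGroupRing Γ R) • m) =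
      (⟨e, he⟩ : intGroupRing Γ R) • m
    rw [smul_smul]
    congr 1
    exact Subtype.ext hc.idem.eq)
  mul_smul y z m := Subtype.ext (mul_smul (toGroupRing he y)
    (toGroupRing he z) m.1)
  smul_zero y := Subtype.ext (smul_zero _)
  smul_add y a b := Subtype.ext (smul_add _ _ _)
  add_smul y z m := Subtype.ext (add_smul (toGroupRing he y)
    (toGroupRing he z) m.1)
  zero_smul m := Subtype.ext (zero_smul (intGroupRing Γ R) m.1)

variable {hc : IsCentralIdempotent e}

/-- The element `g ∈ Γ` of `R[Γ]`. -/
def groupElt (R : Subring ℚ) (g : Γ) : intGroupRing Γ R :=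
  ⟨MonoidAlgebra.single g 1, single_mem_intGroupRing R g⟩

/-- The fixed part `{}^{Γ'}G` of an `eR[Γ]`-module, on which `Γ` acts through
`R[Γ] → eR[Γ]`. -/
def fixedPart (R : Subring ℚ) (hc : IsCentralIdempotent e) (Γ' : Subgroup Γ) (G : Type*)
    [AddCommGroup G] [Module (idemOrder R hc) G] :
    AddSubgroup G where
  carrier := {x | ∀ γ ∈ Γ', toIdemOrder R hc (groupElt R γ) • x = x}
  zero_mem' := fun _ _ => smul_zero _
  add_mem' {a b} ha hb := fun γ hγ => by rw [smul_add, ha γ hγ, hb γ hγ]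
  neg_mem' {a} ha := fun γ hγ => by rw [smul_neg, ha γ hγ]

theorem coeff_sum_of_mul_unitIdem {Γ' : Subgroup Γ} {x : MonoidAlgebra ℚ Γ}
    (h : x * unitIdem Γ' = 0) (g : Γ) : ∑ γ : Γ, (open Classical in
      if g⁻¹ * γ ∈ Γ' then x.coeff γ else 0) = 0 := by
  classical
  have h1 := congrArg (fun z : MonoidAlgebra ℚ Γ => z.coeff g) h
  simp only [unitIdem, Finset.mul_sum, MonoidAlgebra.coeff_sum, Finsupp.finsetSum_apply,
    MonoidAlgebra.coeff_mul_single_apply, MonoidAlgebra.coeff_zero, Finsupp.coe_zero,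
    Pi.zero_apply, ← Finset.sum_mul] at h1
  have hn : ((Nat.card Γ' : ℚ)⁻¹) ≠ 0 := inv_ne_zero (by exact_mod_cast Nat.card_pos.ne')
  have h2 := (mul_eq_zero.mp h1).resolve_right hn
  rw [← Fintype.sum_equiv (Equiv.mulLeft g) (fun k => if k ∈ Γ' then x.coeff (g * k) else 0) _
    (fun k => by simp), ← Finset.sum_filter, Finset.sum_subtype (p := fun k => k ∈ Γ') _ (by simp),
    ← h2]
  exact Fintype.sum_equiv (Equiv.inv Γ') _ _ (fun k => by simp)

/-- An element of `eR[Γ]` killed by right multiplication with `e₁'` kills `Γ'`-fixed elements. -/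
theorem smul_eq_zero_of_mul_unitIdem {Γ' : Subgroup Γ} {G : Type*}
    (he : e ∈ intGroupRing Γ R) [AddCommGroup G] [Module (idemOrder R hc) G] {y : idemOrder R hc}
    (hy : ambient y * unitIdem Γ' = 0) {m : G} (hm : m ∈ fixedPart R hc Γ' G) : y • m = 0 := by
  classical
  let x : intGroupRing Γ R := toGroupRing he y
  have hyx : y = toIdemOrder R hc x := Subtype.ext (Subtype.ext
    ((Subsemigroup.mem_corner_iff hc.idem).mp y.1.2).1.symm)
  have hx := mem_intGroupRing.mp x.2
  let s : Γ → Γ := fun g => (QuotientGroup.mk g : Γ ⧸ Γ').out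
  have hs : ∀ g, (s g)⁻¹ * g ∈ Γ' := fun g =>
    QuotientGroup.eq.mp (QuotientGroup.out_eq' (QuotientGroup.mk g : Γ ⧸ Γ'))
  have hss : ∀ g t, s g = t ↔ s t = t ∧ t⁻¹ * g ∈ Γ' := by
    intro g t
    constructor
    · rintro rfl
      refine ⟨?_, hs g⟩
      change Quotient.out (QuotientGroup.mk (s g) : Γ ⧸ Γ') = s g
      rw [show (QuotientGroup.mk (s g) : Γ ⧸ Γ') = QuotientGroup.mk g from
        QuotientGroup.out_eq' _]
    · rintro ⟨h1, h2⟩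
      rw [← h1]
      change Quotient.out (QuotientGroup.mk g : Γ ⧸ Γ') = Quotient.out (QuotientGroup.mk t : Γ ⧸ Γ')
      rw [QuotientGroup.eq.mpr h2]
  let mon : Γ → Γ → intGroupRing Γ R := fun t g =>
    ⟨MonoidAlgebra.single t (x.1.coeff g), mem_intGroupRing.mpr fun k => by
      rw [MonoidAlgebra.coeff_single, Finsupp.single_apply]
      split_ifs
      exacts [hx g, R.zero_mem]⟩
  have hmon : ∀ g, toIdemOrder R hc (mon g g) • m = toIdemOrder R hc (mon (s g) g) • m := by
    intro g
    have h1 : mon g g = mon (s g) g * groupElt R ((s g)⁻¹ * g) :=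
      Subtype.ext (by simp [mon, groupElt])
    rw [h1, map_mul, mul_smul, hm _ (hs g)]
  have hsum : x = ∑ g, mon g g := by
    refine Subtype.ext (MonoidAlgebra.ext (Finsupp.ext fun k => ?_))
    rw [AddSubmonoidClass.coe_finsetSum]
    simp [mon]
  have hzero : ∑ g, mon (s g) g = 0 := by
    refine Subtype.ext (MonoidAlgebra.ext (Finsupp.ext fun t => ?_))
    rw [AddSubmonoidClass.coe_finsetSum]
    simp only [mon, MonoidAlgebra.coeff_sum, Finsupp.finsetSum_apply, MonoidAlgebra.coeff_single,
      Finsupp.single_apply]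
    change _ = (0 : ℚ)
    by_cases ht : s t = t
    · refine Eq.trans ?_ (coeff_sum_of_mul_unitIdem hy t)
      exact Finset.sum_congr rfl fun g _ =>
        if_congr ((hss g t).trans (and_iff_right ht)) rfl rfl
    · exact Finset.sum_eq_zero fun g _ => if_neg fun h => ht ((hss g t).mp h).1
  rw [hyx, hsum, map_sum, Finset.sum_smul, Finset.sum_congr rfl (fun g _ => hmon g),
    ← Finset.sum_smul, ← map_sum, hzero, map_zero, zero_smul]

/-- Every element of `𝔬` is of the form `σe₁'` with `σ ∈ eR[Γ]`. -/
theorem heckeOrder.exists_lift {Γ' : Subgroup Γ} (y : heckeOrder R hc Γ') :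
    ∃ σ : idemOrder R hc, ambient σ * unitIdem Γ' = y.1.1 := by
  obtain ⟨y, ⟨x, hx, hy⟩, -⟩ := y
  exact ⟨toIdemOrder R hc ⟨x, hx⟩, hy.symm⟩

/-- A choice of `σ ∈ eR[Γ]` with `y = σe₁'`. -/
def heckeOrder.lift {Γ' : Subgroup Γ} (y : heckeOrder R hc Γ') : idemOrder R hc :=
  (heckeOrder.exists_lift y).choose

theorem heckeOrder.lift_spec {Γ' : Subgroup Γ} (y : heckeOrder R hc Γ') :
    ambient (heckeOrder.lift y) * unitIdem Γ' = y.1.1 := (heckeOrder.exists_lift y).choose_spec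

theorem smul_eq_smul_of_mul_unitIdem {Γ' : Subgroup Γ} {G : Type*}
    (he : e ∈ intGroupRing Γ R) [AddCommGroup G] [Module (idemOrder R hc) G]
    {y z : idemOrder R hc} (h : ambient y * unitIdem Γ' = ambient z * unitIdem Γ') {m : G}
    (hm : m ∈ fixedPart R hc Γ' G) : y • m = z • m := by
  rw [← sub_eq_zero, ← sub_smul]
  refine smul_eq_zero_of_mul_unitIdem he ?_ hm
  change (ambient y - ambient z) * _ = 0
  rw [sub_mul, h, sub_self]

theorem heckeOrder.lift_smul_mem (he : e ∈ intGroupRing Γ R) {Γ' : Subgroup Γ} {G : Type*}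
    [AddCommGroup G] [Module (idemOrder R hc) G] (y : heckeOrder R hc Γ') {m : G}
    (hm : m ∈ fixedPart R hc Γ' G) : heckeOrder.lift y • m ∈ fixedPart R hc Γ' G := by
  intro γ hγ
  rw [smul_smul]
  refine smul_eq_smul_of_mul_unitIdem he ?_ hm
  change e * MonoidAlgebra.single γ 1 * ambient (heckeOrder.lift y) * unitIdem Γ' = _
  have hey : e * y.1.1 = y.1.1 := by
    have h1 := ((Subsemigroup.mem_corner_iff (unitProd_idem hc Γ')).mp y.1.2).1
    rw [← h1, ← mul_assoc, ← mul_assoc, hc.idem.eq]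
  rw [mul_assoc, heckeOrder.lift_spec, mul_assoc, y.2.2 γ hγ, hey]

theorem heckeOrder.lift_mul {Γ' : Subgroup Γ} (y z : heckeOrder R hc Γ') :
    ambient (heckeOrder.lift (y * z)) * unitIdem Γ' =
      ambient (heckeOrder.lift y * heckeOrder.lift z) * unitIdem Γ' := by
  have h1 : (y * z).1.1 = y.1.1 * z.1.1 := rfl
  have h2 : ambient (heckeOrder.lift y * heckeOrder.lift z)
      = ambient (heckeOrder.lift y) * ambient (heckeOrder.lift z) := rfl
  rw [heckeOrder.lift_spec, h1, h2, mul_assoc, heckeOrder.lift_spec, ← heckeOrder.lift_spec y,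
    mul_assoc, unitIdem_mul_of_invariant z.2.2]

theorem heckeOrder.lift_add {Γ' : Subgroup Γ} (y z : heckeOrder R hc Γ') :
    ambient (heckeOrder.lift (y + z)) * unitIdem Γ' =
      ambient (heckeOrder.lift y + heckeOrder.lift z) * unitIdem Γ' := by
  have h1 : (y + z).1.1 = y.1.1 + z.1.1 := rfl
  have h2 : ambient (heckeOrder.lift y + heckeOrder.lift z)
      = ambient (heckeOrder.lift y) + ambient (heckeOrder.lift z) := rfl
  rw [heckeOrder.lift_spec, h1, h2, add_mul, heckeOrder.lift_spec, heckeOrder.lift_spec]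

theorem heckeOrder.lift_one {Γ' : Subgroup Γ} :
    ambient (heckeOrder.lift (1 : heckeOrder R hc Γ')) * unitIdem Γ' =
      ambient (1 : idemOrder R hc) * unitIdem Γ' := heckeOrder.lift_spec 1

theorem heckeOrder.lift_zero {Γ' : Subgroup Γ} :
    ambient (heckeOrder.lift (0 : heckeOrder R hc Γ')) * unitIdem Γ' =
      ambient (0 : idemOrder R hc) * unitIdem Γ' :=
  (heckeOrder.lift_spec 0).trans (zero_mul (unitIdem Γ')).symm

section

variable (he : e ∈ intGroupRing Γ R) (Γ' : Subgroup Γ) (G : Type*)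
  [AddCommGroup G] [Module (idemOrder R hc) G]

/-- The fixed part `{}^{Γ'}G` of an `eR[Γ]`-module `G` as a module over `𝔬 = {}^{Γ'}(eR[Γ]e₁')`:
the element `σe₁'` of `𝔬`, with `σ ∈ eR[Γ]`, acts as `σ`. -/
abbrev fixedPartModule : Module (heckeOrder R hc Γ') (fixedPart R hc Γ' G) :=
  letI : SMul (heckeOrder R hc Γ') (fixedPart R hc Γ' G) :=
    ⟨fun y m => ⟨heckeOrder.lift y • m.1, heckeOrder.lift_smul_mem he y m.2⟩⟩
  { one_smul := fun m => Subtype.ext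
      ((smul_eq_smul_of_mul_unitIdem he heckeOrder.lift_one m.2).trans (one_smul _ m.1))
    mul_smul := fun y z m => Subtype.ext
      ((smul_eq_smul_of_mul_unitIdem he (heckeOrder.lift_mul y z) m.2).trans (mul_smul _ _ m.1))
    smul_zero := fun y => Subtype.ext (smul_zero _)
    smul_add := fun y a b => Subtype.ext (smul_add _ _ _)
    add_smul := fun y z m => Subtype.ext
      ((smul_eq_smul_of_mul_unitIdem he (heckeOrder.lift_add y z) m.2).trans (add_smul _ _ m.1))
    zero_smul := fun m => Subtype.ext
      ((smul_eq_smul_of_mul_unitIdem he heckeOrder.lift_zero m.2).trans (zero_smul _ m.1)) }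

end

end Modules

section RandomModules

/-- A finite module over a ring `O`. -/
structure FinMod (O : Type u) [Ring O] : Type (u + 1) where
  carrier : Type u
  [addCommGroup : AddCommGroup carrier]
  [module : Module O carrier]
  [finite : Finite carrier]

attribute [instance] FinMod.addCommGroup FinMod.module FinMod.finite

instance FinMod.setoid (O : Type u) [Ring O] : Setoid (FinMod O) where
  r M N := Nonempty (M.carrier ≃ₗ[O] N.carrier)
  iseqv := ⟨fun M => ⟨LinearEquiv.refl O _⟩, fun ⟨φ⟩ => ⟨φ.symm⟩, fun ⟨φ⟩ ⟨ψ⟩ => ⟨φ.trans ψ⟩⟩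

/-- The isomorphism classes of finite `O`-modules. -/
def FinModClass (O : Type u) [Ring O] : Type (u + 1) := Quotient (FinMod.setoid O)

/-- The isomorphism class of a finite `O`-module `M`. -/
def FinModClass.of (O : Type u) [Ring O] (M : Type u) [AddCommGroup M] [Module O M] [Finite M] :
    FinModClass O := Quotient.mk (FinMod.setoid O) ⟨M⟩

variable {A : Type u} [Ring A] (O : Subring A)

/-- The component `εM = (O ∩ εA)M` of an `O`-module `M` at a central idempotent `ε` of `A`.
(A maximal order contains every central idempotent.) -/
def component (ε : A) (M : Type*) [AddCommGroup M] [Module O M] : Submodule O M :=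
  Submodule.span O {m | ∃ x : O, ε * (x : A) = x ∧ ∃ g : M, m = x • g}

theorem component_map (ε : A) {M N : Type*} [AddCommGroup M] [Module O M] [AddCommGroup N]
    [Module O N] (φ : M ≃ₗ[O] N) :
    (component O ε M).map (φ : M →ₗ[O] N) = component O ε N := by
  unfold component
  rw [Submodule.map_span]
  congr 1
  ext n
  constructor
  · rintro ⟨_, ⟨x, hx, g, rfl⟩, rfl⟩
    exact ⟨x, hx, φ g, by simp⟩
  · rintro ⟨x, hx, g, rfl⟩
    exact ⟨x • φ.symm g, ⟨x, hx, _, rfl⟩, by simp⟩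

variable {ι : Type*} [Fintype ι] (ε : ι → A) (w : ι → ℚ)

/-- `|M|^w = ∏ᵢ |εᵢM|^{wᵢ}`. -/
def powCard (M : Type*) [AddCommGroup M] [Module O M] : ℝ :=
  ∏ i, (Nat.card (component O (ε i) M) : ℝ) ^ (w i : ℝ)

/-- The weight `1 / (|M|^w |Aut_O M|)` of a finite `O`-module. -/
def modWeight (M : FinMod O) : ℝ≥0∞ :=
  ENNReal.ofReal (1 / (powCard O ε w M.carrier * Nat.card (M.carrier ≃ₗ[O] M.carrier)))

/-- The weight as a function on isomorphism classes. -/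
def classWeight : FinModClass O → ℝ≥0∞ :=
  Quotient.lift (modWeight O ε w) (by
    rintro M N ⟨φ⟩
    have h1 : ∀ i, Nat.card (component O (ε i) M.carrier) =
        Nat.card (component O (ε i) N.carrier) := fun i => by
      rw [← component_map O (ε i) φ]
      exact Nat.card_congr (φ.submoduleMap (component O (ε i) M.carrier)).toEquiv
    have h2 : Nat.card (M.carrier ≃ₗ[O] M.carrier) = Nat.card (N.carrier ≃ₗ[O] N.carrier) :=
      Nat.card_congr
        { toFun := fun a => (φ.symm.trans a).trans φ
          invFun := fun a => (φ.trans a).trans φ.symm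
          left_inv := fun a => by ext; simp
          right_inv := fun a => by ext; simp }
    unfold modWeight powCard
    simp only [h1, h2])

/-- The probability that the random module `X(A, w, O)` lies in a given isomorphism class. Here
`O` is an order in the semisimple algebra `A` with irreducible central idempotents `εᵢ`; the
probabilities are proportional to `1 / (|M|^w |Aut_O M|)`. -/
def modProb (c : FinModClass O) : ℝ≥0∞ :=
  classWeight O ε w c / ∑' d, classWeight O ε w d

/-- The expected value `𝔼(f(X))` for the random module `X = X(A, w, O)`. -/
def modExpectation (f : FinModClass O → ℝ≥0) : ℝ≥0∞ :=
  ∑' c, (f c : ℝ≥0∞) * modProb O ε w c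

end RandomModules

section SpecificRandomModules

variable {Γ : Type u} [Group Γ] [Fintype Γ] {e : MonoidAlgebra ℚ Γ}

/-- The irreducible central idempotents `e_i` contained in the central idempotent `e`. -/
def Components (e : MonoidAlgebra ℚ Γ) : Set (IrrIdem Γ) := {i | i.1 * e = i.1}

instance : Fintype (Components e) := Fintype.ofFinite _

/-- The element `exe` of the ring `eAe`. -/
def toCorner {A : Type*} [Ring A] {e : A} (he : IsIdempotentElem e) (x : A) : he.Corner :=
  ⟨e * x * e, x, rfl⟩

/-- `𝔼(f(X))` for `X = X(eℚ[Γ], u, eℤ_S[Γ])`, where `u_i` belongs to the irreducible central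
idempotent `e_i = ee_ie` of `eℚ[Γ]`. -/
def expectationX (S : Set Nat.Primes) (he : IsCentralIdempotent e) (w : IrrIdem Γ → ℚ)
    (f : FinModClass (idemOrder (ZS S) he) → ℝ≥0) : ℝ≥0∞ :=
  modExpectation (idemOrder (ZS S) he) (fun i : Components e => toCorner he.idem i.1.1)
    (fun i => w i) f

/-- `𝔼(f(Y))` for `Y = Y(e₁'eℚ[Γ]e₁', v, 𝔬)`, where `v_i` belongs to the irreducible central
idempotent `e_ie₁' = (ee₁')e_i(ee₁')` of `e₁'eℚ[Γ]e₁'`. -/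
def expectationY (S : Set Nat.Primes) (he : IsCentralIdempotent e) (Γ' : Subgroup Γ)
    (w : IrrIdem Γ → ℚ) (f : FinModClass (heckeOrder (ZS S) he Γ') → ℝ≥0) : ℝ≥0∞ :=
  modExpectation (heckeOrder (ZS S) he Γ')
    (fun i : Components e => toCorner (unitProd_idem he Γ') i.1.1) (fun i => w i) f

instance {R : Subring ℚ} {he : IsCentralIdempotent e} (Γ' : Subgroup Γ)
    (G : Type*) [AddCommGroup G] [Module (idemOrder R he) G] [Finite G] :
    Finite (fixedPart R he Γ' G) := Subtype.finite

/-- The map `G ↦ {}^{Γ'}G` from isomorphism classes of finite `eR[Γ]`-modules to isomorphism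
classes of finite `𝔬`-modules. -/
def fixedClass {R : Subring ℚ} (heR : e ∈ intGroupRing Γ R) (he : IsCentralIdempotent e)
    (Γ' : Subgroup Γ) : FinModClass (idemOrder R he) → FinModClass (heckeOrder R he Γ') :=
  Quotient.map
    (fun G => letI := fixedPartModule (hc := he) heR Γ' G.carrier
      ⟨fixedPart R he Γ' G.carrier⟩) (by
    rintro G H ⟨φ⟩
    let _ := fixedPartModule (hc := he) heR Γ' G.carrier
    let _ := fixedPartModule (hc := he) heR Γ' H.carrier
    have h1 : ∀ x ∈ fixedPart R he Γ' G.carrier, φ x ∈ fixedPart R he Γ' H.carrier :=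
      fun x hx γ hγ => by rw [← map_smul, hx γ hγ]
    have h2 : ∀ x ∈ fixedPart R he Γ' H.carrier, φ.symm x ∈ fixedPart R he Γ' G.carrier :=
      fun x hx γ hγ => by rw [← map_smul, hx γ hγ]
    exact ⟨{ toFun := fun x => ⟨φ x.1, h1 x.1 x.2⟩
             map_add' := fun x y => Subtype.ext (map_add φ x.1 y.1)
             map_smul' := fun c x => Subtype.ext (map_smul φ (heckeOrder.lift c) x.1)
             invFun := fun x => ⟨φ.symm x.1, h2 x.1 x.2⟩
             left_inv := fun x => Subtype.ext (φ.symm_apply_apply x.1)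
             right_inv := fun x => Subtype.ext (φ.apply_symm_apply x.1) }⟩)

end SpecificRandomModules

section ClassGroups

open scoped nonZeroDivisors

/-- A homomorphism on the monoid of nonzero ideals that is trivial on principal ideals induces a
homomorphism on the class group. -/
def classGroupLift {A : Type*} [CommRing A] [IsDedekindDomain A] {H : Type*} [CommGroup H]
    (F : (Ideal A)⁰ →* H) (hF : ∀ I : (Ideal A)⁰, (I : Ideal A).IsPrincipal → F I = 1) :
    ClassGroup A →* H :=
  have key : ∀ I J : (Ideal A)⁰, ClassGroup.mk0 I = ClassGroup.mk0 J → F I = F J := by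
    intro I J h
    obtain ⟨x, y, hx, hy, hxy⟩ := ClassGroup.mk0_eq_mk0_iff.mp h
    let X : (Ideal A)⁰ := ⟨Ideal.span {x}, mem_nonZeroDivisors_iff_ne_zero.mpr (by simpa using hx)⟩
    let Y : (Ideal A)⁰ := ⟨Ideal.span {y}, mem_nonZeroDivisors_iff_ne_zero.mpr (by simpa using hy)⟩
    have h1 : X * I = Y * J := Subtype.ext hxy
    have h2 := congrArg F h1
    rwa [map_mul, map_mul, hF X ⟨x, rfl⟩, hF Y ⟨y, rfl⟩, one_mul, one_mul] at h2
  { toFun := fun c => F (ClassGroup.mk0_surjective c).choose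
    map_one' := by
      rw [key _ 1 ((ClassGroup.mk0_surjective (1 : ClassGroup A)).choose_spec.trans
        (map_one _).symm), map_one]
    map_mul' := fun c d => by
      rw [← map_mul]
      apply key
      rw [map_mul, (ClassGroup.mk0_surjective (c * d)).choose_spec,
        (ClassGroup.mk0_surjective c).choose_spec, (ClassGroup.mk0_surjective d).choose_spec] }

theorem classGroupLift_mk0 {A : Type*} [CommRing A] [IsDedekindDomain A] {H : Type*} [CommGroup H]
    (F : (Ideal A)⁰ →* H) (hF : ∀ I : (Ideal A)⁰, (I : Ideal A).IsPrincipal → F I = 1)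
    (I : (Ideal A)⁰) : classGroupLift F hF (ClassGroup.mk0 I) = F I := by
  obtain ⟨x, y, hx, hy, hxy⟩ := ClassGroup.mk0_eq_mk0_iff.mp
    (ClassGroup.mk0_surjective (ClassGroup.mk0 I)).choose_spec
  let X : (Ideal A)⁰ := ⟨Ideal.span {x}, mem_nonZeroDivisors_iff_ne_zero.mpr (by simpa using hx)⟩
  let Y : (Ideal A)⁰ := ⟨Ideal.span {y}, mem_nonZeroDivisors_iff_ne_zero.mpr (by simpa using hy)⟩
  have h1 : X * (ClassGroup.mk0_surjective (ClassGroup.mk0 I)).choose = Y * I := Subtype.ext hxy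
  have h2 := congrArg F h1
  rwa [map_mul, map_mul, hF X ⟨x, rfl⟩, hF Y ⟨y, rfl⟩, one_mul, one_mul] at h2

/-- A ring automorphism `σ` of a Dedekind domain acts on nonzero ideals by `I ↦ σ(I)`. -/
def idealAut {A : Type*} [CommRing A] [IsDedekindDomain A] (σ : A ≃+* A) :
    (Ideal A)⁰ →* (Ideal A)⁰ where
  toFun I := ⟨Ideal.map (σ : A →+* A) I.1, mem_nonZeroDivisors_iff_ne_zero.mpr
    ((Ideal.map_eq_bot_iff_of_injective σ.injective).not.mpr (nonZeroDivisors.ne_zero I.2))⟩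
  map_one' := Subtype.ext (by simp [Ideal.one_eq_top, Ideal.map_top])
  map_mul' I J := Subtype.ext (Ideal.map_mul _ _ _)

/-- The action of a ring automorphism on the class group. -/
def classAut {A : Type*} [CommRing A] [IsDedekindDomain A] (σ : A ≃+* A) :
    ClassGroup A →* ClassGroup A :=
  classGroupLift (ClassGroup.mk0.comp (idealAut σ)) (by
    rintro I ⟨x, hx⟩
    refine (ClassGroup.mk0_eq_one_iff _).mpr ⟨σ x, ?_⟩
    change Ideal.map (σ : A →+* A) I.1 = _
    rw [hx, Ideal.submodule_span_eq, Ideal.map_span, Set.image_singleton]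
    rfl)

theorem classAut_mk0 {A : Type*} [CommRing A] [IsDedekindDomain A] (σ : A ≃+* A) (I : (Ideal A)⁰) :
    classAut σ (ClassGroup.mk0 I) = ClassGroup.mk0 (idealAut σ I) :=
  classGroupLift_mk0 _ _ I

variable (A B : Type*) [CommRing A] [IsDedekindDomain A] [CommRing B] [IsDedekindDomain B]
  [Algebra A B] [Module.Finite A B] [Module.IsTorsionFree A B]

/-- The relative norm on nonzero ideals. -/
def idealNorm : (Ideal B)⁰ →* (Ideal A)⁰ where
  toFun I := ⟨Ideal.relNorm A I.1, mem_nonZeroDivisors_iff_ne_zero.mpr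
    (Ideal.relNorm_eq_bot_iff.not.mpr (nonZeroDivisors.ne_zero I.2))⟩
  map_one' := Subtype.ext (map_one _)
  map_mul' I J := Subtype.ext (map_mul _ _ _)

/-- The norm homomorphism on class groups. -/
def classNorm : ClassGroup B →* ClassGroup A :=
  classGroupLift (ClassGroup.mk0.comp (idealNorm A B)) (by
    rintro I ⟨x, hx⟩
    refine (ClassGroup.mk0_eq_one_iff _).mpr ⟨Algebra.intNorm A B x, ?_⟩
    change Ideal.relNorm A I.1 = _
    rw [hx, Ideal.submodule_span_eq, Ideal.relNorm_singleton])

end ClassGroups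

section Characters

variable {Γ : Type u} [Group Γ] [Fintype Γ]

/-- The inner product `⟨α, β⟩ = |Γ|⁻¹ ∑ α(g) conj(β(g))` of class functions. -/
def charInner (α β : Γ → ℂ) : ℂ :=
  (Nat.card Γ : ℂ)⁻¹ * ∑ g, α g * starRingEnd ℂ (β g)

/-- The character `Ind_H^Γ 1_H` of the permutation representation of `Γ` on `Γ/H`. -/
def permChar (H : Subgroup Γ) (g : Γ) : ℂ := Nat.card (MulAction.fixedBy (Γ ⧸ H) g)

/-- The augmentation character `a_{Γ/H} = Ind_H^Γ 1_H - 1_Γ`. For `H = ⊥` it is `a_Γ`. -/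
def augChar (H : Subgroup Γ) (g : Γ) : ℂ := permChar H g - 1

/-- `χ` is the character of the irreducible `ℚ`-representation of `Γ` that corresponds to the
irreducible central idempotent `i` of `ℚ[Γ]`, i.e. on which `i` acts as the identity. -/
def IsRationalCharOf (i : IrrIdem Γ) (χ : Γ → ℂ) : Prop :=
  ∃ (n : ℕ) (ρ : Representation ℚ Γ (Fin n → ℚ)), ρ.IsIrreducible ∧ ρ.asAlgebraHom i.1 = 1 ∧
    ∀ g, χ g = (ρ.character g : ℂ)

/-- `φ` is an absolutely irreducible character of `Γ`. -/
def IsAbsIrrChar (φ : Γ → ℂ) : Prop :=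
  ∃ (n : ℕ) (ρ : Representation ℂ Γ (Fin n → ℂ)), ρ.IsIrreducible ∧ ∀ g, φ g = ρ.character g

/-- `φ` is an absolutely irreducible character contained in the rational character `χ_i`. -/
def IsConstituent (i : IrrIdem Γ) (φ : Γ → ℂ) : Prop :=
  IsAbsIrrChar φ ∧ ∃ χ, IsRationalCharOf i χ ∧ charInner χ φ ≠ 0

/-- The number `h_i` with `h_i² = dim_{K_i} A_i`, where `K_i` is the center of `A_i = e_iℚ[Γ]`. -/
def hNum (i : IrrIdem Γ) : ℕ :=
  Nat.sqrt (Module.finrank (Subring.center i.2.idem.Corner) i.2.idem.Corner)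

end Characters

section Extensions

/-- A `Γ`-extension `(L, τ)` of `K₀`: a finite Galois extension `L` with an isomorphism
`τ : Gal(L/K₀) ≃ Γ`. -/
structure GammaExt (Γ : Type u) [Group Γ] (K₀ : Type u) [Field K₀] : Type (u + 1) where
  L : Type u
  [field : Field L]
  [algebra : Algebra K₀ L]
  [finite : FiniteDimensional K₀ L]
  [galois : IsGalois K₀ L]
  τ : Gal(L/K₀) ≃* Γ

attribute [instance] GammaExt.field GammaExt.algebra GammaExt.finite GammaExt.galois

variable (Γ : Type u) [Group Γ] (K₀ : Type u) [Field K₀]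

/-- An isomorphism `(L, τ) ≅ (L', τ')` is a `K₀`-isomorphism `α : L ≃ L'` such that
`τ'(α ∘ φ ∘ α⁻¹) = τ(φ)` for all `φ`. -/
instance GammaExt.setoid : Setoid (GammaExt Γ K₀) where
  r E F := ∃ α : E.L ≃ₐ[K₀] F.L, ∀ φ : Gal(E.L/K₀), F.τ (AlgEquiv.autCongr α φ) = E.τ φ
  iseqv :=
    { refl := fun E => ⟨AlgEquiv.refl, fun φ => rfl⟩
      symm := by
        rintro E F ⟨α, hα⟩
        exact ⟨α.symm, fun φ => by
          rw [← hα, ← AlgEquiv.autCongr_symm, MulEquiv.apply_symm_apply]⟩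
      trans := by
        rintro E F H ⟨α, hα⟩ ⟨β, hβ⟩
        exact ⟨α.trans β, fun φ => by
          rw [← AlgEquiv.autCongr_trans, MulEquiv.trans_apply, hβ, hα]⟩ }

/-- The isomorphism classes of `Γ`-extensions of `K₀`. -/
def GammaExtClass : Type (u + 1) := Quotient (GammaExt.setoid Γ K₀)

variable {Γ K₀}

/-- A representative of an isomorphism class of `Γ`-extensions. -/
def GammaExtClass.rep (c : GammaExtClass Γ K₀) : GammaExt Γ K₀ := Quotient.out c

variable [NumberField K₀]

instance (E : GammaExt Γ K₀) : NumberField E.L := NumberField.of_module_finite K₀ E.L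

namespace GammaExt

variable [Fintype Γ] (E : GammaExt Γ K₀)

/-- A decomposition group `Γ_v ⊆ Γ` at an infinite place `v` of `K₀`: the stabilizer of a place of
`L` above `v`. It is well defined up to conjugation. -/
def decompGroup (v : InfinitePlace K₀) : Subgroup Γ :=
  (MulAction.stabilizer Gal(E.L/K₀)
    (InfinitePlace.comap_surjective (k := K₀) (K := E.L) v).choose).map E.τ.toMonoidHom

/-- The character `χ_L = -1 + ∑_{v ∣ ∞} Ind_{Γ_v}^Γ 1`. -/
def placeChar (g : Γ) : ℂ := -1 + ∑ v : InfinitePlace K₀, permChar (E.decompGroup v) g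

/-- The coordinates in `I` of the rank of `L/K₀` are given by `w`: for `e_i ∈ I` the coordinate of
the rank is `⟨χ_L, φ_i⟩ / h_i`. -/
def HasRankOn (φ : IrrIdem Γ → Γ → ℂ) (I : Set (IrrIdem Γ)) (w : IrrIdem Γ → ℚ) : Prop :=
  ∀ i ∈ I, (w i : ℂ) = charInner E.placeChar (φ i) / (hNum i : ℂ)

/-- The fixed field `K = L^{Γ'}`. -/
abbrev fixedField (Γ' : Subgroup Γ) : IntermediateField K₀ E.L :=
  IntermediateField.fixedField (Γ'.comap E.τ.toMonoidHom)

/-- The `S`-part `Cl_L^S` of the class group of `L`. -/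
abbrev ClS (S : Set Nat.Primes) : Type u := SPart S (Additive (ClassGroup (𝓞 E.L)))

/-- The action of `g ∈ Γ` on the `S`-part of the class group of `L`. -/
def clAction (S : Set Nat.Primes) : Representation (ZS S) Γ (E.ClS S) where
  toFun g :=
    { toFun := SPart.map (MonoidHom.toAdditive
        (classAut (RingOfIntegers.mapRingEquiv (E.τ.symm g : E.L ≃+* E.L))))
      map_add' := map_add _
      map_smul' := SPart.map_smul _ }
  map_one' := by
    refine LinearMap.ext fun x => Subtype.ext (?_ : classAut _ (Additive.toMul x.1) = x.1)
    obtain ⟨I, hI⟩ := ClassGroup.mk0_surjective (Additive.toMul x.1)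
    rw [← hI, classAut_mk0]
    refine (congrArg ClassGroup.mk0 (Subtype.ext ?_)).trans hI
    change Ideal.map _ I.1 = I.1
    rw [map_one]
    exact Ideal.map_id I.1
  map_mul' g h := by
    refine LinearMap.ext fun x => Subtype.ext
      (?_ : classAut _ (Additive.toMul x.1) = classAut _ (classAut _ (Additive.toMul x.1)))
    obtain ⟨I, hI⟩ := ClassGroup.mk0_surjective (Additive.toMul x.1)
    rw [← hI, classAut_mk0, classAut_mk0, classAut_mk0]
    refine congrArg ClassGroup.mk0 (Subtype.ext ?_)
    change Ideal.map _ I.1 = Ideal.map _ (Ideal.map _ I.1)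
    rw [Ideal.map_map, map_mul]
    rfl

instance (S : Set Nat.Primes) : Module (intGroupRing Γ (ZS S)) (E.ClS S) :=
  intGroupRingModule (E.clAction S)

variable {e : MonoidAlgebra ℚ Γ} {S : Set Nat.Primes}

instance (S : Set Nat.Primes) : Finite (E.ClS S) := Subtype.finite

instance (he : e ∈ intGroupRing Γ (ZS S)) : Finite (idemPart he (E.ClS S)) := Subtype.finite

/-- The isomorphism class of the finite `eℤ_S[Γ]`-module `eCl_L^S`. -/
def clClass (heS : e ∈ intGroupRing Γ (ZS S)) (he : IsCentralIdempotent e) :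
    FinModClass (idemOrder (ZS S) he) :=
  letI := idemPartModule heS he (E.ClS S)
  FinModClass.of (idemOrder (ZS S) he) (idemPart heS (E.ClS S))

/-- The relative class group `Cl_{K/K₀}` of `K = L^{Γ'}`: the ideal classes with trivial norm. -/
abbrev RelCl (Γ' : Subgroup Γ) : Subgroup (ClassGroup (𝓞 (E.fixedField Γ'))) :=
  (classNorm (𝓞 K₀) (𝓞 (E.fixedField Γ'))).ker

/-- The `S`-part `Cl_{K/K₀}^S` of the relative class group. -/
abbrev RelClS (S : Set Nat.Primes) (Γ' : Subgroup Γ) : Type u :=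
  SPart S (Additive (E.RelCl Γ'))

instance (S : Set Nat.Primes) (Γ' : Subgroup Γ) : Finite (E.RelClS S Γ') := Subtype.finite

/-- The homomorphism `i_* : Cl_{K/K₀}^S → Cl_L^S` induced by extension of ideals. -/
def extend (S : Set Nat.Primes) (Γ' : Subgroup Γ) : E.RelClS S Γ' →+ E.ClS S :=
  SPart.map (MonoidHom.toAdditive
    ((ClassGroup.extendedHom (𝓞 (E.fixedField Γ')) (𝓞 E.L)).comp (E.RelCl Γ').subtype))

/-- The subgroup `{}^{Γ'}(eCl_L^S)` of `Cl_L^S`. -/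
def fixedCl (heS : e ∈ intGroupRing Γ (ZS S)) (he : IsCentralIdempotent e) (Γ' : Subgroup Γ) :
    AddSubgroup (E.ClS S) :=
  letI := idemPartModule heS he (E.ClS S)
  (fixedPart (ZS S) he Γ' (idemPart heS (E.ClS S))).map (idemPart heS (E.ClS S)).subtype

/-- `i_*` is an isomorphism from `Cl_{K/K₀}^S` onto `{}^{Γ'}(eCl_L^S)`. -/
def ExtendIso (heS : e ∈ intGroupRing Γ (ZS S)) (he : IsCentralIdempotent e)
    (Γ' : Subgroup Γ) : Prop :=
  Function.Injective (E.extend S Γ') ∧ (E.extend S Γ').range = E.fixedCl heS he Γ'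

/-- The isomorphism of `Cl_{K/K₀}^S` with `{}^{Γ'}(eCl_L^S)` given by `i_*`. -/
def extendEquiv (heS : e ∈ intGroupRing Γ (ZS S)) (he : IsCentralIdempotent e) (Γ' : Subgroup Γ)
    (h : E.ExtendIso heS he Γ') :
    letI := idemPartModule heS he (E.ClS S)
    E.RelClS S Γ' ≃+ fixedPart (ZS S) he Γ' (idemPart heS (E.ClS S)) :=
  letI := idemPartModule heS he (E.ClS S)
  ((AddMonoidHom.ofInjective h.1).trans (AddEquiv.addSubgroupCongr h.2)).trans
    (AddSubgroup.equivMapOfInjective _ _ Subtype.val_injective).symm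

/-- The isomorphism class of `Cl_{K/K₀}^S`, `K = L^{Γ'}`, as an `𝔬`-module: the `𝔬`-module structure
is the one for which `i_* : Cl_{K/K₀}^S → {}^{Γ'}(eCl_L^S)` is an isomorphism of `𝔬`-modules.
(If `i_*` were not an isomorphism, the value would be the class of the zero module.) -/
def relClass (heS : e ∈ intGroupRing Γ (ZS S)) (he : IsCentralIdempotent e) (Γ' : Subgroup Γ) :
    FinModClass (heckeOrder (ZS S) he Γ') :=
  open Classical in
  if h : E.ExtendIso heS he Γ' then
    letI := idemPartModule heS he (E.ClS S)
    letI := fixedPartModule heS Γ' (idemPart heS (E.ClS S))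
    letI := (E.extendEquiv heS he Γ' h).module (heckeOrder (ZS S) he Γ')
    FinModClass.of (heckeOrder (ZS S) he Γ') (E.RelClS S Γ')
  else FinModClass.of (heckeOrder (ZS S) he Γ') PUnit

end GammaExt

section Averages

variable [Fintype Γ]

/-- The average of `F` over the `Γ`-extensions `L/K₀` (up to isomorphism) with `P L` and
`|d_L| ≤ x`. The function `F` and the condition `P` are to be isomorphism invariant. -/
def average (P : GammaExt Γ K₀ → Prop) (F : GammaExt Γ K₀ → ℝ≥0∞) (x : ℝ) : ℝ≥0∞ :=
  (∑' c : {c : GammaExtClass Γ K₀ // P c.rep ∧ (|NumberField.discr c.rep.L| : ℝ) ≤ x}, F c.1.rep) /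
    ∑' _ : {c : GammaExtClass Γ K₀ // P c.rep ∧ (|NumberField.discr c.rep.L| : ℝ) ≤ x}, 1

/-- The prediction of Cohen and Martinet for the central idempotent `e`, the set of primes `S`, the
function `f` and the rank `w`: over the `Γ`-extensions `L/K₀` whose rank has coordinates `w_i` at
the `e_i` in `I`, the average of `f(eCl_L^S)` is the expected value of `f(X)`,
`X = X(eℚ[Γ], w, eℤ_S[Γ])`. -/
def CohenMartinetPrediction (K₀ : Type u) [Field K₀] [NumberField K₀] (φ : IrrIdem Γ → Γ → ℂ)
    (e : MonoidAlgebra ℚ Γ) (S : Set Nat.Primes)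
    (heS : e ∈ intGroupRing Γ (ZS S)) (he : IsCentralIdempotent e) (I : Set (IrrIdem Γ))
    (w : IrrIdem Γ → ℚ) (f : FinModClass (idemOrder (ZS S) he) → ℝ≥0) : Prop :=
  Tendsto (average (fun L : GammaExt Γ K₀ => L.HasRankOn φ I w)
    (fun L => (f (L.clClass heS he) : ℝ≥0∞))) atTop (𝓝 (expectationX S he w f))

/-- `v` is the rank of `L^{Γ'}/K₀`, where `w` is the rank of the `Γ`-extension `L/K₀`:
`v_i = (⟨φ_i, a_Γ⟩ / ⟨φ_i, a_{Γ/Γ'}⟩) w_i` for the `e_i` in `e_{Γ/Γ'}`. -/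
def IsFixedFieldRank (φ : IrrIdem Γ → Γ → ℂ) (Γ' : Subgroup Γ) (w v : IrrIdem Γ → ℚ) : Prop :=
  ∀ i ∈ Components (augIdem Γ'),
    (v i : ℂ) = charInner (φ i) (augChar ⊥) / charInner (φ i) (augChar Γ') * (w i : ℂ)

end Averages

end Extensions

end CohenMartinet

end

open CohenMartinet

/-! Write B = ℤ_S[Γ], A = ℚ[Γ] and e = e_{Γ/Γ'}. The theorem rests on two independent facts: the
functor G ↦ {}^{Γ'}G carries the random module X to Y, and the relative class group is
{}^{Γ'}(eCl_L^S).

Modules. If |Γ'| were invertible in ℤ_S, then taking Γ'-fixed elements would be multiplication by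
e₁'. In general e₁' is not integral, but maximality of eB supplies an idempotent c ∈ eB with γc = c
for γ ∈ Γ' and ce₁' = ee₁' (`exists_localIdempotent`): left ideals of finite index containing 1 - e
are projective, and c is read off from a splitting. Then cG = {}^{Γ'}G for every eB-module G, and 𝔬
is the corner ring cBc through xe₁' ↔ xc. Moreover BcB = eB (`exists_full_of_localIdempotent`),
because BcB + B(1 - e) is an idempotent two-sided ideal containing a nonzero integer, and such an
ideal is invertible, hence equal to B. So eB and 𝔬 are Morita equivalent: G ↦ {}^{Γ'}G is bijective
on isomorphism classes of finite modules and preserves the number of automorphisms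
(`fixedClass_bijective`, `card_aut_fixedPart`).

Weights. The left ideals Ae_ic and Ae_i are powers of the same simple module, so (Ae_ic)^a ≅
(Ae_i)^b for some positive a, b. The lattices (Be_ic)^a and (Be_i)^b are then commensurable
projective modules, and over an order that is hereditary at e such modules have equally many
homomorphisms to a finite module (`IsHereditaryAt.card_linearMap_of_comp_eq_natCast`). As Hom(Bz, G)
= zG for an idempotent z, this says |e_i({}^{Γ'}G)|^a = |e_iG|^b. Applied to a representation with
character φ_i, the same isomorphism gives a⟨φ_i, a_{Γ/Γ'}⟩ = b⟨φ_i, a_Γ⟩, that is bv_i = au_i. Hence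
the weights of G and {}^{Γ'}G agree (`powCard_fixedPart`), and so do the expected values
(`expectation_fixedClass`).

Class groups. The coefficients of c, like those of e, have sum 1 - |Γ'|/|Γ| over the coset Γ' and
-|Γ'|/|Γ| over every other left coset. Clearing denominators yields exponents a(g) ≥ 0 and an
integer d prime to S (`exists_coset_weights`) such that y ↦ ∏ N_{L/K}(gy)^{a(g)} composed with i_*,
in either order, is the d-th power up to classes coming from norms to K₀. These disappear on the
groups in question, and d is invertible on S-parts, so i_* is an isomorphism (`extendIso`). The
averages in the hypothesis and in the conclusion are therefore the same function of x. -/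

noncomputable section

namespace CohenMartinet

/-! ### Subrings of ℚ and their residue rings -/

section RationalSubring

variable (R : Subring ℚ)

/-- By Bézout the inverse of the denominator is an integral combination of `q` and `1`. So a subring
of ℚ is obtained from ℤ by inverting denominators, and questions about it reduce to integers. -/
theorem inv_den_mem {q : ℚ} (hq : q ∈ R) : ((q.den : ℚ))⁻¹ ∈ R := by
  obtain ⟨a, b, hab⟩ : IsCoprime q.num (q.den : ℤ) := Rat.isCoprime_num_den q
  have hd : (q.den : ℚ) ≠ 0 := by exact_mod_cast q.den_nz
  have h1 : ((q.den : ℚ))⁻¹ = (a : ℚ) * q + (b : ℚ) := by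
    have h2 : (a : ℚ) * q.num + b * q.den = 1 := by exact_mod_cast hab
    have h3 : q * q.den = q.num := Rat.mul_den_eq_num q
    field_simp
    rw [← h2, ← h3]; ring
  rw [h1]
  exact R.add_mem (R.mul_mem (intCast_mem R a) hq) (intCast_mem R b)

instance isFractionRing_subring : IsFractionRing R ℚ :=
  IsFractionRing.of_field R ℚ fun z => ⟨⟨z.num, intCast_mem R _⟩, ⟨z.den, natCast_mem R _⟩, by
    change z = (z.num : ℚ) / (z.den : ℚ)
    exact (Rat.num_div_den z).symm⟩

/-- Denominators are units, so an ideal is generated by its intersection with ℤ. Principality makes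
lattices over `R` free, which the double dual below needs. -/
instance isPrincipalIdealRing_subring : IsPrincipalIdealRing R := by
  refine ⟨fun I => ?_⟩
  let J : Ideal ℤ := I.comap (Int.castRingHom R)
  obtain ⟨a, ha⟩ := (IsPrincipalIdealRing.principal J).principal
  refine ⟨((a : ℤ) : R), le_antisymm (fun r hr => ?_) ?_⟩
  · have hnum : r.1.num ∈ J := by
      change ((r.1.num : ℤ) : R) ∈ I
      have : ((r.1.num : ℤ) : R) = (r.1.den : R) * r := Subtype.ext (by
        push_cast; rw [mul_comm]; exact (Rat.mul_den_eq_num r.1).symm)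
      rw [this]
      exact I.mul_mem_left _ hr
    rw [ha] at hnum
    obtain ⟨k, hk⟩ := Submodule.mem_span_singleton.mp hnum
    refine Submodule.mem_span_singleton.mpr ⟨⟨k * (r.1.den : ℚ)⁻¹,
      R.mul_mem (intCast_mem R k) (inv_den_mem R r.2)⟩, Subtype.ext ?_⟩
    change (k : ℚ) * (r.1.den : ℚ)⁻¹ * ((a : R) : ℚ) = r.1
    have h2 : (k : ℚ) * (a : ℚ) = r.1.num := by exact_mod_cast hk
    rw [show (((a : ℤ) : R) : ℚ) = (a : ℚ) by push_cast; rfl]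
    rw [mul_right_comm, h2, ← div_eq_mul_inv, Rat.num_div_den]
  · rw [Submodule.span_singleton_le_iff_mem]
    have : a ∈ J := by rw [ha]; exact Submodule.mem_span_singleton_self a
    exact this

/-- The powers of a denominator repeat modulo `a`, so its inverse is congruent to one of its powers
and every fraction to an integer. This is the source of finiteness for quotients of `R[Γ]` in which
a nonzero integer vanishes. -/
theorem exists_nat_residue (a : ℕ) (ha : a ≠ 0) (r : R) :
    ∃ k : ℕ, k < a ∧ ∃ s : R, r = (k : R) + (a : R) * s := by
  let I : Ideal R := Ideal.span {(a : R)}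
  let π := Ideal.Quotient.mk I
  have hint : ∀ z : ℤ, ∃ k : ℕ, k < a ∧ π (z : R) = π (k : R) := by
    intro z
    refine ⟨(z % a).toNat, ?_, ?_⟩
    · have := Int.emod_lt_of_pos z (b := (a : ℤ)) (by omega)
      have := Int.emod_nonneg z (b := (a : ℤ)) (by omega)
      omega
    · rw [Ideal.Quotient.eq, Ideal.mem_span_singleton]
      refine ⟨((z / a : ℤ) : R), ?_⟩
      have h1 := Int.emod_add_mul_ediv z a
      have h2 : (((z % a).toNat : ℕ) : ℤ) = z % a :=
        Int.toNat_of_nonneg (Int.emod_nonneg z (by omega))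
      have h3 : ((((z % a).toNat : ℕ) : ℤ) : R) + (a : R) * ((z / a : ℤ) : R) = (z : R) := by
        rw [h2]; exact_mod_cast congrArg (Int.cast : ℤ → R) h1
      rw [← h3]; push_cast; ring
  let d : R := (r.1.den : R)
  let d' : R := ⟨(r.1.den : ℚ)⁻¹, inv_den_mem R r.2⟩
  have hd0 : (r.1.den : ℚ) ≠ 0 := by exact_mod_cast r.1.den_nz
  have hdd : d * d' = 1 := Subtype.ext (by
    change (((r.1.den : ℕ) : R) : ℚ) * (r.1.den : ℚ)⁻¹ = 1
    push_cast; exact mul_inv_cancel₀ hd0)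
  choose κ hκ hπ using hint
  obtain ⟨i, j, hij, he⟩ := Finite.exists_ne_map_eq_of_infinite
    (fun n : ℕ => (⟨κ ((r.1.den : ℤ) ^ n), hκ _⟩ : Fin a))
  have he' : π (d ^ i) = π (d ^ j) := by
    have h := congrArg Fin.val he
    simp only at h
    have e1 := hπ ((r.1.den : ℤ) ^ i)
    have e2 := hπ ((r.1.den : ℤ) ^ j)
    rw [← h, ← e1] at e2
    simpa [d] using e2.symm
  wlog hlt : i < j generalizing i j
  · exact this j i hij.symm he.symm he'.symm (by omega)
  have hinv : π d' = π (d ^ (j - i - 1)) := by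
    have h1 : d' = d ^ i * d' ^ (i + 1) := by
      rw [pow_succ', mul_left_comm, ← mul_pow, hdd, one_pow, mul_one]
    have h2 : d ^ (j - i - 1) = d ^ j * d' ^ (i + 1) := by
      have : j = (j - i - 1) + (i + 1) := by omega
      conv_rhs => rw [this, pow_add, mul_assoc, ← mul_pow, hdd, one_pow, mul_one]
    rw [h1, h2, map_mul, map_mul, he']
  have hr : r = (r.1.num : R) * d' := Subtype.ext (by
    change r.1 = (((r.1.num : ℤ) : R) : ℚ) * (r.1.den : ℚ)⁻¹
    push_cast
    rw [← div_eq_mul_inv, Rat.num_div_den])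
  have hfin : π r = π (((r.1.num * (r.1.den : ℤ) ^ (j - i - 1) : ℤ)) : R) := by
    conv_lhs => rw [hr]
    rw [map_mul, hinv, ← map_mul]
    congr 1
    push_cast
    rfl
  rw [hπ, Ideal.Quotient.eq, Ideal.mem_span_singleton] at hfin
  obtain ⟨s, hs⟩ := hfin
  exact ⟨_, hκ _, s, by rw [← hs]; ring⟩

theorem ZS_le_singleton {S : Set Nat.Primes} {p : Nat.Primes} (hp : p ∈ S) : ZS S ≤ ZS {p} :=
  fun q hq r hr => by rw [Set.mem_singleton_iff.mp hr]; exact hq p hp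

end RationalSubring

/-! ### Lattices in ℚ[Γ] and duality for the trace form -/

section GroupRingLattice

variable {Γ : Type u} [Group Γ] [Fintype Γ] (R : Subring ℚ)

theorem exists_int_mul_mem (R : Subring ℚ) (x : MonoidAlgebra ℚ Γ) :
    ∃ n : ℕ, n ≠ 0 ∧ (n : ℚ) • x ∈ intGroupRing Γ R := by
  refine ⟨∏ g, (x.coeff g).den, Finset.prod_ne_zero_iff.mpr fun g _ => (x.coeff g).den_nz, ?_⟩
  rw [mem_intGroupRing]
  intro g
  obtain ⟨k, hk⟩ := Finset.dvd_prod_of_mem (fun g => (x.coeff g).den) (Finset.mem_univ g)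
  rw [hk, MonoidAlgebra.coeff_smul, Finsupp.smul_apply, smul_eq_mul]
  push_cast
  rw [mul_right_comm, mul_comm ((x.coeff g).den : ℚ), Rat.mul_den_eq_num]
  exact R.mul_mem (intCast_mem R _) (natCast_mem R _)

variable (Γ) in
/-- The group ring `R[Γ]` as an `R`-submodule of `ℚ[Γ]`. -/
def groupLattice : Submodule R (MonoidAlgebra ℚ Γ) where
  carrier := intGroupRing Γ R
  zero_mem' := zero_mem _
  add_mem' := add_mem
  smul_mem' c x hx := by
    have hx' : x ∈ intGroupRing Γ R := hx
    change c • x ∈ intGroupRing Γ R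
    rw [mem_intGroupRing] at hx' ⊢
    exact fun g => R.mul_mem c.2 (hx' g)

variable {R} in
theorem mem_groupLattice {x : MonoidAlgebra ℚ Γ} :
    x ∈ groupLattice Γ R ↔ x ∈ intGroupRing Γ R := Iff.rfl

theorem groupLattice_eq_span :
    groupLattice Γ R = Submodule.span R (Set.range fun g : Γ => MonoidAlgebra.single g (1 : ℚ)) := by
  refine le_antisymm (fun x hx => ?_) ?_
  · have hx' := mem_intGroupRing.mp (mem_groupLattice.mp hx)
    have : x = ∑ g, (⟨x.coeff g, hx' g⟩ : R) • MonoidAlgebra.single g (1 : ℚ) := by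
      ext k
      simp [MonoidAlgebra.coeff_sum, Subring.smul_def]
    rw [this]
    exact Submodule.sum_mem _ fun g _ => Submodule.smul_mem _ _ (Submodule.subset_span ⟨g, rfl⟩)
  · rw [Submodule.span_le]
    rintro _ ⟨g, rfl⟩
    exact single_mem_intGroupRing R g

theorem groupLattice_fg : (groupLattice Γ R).FG := by
  rw [groupLattice_eq_span]
  exact Submodule.fg_span (Set.finite_range _)

variable (Γ) in
/-- The bilinear form `(x, y) ↦ (xy)₁` on `ℚ[Γ]`. -/
def traceForm : LinearMap.BilinForm ℚ (MonoidAlgebra ℚ Γ) :=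
  LinearMap.mk₂ ℚ (fun x y => (x * y).coeff 1) (by simp [add_mul]) (by simp) (by simp [mul_add])
    (by simp)

theorem traceForm_apply (x y : MonoidAlgebra ℚ Γ) : traceForm Γ x y = (x * y).coeff 1 := rfl

theorem coeff_one_mul_single (x : MonoidAlgebra ℚ Γ) (g : Γ) :
    (x * MonoidAlgebra.single g⁻¹ (1 : ℚ)).coeff 1 = x.coeff g := by
  simp

theorem coeff_one_mul_comm (x y : MonoidAlgebra ℚ Γ) : (x * y).coeff 1 = (y * x).coeff 1 := by
  classical
  induction x using MonoidAlgebra.induction_linear with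
  | zero => simp
  | add a b ha hb => simp [add_mul, mul_add, ha, hb]
  | single g r =>
    rw [MonoidAlgebra.coeff_single_mul_apply, MonoidAlgebra.coeff_mul_single_apply, mul_comm]
    simp

theorem traceForm_isSymm : (traceForm Γ).IsSymm :=
  ⟨fun x y => coeff_one_mul_comm x y⟩

theorem traceForm_nondegenerate : (traceForm Γ).Nondegenerate := by
  have h : ∀ x : MonoidAlgebra ℚ Γ, (∀ y, traceForm Γ x y = 0) → x = 0 := by
    intro x hx
    ext g
    rw [← coeff_one_mul_single]
    exact hx _
  exact ⟨h, fun x hx => h x fun y => by rw [← hx y]; exact coeff_one_mul_comm x y⟩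

/-- The dual `{x | xJ ⊆ R[Γ]}` of a sublattice of `ℚ[Γ]`. -/
def dualLattice (J : Submodule R (MonoidAlgebra ℚ Γ)) : Submodule R (MonoidAlgebra ℚ Γ) where
  carrier := {x | ∀ y ∈ J, x * y ∈ groupLattice Γ R}
  zero_mem' y _ := by rw [zero_mul]; exact zero_mem _
  add_mem' {a b} ha hb y hy := by rw [add_mul]; exact add_mem (ha y hy) (hb y hy)
  smul_mem' r a ha y hy := by rw [smul_mul_assoc]; exact Submodule.smul_mem _ _ (ha y hy)

variable {R}

theorem mem_one_submodule {q : ℚ} : q ∈ (1 : Submodule R ℚ) ↔ q ∈ R := by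
  rw [Submodule.mem_one]
  exact ⟨fun ⟨y, hy⟩ => hy ▸ y.2, fun h => ⟨⟨q, h⟩, rfl⟩⟩

/-- The coefficient of `x * y` at `g` is the trace form of `x` and `y * g⁻¹`. For a right ideal,
integrality of all coefficients is therefore integrality of the coefficient at `1`. -/
theorem dualLattice_eq_right {J : Submodule R (MonoidAlgebra ℚ Γ)}
    (hr : ∀ x ∈ J, ∀ y ∈ groupLattice Γ R, x * y ∈ J) :
    dualLattice R J = (traceForm Γ).dualSubmodule J := by
  ext x
  rw [LinearMap.BilinForm.mem_dualSubmodule]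
  simp only [mem_one_submodule, traceForm_apply]
  refine ⟨fun h y hy => mem_intGroupRing.mp (h y hy) 1, fun h y hy => ?_⟩
  rw [mem_groupLattice, mem_intGroupRing]
  intro g
  rw [← coeff_one_mul_single, mul_assoc]
  exact h _ (hr y hy _ (single_mem_intGroupRing R _))

/-- By symmetry of the trace form the left and the right dual of a two-sided ideal coincide. Hence
both products of `J` with its dual are integral. -/
theorem mem_dualLattice_iff_left {J : Submodule R (MonoidAlgebra ℚ Γ)}
    (hl : ∀ x ∈ J, ∀ y ∈ groupLattice Γ R, y * x ∈ J)
    (hr : ∀ x ∈ J, ∀ y ∈ groupLattice Γ R, x * y ∈ J) {x : MonoidAlgebra ℚ Γ} :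
    x ∈ dualLattice R J ↔ ∀ y ∈ J, y * x ∈ groupLattice Γ R := by
  rw [dualLattice_eq_right hr, LinearMap.BilinForm.mem_dualSubmodule]
  simp only [mem_one_submodule, traceForm_apply]
  refine ⟨fun h y hy => ?_, fun h y hy => ?_⟩
  · rw [mem_groupLattice, mem_intGroupRing]
    intro g
    rw [← coeff_one_mul_single, coeff_one_mul_comm, ← mul_assoc, coeff_one_mul_comm]
    exact h _ (hl y hy _ (single_mem_intGroupRing R _))
  · rw [coeff_one_mul_comm]
    exact mem_intGroupRing.mp (h y hy) 1

/-- `J` is a two-sided ideal of `R[Γ]` that contains a nonzero integer. -/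
structure IsFullIdeal (J : Submodule R (MonoidAlgebra ℚ Γ)) : Prop where
  le : J ≤ groupLattice Γ R
  left : ∀ x ∈ J, ∀ y ∈ groupLattice Γ R, y * x ∈ J
  right : ∀ x ∈ J, ∀ y ∈ groupLattice Γ R, x * y ∈ J
  full : ∃ a : ℕ, a ≠ 0 ∧ (a : MonoidAlgebra ℚ Γ) ∈ J

theorem IsFullIdeal.isLattice {J : Submodule R (MonoidAlgebra ℚ Γ)} (hJ : IsFullIdeal J) :
    Submodule.IsLattice ℚ J where
  fg := by
    have : IsNoetherian R (groupLattice Γ R) :=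
      isNoetherian_of_fg_of_noetherian _ (groupLattice_fg R)
    have := isNoetherian_of_le hJ.le
    exact Module.Finite.iff_fg.mp inferInstance
  span_eq_top := by
    obtain ⟨a, ha, haJ⟩ := hJ.full
    rw [eq_top_iff]
    intro x _
    obtain ⟨n, hn, hx⟩ := exists_int_mul_mem R x
    have h := hJ.left _ haJ _ hx
    have hna : (n : ℚ) * a ≠ 0 := by positivity
    have : x = ((n : ℚ) * a)⁻¹ • (((n : ℚ) • x) * (a : MonoidAlgebra ℚ Γ)) := by
      have h1 : ((n : ℚ) • x) * (a : MonoidAlgebra ℚ Γ) = ((n : ℚ) * a) • x := by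
        rw [← nsmul_eq_mul', ← Nat.cast_smul_eq_nsmul ℚ, smul_smul, mul_comm]
      rw [h1, smul_smul, inv_mul_cancel₀ hna, one_smul]
    rw [this]
    exact Submodule.smul_mem _ _ (Submodule.subset_span h)

/-- `J` and its dual are right ideals, so both duals are taken with respect to the trace form. Over
a principal ideal domain `J` has a basis, which extends to a basis of ℚ[Γ], and a nondegenerate
symmetric form recovers its span from the dual. -/
theorem IsFullIdeal.dual_dual {J : Submodule R (MonoidAlgebra ℚ Γ)} (hJ : IsFullIdeal J) :
    dualLattice R (dualLattice R J) = J := by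
  have hr : ∀ x ∈ dualLattice R J, ∀ y ∈ groupLattice Γ R, x * y ∈ dualLattice R J :=
    fun x hx y hy z hz => by rw [mul_assoc]; exact hx _ (hJ.left z hz y hy)
  rw [dualLattice_eq_right hr, dualLattice_eq_right hJ.right]
  have := hJ.isLattice
  let b := Module.Free.chooseBasis R J
  have h := LinearMap.BilinForm.dualSubmodule_dualSubmodule_of_basis (R := R)
    (traceForm Γ) traceForm_nondegenerate traceForm_isSymm (b.extendOfIsLattice ℚ)
  have hJb : Submodule.span R (Set.range (b.extendOfIsLattice ℚ)) = J := by
    have : Set.range (b.extendOfIsLattice ℚ) = J.subtype '' Set.range b := by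
      rw [← Set.range_comp]; congr 1; ext k; simp
    rw [this, ← Submodule.map_span, b.span_eq, Submodule.map_top, Submodule.range_subtype]
  rwa [hJb] at h

end GroupRingLattice

/-! ### Maximality of eℤ_S[Γ] and invertible two-sided ideals -/

section MaximalOrder

variable {Γ : Type u} [Group Γ] [Fintype Γ] {S : Set Nat.Primes} {e : MonoidAlgebra ℚ Γ}

/-- If all primes in `S` are good for `e`, then `eℤ_S[Γ]` is a maximal order. -/
theorem le_groupLattice_of_good (he : IsCentralIdempotent e) (hS : ∀ p ∈ S, IsGoodPrime p e)
    (Z : Submodule (ZS S) (MonoidAlgebra ℚ Γ)) (hcorner : ∀ x ∈ Z, e * x = x)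
    (hmul : ∀ x ∈ Z, ∀ y ∈ Z, x * y ∈ Z) (hle : ∀ x ∈ groupLattice Γ (ZS S), e * x ∈ Z)
    (hden : ∃ a : ℕ, a ≠ 0 ∧ ∀ x ∈ Z, (a : ℚ) • x ∈ groupLattice Γ (ZS S)) :
    Z ≤ groupLattice Γ (ZS S) := by
  obtain ⟨a, ha, hden⟩ := hden
  have ha' : (a : ℚ) ≠ 0 := by exact_mod_cast ha
  -- Maximality is given prime by prime: the ℤ_(p)-span of `Z` is an order containing eℤ_(p)[Γ], so
  -- it equals it. Coefficients that are integral at every p ∈ S lie in ℤ_S.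
  have key : ∀ p ∈ S, ∀ z ∈ Z, z ∈ idemLattice (ZS {p}) e := by
    intro p hp z hz
    let Zp : Submodule (ZS {p}) (MonoidAlgebra ℚ Γ) := Submodule.span (ZS {p}) Z
    have hsub : groupLattice Γ (ZS S) ≤ groupLattice Γ (ZS S) := le_rfl
    have hBp : ∀ x ∈ groupLattice Γ (ZS S), x ∈ groupLattice Γ (ZS {p}) := fun x hx =>
      mem_intGroupRing.mpr fun g => ZS_le_singleton hp (mem_intGroupRing.mp hx g)
    have hord : IsOrderIn (ZS {p}) e Zp := by
      refine ⟨fun x hx => ?_, ?_, fun x hx y hy => ?_, ?_, fun x hx => ?_⟩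
      · have h1 : e * x = x := by
          induction hx using Submodule.span_induction with
          | mem x h => exact hcorner x h
          | zero => simp
          | add x y _ _ h1 h2 => rw [mul_add, h1, h2]
          | smul r x _ h => rw [mul_smul_comm, h]
        exact ⟨h1, by rw [← he.central, h1]⟩
      · refine Submodule.subset_span ?_
        have := hle 1 (one_mem (intGroupRing Γ (ZS S)))
        rwa [mul_one] at this
      · induction hx, hy using Submodule.span_induction₂ with
        | mem_mem x y hx hy => exact Submodule.subset_span (hmul x hx y hy)
        | zero_left y hy => rw [zero_mul]; exact zero_mem _
        | zero_right y hy => rw [mul_zero]; exact zero_mem _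
        | add_left x y z _ _ _ h1 h2 => rw [add_mul]; exact add_mem h1 h2
        | add_right x y z _ _ _ h1 h2 => rw [mul_add]; exact add_mem h1 h2
        | smul_left r x y _ _ h => rw [smul_mul_assoc]; exact Submodule.smul_mem _ _ h
        | smul_right r x y _ _ h => rw [mul_smul_comm]; exact Submodule.smul_mem _ _ h
      -- Bounded denominators give finite generation: the span lies in a⁻¹ℤ_(p)[Γ], a noetherian
      -- module.
      · have hfg : ((groupLattice Γ (ZS {p})).map
            (LinearMap.lsmul ℚ (MonoidAlgebra ℚ Γ) (a : ℚ)⁻¹ |>.restrictScalars (ZS {p}))).FG :=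
          (groupLattice_fg _).map _
        have hle' : Zp ≤ (groupLattice Γ (ZS {p})).map
            (LinearMap.lsmul ℚ (MonoidAlgebra ℚ Γ) (a : ℚ)⁻¹ |>.restrictScalars (ZS {p})) := by
          rw [Submodule.span_le]
          intro x hx
          refine ⟨(a : ℚ) • x, hBp _ (hden x hx), ?_⟩
          change (a : ℚ)⁻¹ • (a : ℚ) • x = x
          rw [smul_smul, inv_mul_cancel₀ ha', one_smul]
        have := isNoetherian_of_fg_of_noetherian _ hfg
        have := isNoetherian_of_le hle'
        exact Module.Finite.iff_fg.mp inferInstance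
      · obtain ⟨n, hn, hx'⟩ := exists_int_mul_mem (ZS S) x
        have hn' : (n : ℚ) ≠ 0 := by exact_mod_cast hn
        have hex : e * x = x := by rw [← hx, ← mul_assoc, ← mul_assoc, he.idem.eq]
        have h2 := hle _ hx'
        rw [mul_smul_comm, hex] at h2
        have : x = (n : ℚ)⁻¹ • (n : ℚ) • x := by rw [smul_smul, inv_mul_cancel₀ hn', one_smul]
        rw [this]
        exact Submodule.smul_mem _ _ (Submodule.subset_span (Submodule.subset_span h2))
    have hge : idemLattice (ZS {p}) e ≤ Zp := by
      rintro _ ⟨x, hx, rfl⟩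
      change x ∈ groupLattice Γ (ZS {p}) at hx
      rw [groupLattice_eq_span] at hx
      induction hx using Submodule.span_induction with
      | mem x h =>
        obtain ⟨g, rfl⟩ := h
        exact Submodule.subset_span (hle _ (single_mem_intGroupRing _ g))
      | zero => rw [mul_zero]; exact zero_mem _
      | add x y _ _ h1 h2 => rw [mul_add]; exact add_mem h1 h2
      | smul r x _ h => rw [mul_smul_comm]; exact Submodule.smul_mem _ _ h
    rw [← (hS p hp).2.maximal Zp hord hge]
    exact Submodule.subset_span hz
  intro z hz
  rw [mem_groupLattice, mem_intGroupRing]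
  intro g p hp
  obtain ⟨x, hx, hzx⟩ := key p hp z hz
  have : z ∈ intGroupRing Γ (ZS {p}) := by
    rw [hzx]; exact mul_mem (hS p hp).1 hx
  exact mem_intGroupRing.mp this g p rfl

theorem mul_mem_groupLattice {R : Subring ℚ} {x y : MonoidAlgebra ℚ Γ}
    (hx : x ∈ groupLattice Γ R) (hy : y ∈ groupLattice Γ R) : x * y ∈ groupLattice Γ R :=
  mul_mem (s := intGroupRing Γ R) hx hy

theorem one_mem_groupLattice {R : Subring ℚ} : (1 : MonoidAlgebra ℚ Γ) ∈ groupLattice Γ R :=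
  one_mem (intGroupRing Γ R)

variable {J : Submodule (ZS S) (MonoidAlgebra ℚ Γ)}

theorem IsFullIdeal.dual_left {R : Subring ℚ} {J : Submodule R (MonoidAlgebra ℚ Γ)}
    (hJ : IsFullIdeal J) : ∀ x ∈ dualLattice R J, ∀ y ∈ groupLattice Γ R,
      y * x ∈ dualLattice R J :=
  fun x hx y hy z hz => by rw [mul_assoc]; exact mul_mem_groupLattice hy (hx z hz)

theorem IsFullIdeal.dual_right {R : Subring ℚ} {J : Submodule R (MonoidAlgebra ℚ Γ)}
    (hJ : IsFullIdeal J) : ∀ x ∈ dualLattice R J, ∀ y ∈ groupLattice Γ R,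
      x * y ∈ dualLattice R J :=
  fun x hx y hy z hz => by rw [mul_assoc]; exact hx _ (hJ.left z hz y hy)

theorem IsFullIdeal.one_mem_dual {R : Subring ℚ} {J : Submodule R (MonoidAlgebra ℚ Γ)}
    (hJ : IsFullIdeal J) : (1 : MonoidAlgebra ℚ Γ) ∈ dualLattice R J :=
  fun y hy => by rw [one_mul]; exact hJ.le hy

theorem IsFullIdeal.mul_dual_mem {R : Subring ℚ} {J : Submodule R (MonoidAlgebra ℚ Γ)}
    (hJ : IsFullIdeal J) {x y : MonoidAlgebra ℚ Γ} (hx : x ∈ J) (hy : y ∈ dualLattice R J) :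
    x * y ∈ groupLattice Γ R :=
  (mem_dualLattice_iff_left hJ.left hJ.right).mp hy x hx

/-- Let D be the dual of J. If x lies in the dual of DJ, then xD ⊆ D. The elements of eA mapping D
into itself form an order containing eB, so ex ∈ B by maximality; also x ∈ D and 1 - e ∈ J give (1 -
e)x ∈ JD ⊆ B. Thus the dual of DJ is contained in B, and dualizing again gives 1 ∈ DJ. -/
theorem IsFullIdeal.one_mem_dual_mul (he : IsCentralIdempotent e) (hS : ∀ p ∈ S, IsGoodPrime p e)
    (hJ : IsFullIdeal J) (heJ : 1 - e ∈ J) :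
    (1 : MonoidAlgebra ℚ Γ) ∈ dualLattice (ZS S) J * J := by
  have heB : e ∈ groupLattice Γ (ZS S) := mem_of_good hS
  set D := dualLattice (ZS S) J with hD
  have hDJ : IsFullIdeal (D * J) := by
    refine ⟨?_, fun x hx y hy => ?_, fun x hx y hy => ?_, ?_⟩
    · rw [Submodule.mul_le]
      exact fun x hx y hy => hx y hy
    · induction hx using Submodule.mul_induction_on' with
      | mem_mul_mem m hm n hn =>
        rw [← mul_assoc]; exact Submodule.mul_mem_mul (hJ.dual_left m hm y hy) hn
      | add a _ b _ h1 h2 => rw [mul_add]; exact add_mem h1 h2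
    · induction hx using Submodule.mul_induction_on' with
      | mem_mul_mem m hm n hn =>
        rw [mul_assoc]; exact Submodule.mul_mem_mul hm (hJ.right n hn y hy)
      | add a _ b _ h1 h2 => rw [add_mul]; exact add_mem h1 h2
    · obtain ⟨a, ha, haJ⟩ := hJ.full
      refine ⟨a, ha, ?_⟩
      have := Submodule.mul_mem_mul hJ.one_mem_dual haJ
      rwa [one_mul] at this
  let Z : Submodule (ZS S) (MonoidAlgebra ℚ Γ) :=
    { carrier := {x | e * x = x ∧ ∀ y ∈ D, x * y ∈ D}
      zero_mem' := ⟨mul_zero e, fun y _ => by rw [zero_mul]; exact zero_mem _⟩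
      add_mem' := fun {a b} ha hb => ⟨by rw [mul_add, ha.1, hb.1], fun y hy => by
        rw [add_mul]; exact add_mem (ha.2 y hy) (hb.2 y hy)⟩
      smul_mem' := fun r a ha => ⟨by rw [mul_smul_comm, ha.1], fun y hy => by
        rw [smul_mul_assoc]; exact Submodule.smul_mem _ _ (ha.2 y hy)⟩ }
  have hZ : Z ≤ groupLattice Γ (ZS S) := by
    refine le_groupLattice_of_good he hS Z (fun x hx => hx.1) (fun x hx y hy => ⟨?_, ?_⟩) ?_ ?_
    · rw [← mul_assoc, hx.1]
    · intro z hz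
      rw [mul_assoc]
      exact hx.2 _ (hy.2 z hz)
    · intro x hx
      refine ⟨by rw [← mul_assoc, he.idem.eq], fun y hy => ?_⟩
      exact hJ.dual_left y hy _ (mul_mem_groupLattice heB hx)
    · obtain ⟨a, ha, haJ⟩ := hJ.full
      refine ⟨a, ha, fun x hx => ?_⟩
      have h1 := hx.2 1 hJ.one_mem_dual
      rw [mul_one] at h1
      have h2 := h1 _ haJ
      rwa [← nsmul_eq_mul', ← Nat.cast_smul_eq_nsmul ℚ] at h2
  have hle : dualLattice (ZS S) (D * J) ≤ groupLattice Γ (ZS S) := by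
    intro x hx
    have hxD : ∀ y ∈ D, x * y ∈ D := fun y hy z hz => by
      rw [mul_assoc]; exact hx _ (Submodule.mul_mem_mul hy hz)
    have h1 : e * x ∈ groupLattice Γ (ZS S) := by
      refine hZ ⟨by rw [← mul_assoc, he.idem.eq], fun y hy => ?_⟩
      rw [mul_assoc]
      exact hJ.dual_left _ (hxD y hy) _ heB
    have h2 : (1 - e) * x ∈ groupLattice Γ (ZS S) := by
      have h3 := hxD 1 hJ.one_mem_dual
      rw [mul_one] at h3
      exact hJ.mul_dual_mem heJ h3
    have : x = e * x + (1 - e) * x := by rw [← add_mul]; simp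
    rw [this]
    exact add_mem h1 h2
  rw [← hDJ.dual_dual]
  exact fun y hy => by rw [one_mul]; exact hle hy

/-- An idempotent two-sided ideal of `ℤ_S[Γ]` which contains `1 - e` and a nonzero integer is the
whole ring. -/
theorem IsFullIdeal.one_mem_of_le_mul (he : IsCentralIdempotent e)
    (hS : ∀ p ∈ S, IsGoodPrime p e) (hJ : IsFullIdeal J) (heJ : 1 - e ∈ J) (hJJ : J ≤ J * J) :
    (1 : MonoidAlgebra ℚ Γ) ∈ J := by
  -- Cancel one factor of J ⊆ J² with the dual D: 1 ∈ DJ ⊆ DJJ ⊆ J.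
  have h1 : dualLattice (ZS S) J * J ≤ dualLattice (ZS S) J * J * J := by
    rw [mul_assoc]
    exact mul_le_mul' le_rfl hJJ
  have h2 : dualLattice (ZS S) J * J * J ≤ J := by
    rw [Submodule.mul_le]
    intro x hx y hy
    refine hJ.left y hy x ?_
    have : dualLattice (ZS S) J * J ≤ groupLattice Γ (ZS S) := by
      rw [Submodule.mul_le]; exact fun x hx y hy => hx y hy
    exact this hx
  exact h2 (h1 (hJ.one_mem_dual_mul he hS heJ))

/-- The ideal JD is idempotent because JD ⊆ J(DJ)D by invertibility on the other side, and an
idempotent full ideal containing 1 - e is the whole ring. -/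
theorem IsFullIdeal.one_mem_mul_dual (he : IsCentralIdempotent e) (hS : ∀ p ∈ S, IsGoodPrime p e)
    (hJ : IsFullIdeal J) (heJ : 1 - e ∈ J) :
    (1 : MonoidAlgebra ℚ Γ) ∈ J * dualLattice (ZS S) J := by
  set D := dualLattice (ZS S) J with hD
  have hJD : IsFullIdeal (J * D) := by
    refine ⟨?_, fun x hx y hy => ?_, fun x hx y hy => ?_, ?_⟩
    · rw [Submodule.mul_le]
      exact fun x hx y hy => hJ.mul_dual_mem hx hy
    · induction hx using Submodule.mul_induction_on' with
      | mem_mul_mem m hm n hn =>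
        rw [← mul_assoc]; exact Submodule.mul_mem_mul (hJ.left m hm y hy) hn
      | add a _ b _ h1 h2 => rw [mul_add]; exact add_mem h1 h2
    · induction hx using Submodule.mul_induction_on' with
      | mem_mul_mem m hm n hn =>
        rw [mul_assoc]; exact Submodule.mul_mem_mul hm (hJ.dual_right n hn y hy)
      | add a _ b _ h1 h2 => rw [add_mul]; exact add_mem h1 h2
    · obtain ⟨a, ha, haJ⟩ := hJ.full
      refine ⟨a, ha, ?_⟩
      have := Submodule.mul_mem_mul haJ hJ.one_mem_dual
      rwa [mul_one] at this
  have h1e : 1 - e ∈ J * D := by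
    have := Submodule.mul_mem_mul heJ hJ.one_mem_dual
    rwa [mul_one] at this
  refine hJD.one_mem_of_le_mul he hS h1e ?_
  rw [Submodule.mul_le]
  intro x hx y hy
  have h2 := Submodule.mul_mem_mul (Submodule.mul_mem_mul hx
    (hJ.one_mem_dual_mul he hS heJ)) hy
  rwa [mul_one, ← mul_assoc J D J, mul_assoc (J * D)] at h2

/-- A maximal order contains the central idempotents. -/
theorem IsCentralIdempotent.mem_of_good (he : IsCentralIdempotent e)
    (hS : ∀ p ∈ S, IsGoodPrime p e) {ε : MonoidAlgebra ℚ Γ} (hε : IsCentralIdempotent ε)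
    (hεe : ε * e = ε) : ε ∈ intGroupRing Γ (ZS S) := by
  have heε : e * ε = ε := by rw [he.central, hεe]
  -- The candidate for a larger order is εB + (e - ε)B, a ring since ε and e - ε are orthogonal
  -- central idempotents.
  let Z : Submodule (ZS S) (MonoidAlgebra ℚ Γ) :=
    { carrier := {z | ∃ x ∈ groupLattice Γ (ZS S), ∃ y ∈ groupLattice Γ (ZS S),
        z = ε * x + (e - ε) * y}
      zero_mem' := ⟨0, zero_mem _, 0, zero_mem _, by simp⟩
      add_mem' := by
        rintro _ _ ⟨x, hx, y, hy, rfl⟩ ⟨x', hx', y', hy', rfl⟩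
        exact ⟨x + x', add_mem hx hx', y + y', add_mem hy hy', by simp only [mul_add]; abel⟩
      smul_mem' := by
        rintro r _ ⟨x, hx, y, hy, rfl⟩
        exact ⟨r • x, Submodule.smul_mem _ _ hx, r • y, Submodule.smul_mem _ _ hy, by
          simp only [mul_smul_comm, smul_add]⟩ }
  have hZ : Z ≤ groupLattice Γ (ZS S) := by
    refine le_groupLattice_of_good he hS Z ?_ ?_ ?_ ?_
    · rintro _ ⟨x, hx, y, hy, rfl⟩
      simp only [mul_add, sub_mul, mul_sub, ← mul_assoc, heε, he.idem.eq]
    · rintro _ ⟨x, hx, y, hy, rfl⟩ _ ⟨x', hx', y', hy', rfl⟩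
      refine ⟨x * x', mul_mem_groupLattice hx hx', y * y', mul_mem_groupLattice hy hy', ?_⟩
      have a1 : ε * x * (ε * x') = ε * (x * x') := by
        rw [hε.central x, mul_assoc, ← mul_assoc ε ε, hε.idem.eq, ← mul_assoc, ← hε.central x,
          mul_assoc]
      have h0 : ε * (e - ε) = 0 := by rw [mul_sub, hεe, hε.idem.eq, sub_self]
      have h0' : (e - ε) * ε = 0 := by rw [sub_mul, heε, hε.idem.eq, sub_self]
      have hc : ∀ z, (e - ε) * z = z * (e - ε) := fun z => by
        rw [sub_mul, mul_sub, he.central, hε.central]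
      have hi : (e - ε) * (e - ε) = e - ε := by
        rw [mul_sub, h0', sub_zero, sub_mul, he.idem.eq, hεe]
      have a2 : ε * x * ((e - ε) * y') = 0 := by
        rw [mul_assoc, ← mul_assoc x, ← hc x, mul_assoc, ← mul_assoc, h0, zero_mul]
      have a3 : (e - ε) * y * (ε * x') = 0 := by
        rw [mul_assoc, ← mul_assoc y, ← hε.central y, mul_assoc, ← mul_assoc, h0', zero_mul]
      have a4 : (e - ε) * y * ((e - ε) * y') = (e - ε) * (y * y') := by
        rw [hc y, mul_assoc, ← mul_assoc (e - ε) (e - ε), hi, ← mul_assoc, ← hc y, mul_assoc]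
      rw [add_mul, mul_add, mul_add, a1, a2, a3, a4]
      abel
    · intro x hx
      exact ⟨x, hx, x, hx, by rw [← add_mul]; simp⟩
    · obtain ⟨a, ha, haε⟩ := exists_int_mul_mem (ZS S) ε
      refine ⟨a, ha, ?_⟩
      rintro _ ⟨x, hx, y, hy, rfl⟩
      have heB : e ∈ groupLattice Γ (ZS S) := CohenMartinet.mem_of_good hS
      have : (a : ℚ) • (ε * x + (e - ε) * y) =
          ((a : ℚ) • ε) * x + (((a : ℕ) : ZS S) • e - (a : ℚ) • ε) * y := by
        have h1 : ((a : ℕ) : ZS S) • e = (a : ℚ) • e := by rw [Subring.smul_def]; push_cast; rfl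
        rw [h1, ← smul_sub, smul_mul_assoc, smul_mul_assoc, smul_add]
      rw [this]
      exact add_mem (mul_mem_groupLattice haε hx)
        (mul_mem_groupLattice (sub_mem (Submodule.smul_mem _ _ heB) haε) hy)
  exact hZ ⟨1, one_mem_groupLattice, 0, zero_mem _, by simp⟩

end MaximalOrder

/-! ### Projectivity of submodules of finite index -/

section Hereditary

variable {B : Type*} [Ring B]

/-- A module killed by the annihilator of a finite semisimple module is semisimple. -/
theorem isSemisimpleModule_of_annihilator_le (X : Type*) [AddCommGroup X] [Module B X] [Finite X]
    [IsSemisimpleModule B X] {E : Type*} [AddCommGroup E] [Module B E]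
    (h : Module.annihilator B X ≤ Module.annihilator B E) : IsSemisimpleModule B E := by
  -- `B` modulo the annihilator of `X` embeds in the finite power `X → X`, so it is semisimple.
  -- Every cyclic submodule of `E` is a quotient of it.
  let f : B →ₗ[B] (X → X) :=
    { toFun := fun b x => b • x
      map_add' := fun a b => funext fun x => add_smul a b x
      map_smul' := fun a b => funext fun x => mul_smul a b x }
  have hker : LinearMap.ker f = Module.annihilator B X := by
    ext b
    rw [LinearMap.mem_ker, Module.mem_annihilator]
    exact ⟨fun hb m => congrFun hb m, fun hb => funext hb⟩
  have hss : IsSemisimpleModule B (B ⧸ LinearMap.ker f) :=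
    IsSemisimpleModule.congr f.quotKerEquivRange
  refine isSemisimpleModule_of_isSemisimpleModule_submodule'
    (p := fun m : E => LinearMap.range (LinearMap.toSpanSingleton B E m)) (fun m => ?_) ?_
  · have hle : LinearMap.ker f ≤ LinearMap.ker (LinearMap.toSpanSingleton B E m) := by
      rw [hker]
      intro b hb
      exact Module.mem_annihilator.mp (h hb) m
    have hr : LinearMap.range ((LinearMap.ker f).liftQ _ hle) =
        LinearMap.range (LinearMap.toSpanSingleton B E m) := Submodule.range_liftQ _ _ _
    rw [← hr]
    exact IsSemisimpleModule.range _
  · rw [eq_top_iff]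
    intro m _
    exact Submodule.mem_iSup_of_mem m ⟨1, one_smul B m⟩

/-- `F` is a direct summand of a free module, with section `s`; multiplying by the two-sided ideal
makes `IF` a direct summand of a direct sum of copies of `I`. -/
theorem projective_ideal_smul_top {F : Type*} [AddCommGroup F] [Module B F] [Module.Projective B F]
    (I : Ideal B) [I.IsTwoSided] [Module.Projective B I] :
    Module.Projective B (I • ⊤ : Submodule B F) := by
  obtain ⟨s, hs⟩ := Module.projective_def.mp (inferInstance : Module.Projective B F)
  let ι : (F →₀ I) →ₗ[B] (F →₀ B) := Finsupp.mapRange.linearMap I.subtype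
  have hι : Function.Injective ι := Finsupp.mapRange_injective _ rfl Subtype.val_injective
  have hrange : ∀ x ∈ (I • ⊤ : Submodule B F), s x ∈ LinearMap.range ι := by
    intro x hx
    refine Submodule.smul_induction_on hx (fun r hr n _ => ?_) (fun x y hx hy => ?_)
    · refine ⟨Finsupp.mapRange (fun b : B => (⟨r * b, I.mul_mem_right b hr⟩ : I))
        (Subtype.ext (mul_zero r)) (s n), ?_⟩
      rw [map_smul]
      ext k
      simp [ι]
    · rw [map_add]; exact add_mem hx hy
  let i : (I • ⊤ : Submodule B F) →ₗ[B] (F →₀ I) :=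
    (LinearEquiv.ofInjective ι hι).symm.toLinearMap ∘ₗ
      (s ∘ₗ (I • ⊤ : Submodule B F).subtype).codRestrict _ (fun x => hrange x.1 x.2)
  let r : (F →₀ I) →ₗ[B] (I • ⊤ : Submodule B F) :=
    (Finsupp.linearCombination B id ∘ₗ ι).codRestrict _ (fun f => by
      rw [LinearMap.comp_apply, Finsupp.linearCombination_apply]
      refine Submodule.sum_mem _ fun k _ => Submodule.smul_mem_smul ?_ trivial
      simp [ι])
  classical
  have : Module.Projective B (F →₀ I) :=
    Module.Projective.of_equiv (finsuppLequivDFinsupp (ι := F) (M := I) B).symm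
  refine Module.Projective.of_split i r (LinearMap.ext fun x => Subtype.ext ?_)
  have h1 : ι (i x) = s x.1 := by
    have := LinearEquiv.apply_symm_apply (LinearEquiv.ofInjective ι hι)
      ((s ∘ₗ (I • ⊤ : Submodule B F).subtype).codRestrict _ (fun x => hrange x.1 x.2) x)
    exact congrArg Subtype.val this
  change Finsupp.linearCombination B id (ι (i x)) = x.1
  rw [h1]
  exact hs x.1

/-- The kernel of a surjection from a projective module onto a finite simple module whose
annihilator is projective is projective. -/
theorem projective_of_isSimpleModule_quotient {F : Type*} [AddCommGroup F] [Module B F]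
    [Module.Projective B F] (F₁ : Submodule B F) [Finite (F ⧸ F₁)] [IsSimpleModule B (F ⧸ F₁)]
    [Module.Projective B (Module.annihilator B (F ⧸ F₁))] : Module.Projective B F₁ := by
  set I := Module.annihilator B (F ⧸ F₁) with hI
  let K : Submodule B F := I • ⊤
  have hKF : K ≤ F₁ := by
    rw [Submodule.smul_le]
    intro r hr n _
    rw [← Submodule.Quotient.mk_eq_zero, Submodule.Quotient.mk_smul]
    exact Module.mem_annihilator.mp hr _
  have hss : IsSemisimpleModule B (F ⧸ K) := by
    refine isSemisimpleModule_of_annihilator_le (F ⧸ F₁) fun r hr => ?_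
    rw [Module.mem_annihilator]
    intro m
    obtain ⟨m, rfl⟩ := Submodule.Quotient.mk_surjective _ m
    rw [← Submodule.Quotient.mk_smul, Submodule.Quotient.mk_eq_zero]
    exact Submodule.smul_mem_smul hr trivial
  -- A complement in the semisimple module F/IF gives F₂ with F₁ + F₂ = F and F₁ ∩ F₂ ⊆ IF. Since F
  -- is projective, F₁ ⊕ F₂ → F has a section `σ`, and `σ` makes F₁ a direct summand of F ⊕ IF.
  obtain ⟨C, hC⟩ := exists_isCompl (F₁.map K.mkQ)
  let F₂ := C.comap K.mkQ
  have hinf : ∀ x ∈ F₁, x ∈ F₂ → x ∈ K := fun x h1 h2 => by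
    rw [← Submodule.Quotient.mk_eq_zero]
    have : K.mkQ x ∈ F₁.map K.mkQ ⊓ C := ⟨⟨x, h1, rfl⟩, h2⟩
    rwa [hC.inf_eq_bot] at this
  have hsup : Function.Surjective (LinearMap.coprod F₁.subtype F₂.subtype) := by
    intro x
    have : K.mkQ x ∈ F₁.map K.mkQ ⊔ C := by rw [hC.sup_eq_top]; trivial
    obtain ⟨_, ⟨y, hy, rfl⟩, z, hz, hyz⟩ := Submodule.mem_sup.mp this
    refine ⟨(⟨y, hy⟩, ⟨x - y, ?_⟩), by simp⟩
    change K.mkQ (x - y) ∈ C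
    rw [map_sub, ← hyz, add_sub_cancel_left]
    exact hz
  obtain ⟨σ, hσ⟩ := Module.projective_lifting_property _ LinearMap.id hsup
  have hσ' : ∀ x, ((σ x).1 : F) + ((σ x).2 : F) = x := fun x => LinearMap.congr_fun hσ x
  have : Module.Projective B K := projective_ideal_smul_top I
  let i : F₁ →ₗ[B] F × K :=
    F₁.subtype.prod ((F₂.subtype ∘ₗ LinearMap.snd B F₁ F₂ ∘ₗ σ ∘ₗ F₁.subtype).codRestrict K
      (fun x => hinf _ (by
        have : ((σ x.1).2 : F) = x.1 - (σ x.1).1 := by rw [eq_sub_iff_add_eq']; exact hσ' x.1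
        change ((σ x.1).2 : F) ∈ F₁
        rw [this]
        exact sub_mem x.2 (σ x.1).1.2) (σ x.1).2.2))
  let r : F × K →ₗ[B] F₁ :=
    LinearMap.coprod (LinearMap.fst B F₁ F₂ ∘ₗ σ) (Submodule.inclusion hKF)
  exact Module.Projective.of_split i r (LinearMap.ext fun x => Subtype.ext (hσ' x.1))

theorem exists_isCoatom_of_finite_quotient {F : Type*} [AddCommGroup F] [Module B F]
    (F₁ : Submodule B F) [Finite (F ⧸ F₁)] (h : F₁ ≠ ⊤) :
    ∃ F' : Submodule B F, F₁ ≤ F' ∧ IsSimpleModule B (F ⧸ F') := by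
  have : Finite (Submodule B (F ⧸ F₁)) := Finite.of_injective _ SetLike.coe_injective
  have hb : (⊥ : Submodule B (F ⧸ F₁)) ≠ ⊤ := by
    intro hb
    apply h
    rw [← F₁.ker_mkQ, ← Submodule.comap_bot, hb, Submodule.comap_top]
  obtain ⟨N, hN, -⟩ := (eq_top_or_exists_le_coatom (⊥ : Submodule B (F ⧸ F₁))).resolve_left hb
  refine ⟨N.comap F₁.mkQ, ?_, ?_⟩
  · intro x hx
    change F₁.mkQ x ∈ N
    rw [show F₁.mkQ x = 0 from (Submodule.Quotient.mk_eq_zero F₁).mpr hx]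
    exact zero_mem _
  · have hs : IsSimpleModule B ((F ⧸ F₁) ⧸ N) := isSimpleModule_iff_isCoatom.mpr hN
    have hk : N.comap F₁.mkQ = LinearMap.ker (N.mkQ ∘ₗ F₁.mkQ) := by
      rw [LinearMap.ker_comp, Submodule.ker_mkQ]
    rw [hk]
    exact IsSimpleModule.congr (LinearMap.quotKerEquivOfSurjective (N.mkQ ∘ₗ F₁.mkQ)
      ((Submodule.mkQ_surjective _).comp (Submodule.mkQ_surjective _)))

/-- If the annihilators of finite simple modules with the property `P` are projective, then
submodules of projective modules are projective if the quotient is finite and its simple quotients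
have the property `P`. -/
theorem projective_of_finite_quotient {F : Type*} [AddCommGroup F] [Module B F]
    [Module.Projective B F] (E : Ideal B)
    (hB : ∀ (F' : Submodule B F) (F'' : Submodule B F'), Finite (F' ⧸ F'') →
      IsSimpleModule B (F' ⧸ F'') → E ≤ Module.annihilator B (F' ⧸ F'') →
      Module.Projective B (Module.annihilator B (F' ⧸ F'')))
    (F₁ : Submodule B F) [Finite (F ⧸ F₁)] (hE : E ≤ Module.annihilator B (F ⧸ F₁)) :
    Module.Projective B F₁ := by
  -- Descend from F to F₁ by maximal submodules; each step loses one finite simple quotient and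
  -- keeps projectivity, and the order of F'/F₁ drops.
  suffices H : ∀ n : ℕ, ∀ F' : Submodule B F, Module.Projective B F' → F₁ ≤ F' →
      Nat.card (F' ⧸ F₁.comap F'.subtype) = n → Module.Projective B F₁ by
    exact H _ ⊤ (Module.Projective.of_equiv Submodule.topEquiv.symm) le_top rfl
  intro n
  induction n using Nat.strong_induction_on with
  | _ n IH =>
  intro F' hF' hle hn
  have hfin : Finite (F' ⧸ F₁.comap F'.subtype) :=
    Finite.of_injective (Submodule.mapQ (F₁.comap F'.subtype) F₁ F'.subtype le_rfl) (by
      rw [← LinearMap.ker_eq_bot, Submodule.ker_mapQ]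
      exact Submodule.mkQ_map_self _)
  by_cases htop : F₁.comap F'.subtype = ⊤
  · have : F' ≤ F₁ := fun x hx => by
      have : (⟨x, hx⟩ : F') ∈ F₁.comap F'.subtype := by rw [htop]; trivial
      exact this
    rw [le_antisymm hle this]
    exact hF'
  obtain ⟨M, hM, hMs⟩ := exists_isCoatom_of_finite_quotient _ htop
  have hfinM : Finite (F' ⧸ M) := Finite.of_surjective (Submodule.factor hM)
    (Submodule.factor_surjective hM)
  have hE' : E ≤ Module.annihilator B (F' ⧸ M) := fun x hx => by
    rw [Module.mem_annihilator]
    intro m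
    obtain ⟨m, rfl⟩ := Submodule.Quotient.mk_surjective _ m
    rw [← Submodule.Quotient.mk_smul, Submodule.Quotient.mk_eq_zero]
    apply hM
    change x • m.1 ∈ F₁
    rw [← Submodule.Quotient.mk_eq_zero, Submodule.Quotient.mk_smul]
    exact Module.mem_annihilator.mp (hE hx) _
  have := hB F' M hfinM hMs hE'
  have hMproj : Module.Projective B M := projective_of_isSimpleModule_quotient M
  let F'' : Submodule B F := M.map F'.subtype
  have hF'' : F'' ≤ F' := by
    rintro _ ⟨x, -, rfl⟩; exact x.2
  have hle'' : F₁ ≤ F'' := fun x hx => ⟨⟨x, hle hx⟩, hM hx, rfl⟩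
  have hproj : Module.Projective B F'' :=
    Module.Projective.of_equiv (Submodule.equivMapOfInjective F'.subtype Subtype.val_injective M)
  refine IH _ ?_ F'' hproj hle'' rfl
  rw [← hn]
  let q : (F'' ⧸ F₁.comap F''.subtype) →ₗ[B] (F' ⧸ F₁.comap F'.subtype) :=
    Submodule.mapQ _ _ (Submodule.inclusion hF'') (fun x hx => hx)
  have hq : Function.Injective q := by
    rw [← LinearMap.ker_eq_bot]
    refine (Submodule.ker_mapQ _ _ _ _).trans ?_
    exact Submodule.mkQ_map_self _
  refine (Nat.card_le_card_of_injective q hq).lt_of_ne fun heq => ?_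
  have hsurj : Function.Surjective q := by
    have := Finite.of_injective q hq
    exact ((Nat.bijective_iff_injective_and_card q).mpr ⟨hq, heq⟩).2
  have hMtop : M = ⊤ := by
    rw [eq_top_iff]
    intro x _
    obtain ⟨y, hy⟩ := hsurj (Submodule.Quotient.mk x)
    obtain ⟨y, rfl⟩ := Submodule.Quotient.mk_surjective _ y
    have h1 : Submodule.inclusion hF'' y - x ∈ F₁.comap F'.subtype :=
      (Submodule.Quotient.eq _).mp hy
    have h2 := hM h1
    obtain ⟨z, hz, hzy⟩ := y.2
    have hzy' : z = Submodule.inclusion hF'' y := Subtype.ext hzy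
    rw [← hzy'] at h2
    have := M.sub_mem hz h2
    rwa [sub_sub_cancel] at this
  exact (isSimpleModule_iff_isCoatom.mp hMs).1 hMtop

end Hereditary

/-! ### Ideals and finite modules of ℤ_S[Γ] -/

section GroupRingModules

variable {Γ : Type u} [Group Γ] [Fintype Γ] {R : Subring ℚ}

/-- An ideal of `R[Γ]` as an `R`-submodule of `ℚ[Γ]`. -/
def idealLattice (I : Ideal (intGroupRing Γ R)) : Submodule R (MonoidAlgebra ℚ Γ) where
  carrier := {x | ∃ h : x ∈ intGroupRing Γ R, (⟨x, h⟩ : intGroupRing Γ R) ∈ I}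
  zero_mem' := ⟨zero_mem _, I.zero_mem⟩
  add_mem' := fun ⟨h, ha⟩ ⟨k, hb⟩ => ⟨add_mem h k, I.add_mem ha hb⟩
  smul_mem' := fun r x ⟨h, hx⟩ => by
    have hr : algebraMap R (MonoidAlgebra ℚ Γ) r ∈ intGroupRing Γ R := by
      have := (groupLattice Γ R).smul_mem r one_mem_groupLattice
      rwa [Algebra.smul_def, mul_one] at this
    have hrx : r • x = algebraMap R (MonoidAlgebra ℚ Γ) r * x := Algebra.smul_def r x
    refine ⟨by rw [hrx]; exact mul_mem hr h, ?_⟩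
    have h2 : (⟨r • x, by rw [hrx]; exact mul_mem hr h⟩ : intGroupRing Γ R) =
        ⟨_, hr⟩ * ⟨x, h⟩ := Subtype.ext hrx
    rw [h2]
    exact I.mul_mem_left _ hx

theorem mem_idealLattice_iff {I : Ideal (intGroupRing Γ R)} {x : MonoidAlgebra ℚ Γ} :
    x ∈ idealLattice I ↔ ∃ h : x ∈ intGroupRing Γ R, (⟨x, h⟩ : intGroupRing Γ R) ∈ I := Iff.rfl

theorem mem_of_mem_idealLattice {I : Ideal (intGroupRing Γ R)} {x : MonoidAlgebra ℚ Γ}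
    (h : x ∈ idealLattice I) : x ∈ intGroupRing Γ R := (mem_idealLattice_iff.mp h).choose

theorem mk_mem_of_mem_idealLattice {I : Ideal (intGroupRing Γ R)} {x : MonoidAlgebra ℚ Γ}
    (h : x ∈ idealLattice I) : (⟨x, mem_of_mem_idealLattice h⟩ : intGroupRing Γ R) ∈ I :=
  (mem_idealLattice_iff.mp h).choose_spec

theorem mem_idealLattice {I : Ideal (intGroupRing Γ R)} {x : intGroupRing Γ R} :
    x.1 ∈ idealLattice I ↔ x ∈ I := ⟨fun ⟨_, h⟩ => h, fun h => ⟨x.2, h⟩⟩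

theorem isFullIdeal_idealLattice (I : Ideal (intGroupRing Γ R)) [I.IsTwoSided] {a : ℕ} (ha : a ≠ 0)
    (haI : (a : intGroupRing Γ R) ∈ I) : IsFullIdeal (idealLattice I) where
  le x h := mem_of_mem_idealLattice h
  left x h y hy := by
    have hy' : y ∈ intGroupRing Γ R := hy
    refine mem_idealLattice_iff.mpr ⟨mul_mem hy' (mem_of_mem_idealLattice h), ?_⟩
    have h2 := I.mul_mem_left ⟨y, hy'⟩ (mk_mem_of_mem_idealLattice h)
    rwa [MulMemClass.mk_mul_mk] at h2
  right x h y hy := by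
    have hy' : y ∈ intGroupRing Γ R := hy
    refine mem_idealLattice_iff.mpr ⟨mul_mem (mem_of_mem_idealLattice h) hy', ?_⟩
    have h2 := I.mul_mem_right ⟨y, hy'⟩ (mk_mem_of_mem_idealLattice h)
    rwa [MulMemClass.mk_mul_mk] at h2
  full := ⟨a, ha, by
    have h := mem_idealLattice.mpr haI
    rwa [Subring.coe_natCast] at h⟩

theorem exists_sum_of_mem_mul {M N : Submodule R (MonoidAlgebra ℚ Γ)} {z : MonoidAlgebra ℚ Γ}
    (hz : z ∈ M * N) : ∃ (n : ℕ) (a b : Fin n → MonoidAlgebra ℚ Γ), (∀ i, a i ∈ M) ∧ (∀ i, b i ∈ N) ∧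
      z = ∑ i, a i * b i := by
  suffices h : ∃ l : List (MonoidAlgebra ℚ Γ × MonoidAlgebra ℚ Γ), (∀ p ∈ l, p.1 ∈ M ∧ p.2 ∈ N) ∧
      z = (l.map fun p => p.1 * p.2).sum by
    obtain ⟨l, hl, rfl⟩ := h
    refine ⟨l.length, fun i => (l.get i).1, fun i => (l.get i).2, fun i => (hl _ (l.get_mem i)).1,
      fun i => (hl _ (l.get_mem i)).2, ?_⟩
    conv_lhs => rw [← List.ofFn_get l, List.map_ofFn, List.sum_ofFn]
    rfl
  refine Submodule.mul_induction_on hz (fun a ha b hb => ⟨[(a, b)], by simpa using ⟨ha, hb⟩,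
    by simp⟩) ?_
  rintro _ _ ⟨l, hl, rfl⟩ ⟨l', hl', rfl⟩
  refine ⟨l ++ l', fun p hp => ?_, by simp⟩
  rcases List.mem_append.mp hp with h | h
  exacts [hl p h, hl' p h]

/-- Since R/aR is represented by 0, …, a - 1, so is R[Γ]/I by the group ring elements with these
coefficients. -/
theorem finite_quotient_of_natCast_mem {I : Ideal (intGroupRing Γ R)} {a : ℕ} (ha : a ≠ 0)
    (haI : (a : intGroupRing Γ R) ∈ I) : Finite (intGroupRing Γ R ⧸ I) := by
  let f : (Γ → Fin a) → intGroupRing Γ R ⧸ I := fun k =>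
    Submodule.Quotient.mk (∑ g, ((k g : ℕ) : intGroupRing Γ R) * groupElt R g)
  refine Finite.of_surjective f fun x => ?_
  obtain ⟨x, rfl⟩ := Submodule.Quotient.mk_surjective _ x
  have hx := mem_intGroupRing.mp x.2
  choose k hk s hs using fun g => exists_nat_residue R a ha ⟨x.1.coeff g, hx g⟩
  refine ⟨fun g => ⟨k g, hk g⟩, ?_⟩
  refine ((Submodule.Quotient.eq _).mpr ?_).symm
  let y : intGroupRing Γ R := ⟨MonoidAlgebra.ofCoeff (Finsupp.equivFunOnFinite.symm fun g => (s g).1),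
    mem_intGroupRing.mpr fun g => (s g).2⟩
  classical
  have : x - ∑ g, ((k g : ℕ) : intGroupRing Γ R) * groupElt R g = y * (a : intGroupRing Γ R) := by
    rw [sub_eq_iff_eq_add]
    refine Subtype.ext (MonoidAlgebra.ext (Finsupp.ext fun g => ?_))
    have h1 := congrArg Subtype.val (hs g)
    push_cast at h1
    rw [← nsmul_eq_mul']
    simp only [← nsmul_eq_mul]
    push_cast
    have h2 : ∀ k' : Γ, ((MonoidAlgebra.single k' (1 : ℚ)).coeff g : ℚ) =
        if k' = g then 1 else 0 := fun k' => by
      rw [MonoidAlgebra.coeff_single, Finsupp.single_apply]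
    simp only [groupElt, MonoidAlgebra.coeff_add, MonoidAlgebra.coeff_sum, MonoidAlgebra.coeff_smul,
      Finsupp.add_apply, Finsupp.smul_apply, Finsupp.finsetSum_apply, h2, y]
    simp [h1, add_comm]
  rw [this]
  exact I.mul_mem_left y haI

theorem natCard_mem_annihilator (B : Type*) [Ring B] (T : Type*) [AddCommGroup T] [Module B T]
    [Finite T] : ((Nat.card T : ℕ) : B) ∈ Module.annihilator B T := by
  rw [Module.mem_annihilator]
  intro m
  rw [Nat.cast_smul_eq_nsmul]
  exact card_nsmul_eq_zero'

variable {S : Set Nat.Primes} {e : MonoidAlgebra ℚ Γ}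

/-- The element `e` of `R[Γ]`. -/
def idemElt (heS : e ∈ intGroupRing Γ R) : intGroupRing Γ R := ⟨e, heS⟩

theorem coe_one_sub_idemElt (heS : e ∈ intGroupRing Γ R) :
    ((1 - idemElt heS : intGroupRing Γ R) : MonoidAlgebra ℚ Γ) = 1 - e := by
  rw [AddSubgroupClass.coe_sub, Subring.coe_one]; rfl

theorem one_sub_mem_idealLattice {heS : e ∈ intGroupRing Γ R} {I : Ideal (intGroupRing Γ R)}
    (h : 1 - idemElt heS ∈ I) : 1 - e ∈ idealLattice I := by
  have h := mem_idealLattice.mpr h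
  rwa [coe_one_sub_idemElt] at h

/-- Invertibility provides a dual basis: with 1 = ∑ cₖdₖ, where cₖ is in the dual and dₖ in `I`,
every x in `I` is ∑ (xcₖ)dₖ, and each x ↦ xcₖ is a linear map into the ring. -/
theorem projective_of_one_sub_mem (he : IsCentralIdempotent e) (hS : ∀ p ∈ S, IsGoodPrime p e)
    (I : Ideal (intGroupRing Γ (ZS S))) [I.IsTwoSided] {a : ℕ} (ha : a ≠ 0)
    (haI : (a : intGroupRing Γ (ZS S)) ∈ I) (hI : 1 - idemElt (mem_of_good hS) ∈ I) :
    Module.Projective (intGroupRing Γ (ZS S)) I := by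
  have hJ := isFullIdeal_idealLattice I ha haI
  have h0 := hJ.one_mem_dual_mul he hS (one_sub_mem_idealLattice hI)
  obtain ⟨n, c, d, hc, hd, h1⟩ := exists_sum_of_mem_mul h0
  let i : I →ₗ[intGroupRing Γ (ZS S)] (Fin n → intGroupRing Γ (ZS S)) :=
    { toFun := fun x k => ⟨x.1.1 * c k, hJ.mul_dual_mem (mem_idealLattice.mpr x.2) (hc k)⟩
      map_add' := fun x y => funext fun k => Subtype.ext (add_mul _ _ _)
      map_smul' := fun r x => funext fun k => Subtype.ext (mul_assoc _ _ _) }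
  let s : (Fin n → intGroupRing Γ (ZS S)) →ₗ[intGroupRing Γ (ZS S)] I :=
    { toFun := fun f => ∑ k, f k • (⟨⟨d k, mem_of_mem_idealLattice (hd k)⟩, mk_mem_of_mem_idealLattice (hd k)⟩ : I)
      map_add' := fun x y => by simp only [Pi.add_apply, add_smul, Finset.sum_add_distrib]
      map_smul' := fun r x => by
        simp only [Pi.smul_apply, smul_assoc, Finset.smul_sum, RingHom.id_apply] }
  refine Module.Projective.of_split i s (LinearMap.ext fun x => Subtype.ext (Subtype.ext ?_))
  change ((∑ k, i x k • (⟨⟨d k, mem_of_mem_idealLattice (hd k)⟩, mk_mem_of_mem_idealLattice (hd k)⟩ : I) : I) : intGroupRing Γ (ZS S)).1 = x.1.1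
  rw [AddSubmonoidClass.coe_finsetSum, AddSubmonoidClass.coe_finsetSum]
  change ∑ k, x.1.1 * c k * d k = x.1.1
  simp only [mul_assoc]
  rw [← Finset.mul_sum, ← h1, mul_one]

theorem projective_annihilator (he : IsCentralIdempotent e) (hS : ∀ p ∈ S, IsGoodPrime p e)
    (T : Type*) [AddCommGroup T] [Module (intGroupRing Γ (ZS S)) T] [Finite T]
    (hT : 1 - idemElt (mem_of_good hS) ∈ Module.annihilator (intGroupRing Γ (ZS S)) T) :
    Module.Projective (intGroupRing Γ (ZS S)) (Module.annihilator (intGroupRing Γ (ZS S)) T) :=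
  projective_of_one_sub_mem he hS _ (Nat.card_pos (α := T)).ne' (natCard_mem_annihilator _ T) hT

/-- If every prime in `S` is good for `e`, then a submodule of a projective `ℤ_S[Γ]`-module is
projective if the quotient is finite and `e` acts on it as the identity. -/
theorem projective_of_finite_quotient_of_good (he : IsCentralIdempotent e)
    (hS : ∀ p ∈ S, IsGoodPrime p e) {F : Type*} [AddCommGroup F]
    [Module (intGroupRing Γ (ZS S)) F] [Module.Projective (intGroupRing Γ (ZS S)) F]
    (F₁ : Submodule (intGroupRing Γ (ZS S)) F) [Finite (F ⧸ F₁)]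
    (hF : 1 - idemElt (mem_of_good hS) ∈ Module.annihilator (intGroupRing Γ (ZS S)) (F ⧸ F₁)) :
    Module.Projective (intGroupRing Γ (ZS S)) F₁ := by
  refine projective_of_finite_quotient (Ideal.span {1 - idemElt (mem_of_good hS)})
    (fun F' F'' hf _ hE => ?_) F₁ ?_
  · exact projective_annihilator he hS (F' ⧸ F'') (hE (Ideal.mem_span_singleton_self _))
  · rwa [Ideal.span_le, Set.singleton_subset_iff]

/-- The annihilators of two finite simple modules over a maximal order are either comparable or
coprime. -/
theorem inf_annihilator_le_mul (he : IsCentralIdempotent e) (hS : ∀ p ∈ S, IsGoodPrime p e)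
    (G T : Type*) [AddCommGroup G] [Module (intGroupRing Γ (ZS S)) G] [Finite G]
    [AddCommGroup T] [Module (intGroupRing Γ (ZS S)) T] [IsSimpleModule (intGroupRing Γ (ZS S)) T]
    (hG : 1 - idemElt (mem_of_good hS) ∈ Module.annihilator (intGroupRing Γ (ZS S)) G)
    (h : ¬ Module.annihilator (intGroupRing Γ (ZS S)) G ≤
      Module.annihilator (intGroupRing Γ (ZS S)) T) :
    Module.annihilator (intGroupRing Γ (ZS S)) G ⊓ Module.annihilator (intGroupRing Γ (ZS S)) T ≤
      Module.annihilator (intGroupRing Γ (ZS S)) G *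
        Module.annihilator (intGroupRing Γ (ZS S)) T := by
  set I := Module.annihilator (intGroupRing Γ (ZS S)) G
  set I' := Module.annihilator (intGroupRing Γ (ZS S)) T
  have hJ := isFullIdeal_idealLattice I (Nat.card_pos (α := G)).ne' (natCard_mem_annihilator _ G)
  have h0 := hJ.one_mem_mul_dual he hS (one_sub_mem_idealLattice hG)
  obtain ⟨n, c, d, hc, hd, h1⟩ := exists_sum_of_mem_mul h0
  rintro x ⟨hxI, hxI'⟩
  have hdx : ∀ k, d k * x.1 ∈ intGroupRing Γ (ZS S) := fun k =>
    hd k _ (mem_idealLattice.mpr hxI)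
  let y : Fin n → intGroupRing Γ (ZS S) := fun k => ⟨d k * x.1, hdx k⟩
  -- Since 1 = ∑ cₖdₖ with cₖ ∈ I and dₖ in the dual D, it is enough that each dₖx annihilates T.
  -- First, I(dₖx)T = 0, because I·D ⊆ B and x annihilates T.
  have hx : x = ∑ k, (⟨c k, mem_of_mem_idealLattice (hc k)⟩ : intGroupRing Γ (ZS S)) * y k := Subtype.ext (by
    rw [AddSubmonoidClass.coe_finsetSum]
    change x.1 = ∑ k, c k * (d k * x.1)
    simp only [← mul_assoc]
    rw [← Finset.sum_mul, ← h1, one_mul])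
  rw [hx]
  refine Submodule.sum_mem _ fun k _ => Submodule.smul_mem_smul (mk_mem_of_mem_idealLattice (hc k)) ?_
  have hIy : ∀ z ∈ I, ∀ t : T, z • y k • t = 0 := fun z hz t => by
    have : z * y k = (⟨z.1 * d k, hJ.mul_dual_mem (mem_idealLattice.mpr hz) (hd k)⟩ :
        intGroupRing Γ (ZS S)) * x := Subtype.ext (mul_assoc _ _ _).symm
    rw [smul_smul, this, mul_smul, Module.mem_annihilator.mp hxI' t, smul_zero]
  -- If dₖx did not kill T, some (dₖx)t would generate the simple module T, and I, which kills its
  -- multiples, would annihilate T.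
  by_contra hy
  rw [Module.mem_annihilator] at hy
  push Not at hy
  obtain ⟨t, ht⟩ := hy
  refine h fun z hz => Module.mem_annihilator.mpr fun t' => ?_
  have htop := IsSimpleModule.span_singleton_eq_top (intGroupRing Γ (ZS S)) ht
  obtain ⟨r, hr⟩ := Submodule.mem_span_singleton.mp (htop ▸ Submodule.mem_top (x := t'))
  rw [← hr, smul_smul]
  exact hIy _ (I.mul_mem_right r hz) t

end GroupRingModules

/-! ### Central idempotents and the permutation module on Γ/Γ' -/

section CentralIdempotents

/-- A two-sided ideal of a semisimple ring is generated by a central idempotent. -/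
theorem exists_centralIdempotent_of_isTwoSided {A : Type*} [Ring A] [IsSemisimpleRing A]
    (T : Ideal A) [T.IsTwoSided] :
    ∃ g ∈ T, IsCentralIdempotent g ∧ ∀ x ∈ T, x * g = x := by
  obtain ⟨g, hg, hT⟩ := IsSemisimpleRing.ideal_eq_span_idempotent T
  have hgT : g ∈ T := by rw [hT]; exact Ideal.mem_span_singleton_self g
  have hxg : ∀ x ∈ T, x * g = x := fun x hx => by
    rw [hT] at hx
    obtain ⟨y, rfl⟩ := Ideal.mem_span_singleton'.mp hx
    rw [mul_assoc, hg.eq]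
  -- In the opposite ring the same structure theorem yields a left identity of `T`. It must coincide
  -- with the right identity `g`, and a two-sided identity of a two-sided ideal is central.
  let T' : Ideal Aᵐᵒᵖ :=
    { carrier := {x | x.unop ∈ T}
      zero_mem' := T.zero_mem
      add_mem' := T.add_mem
      smul_mem' := fun c x hx => T.mul_mem_right c.unop hx }
  obtain ⟨g', hg', hT'⟩ := IsSemisimpleRing.ideal_eq_span_idempotent T'
  have hgT' : g'.unop ∈ T := by
    have : g' ∈ T' := by rw [hT']; exact Ideal.mem_span_singleton_self g'
    exact this
  have hgx : ∀ x ∈ T, g'.unop * x = x := fun x hx => by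
    have : MulOpposite.op x ∈ T' := hx
    rw [hT'] at this
    obtain ⟨y, hy⟩ := Ideal.mem_span_singleton'.mp this
    have h1 : x = g'.unop * y.unop := (congrArg MulOpposite.unop hy).symm
    have h2 : g'.unop * g'.unop = g'.unop := congrArg MulOpposite.unop hg'.eq
    rw [h1, ← mul_assoc, h2]
  have heq : g'.unop = g := by rw [← hxg _ hgT', hgx g hgT]
  refine ⟨g, hgT, ⟨hg, fun y => ?_⟩, hxg⟩
  rw [← hxg _ (T.mul_mem_right y hgT), mul_assoc, ← heq, hgx _ (heq ▸ T.mul_mem_left y hgT)]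

variable {Γ : Type u} [Group Γ] [Fintype Γ]

/-- `e_i` is contained in `e_{Γ/Γ'}` if and only if it acts non-trivially on the augmentation
representation. -/
theorem mem_components_augIdem {Γ' : Subgroup Γ} {i : IrrIdem Γ} :
    i ∈ Components (augIdem Γ') ↔ ∃ w ∈ augModule Γ', cosetAction Γ' i.1 w ≠ 0 := by
  classical
  have h : i.1 * augIdem Γ' =
      if ∃ w ∈ augModule Γ', cosetAction Γ' i.1 w ≠ 0 then i.1 else 0 := by
    unfold augIdem
    rw [Finset.mul_sum, Finset.sum_eq_single i]
    · split_ifs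
      exacts [i.mul_self, mul_zero _]
    · intro j _ hj
      split_ifs
      exacts [IrrIdem.mul_eq_zero hj.symm, mul_zero _]
    · simp
  change i.1 * augIdem Γ' = i.1 ↔ _
  rw [h]
  split_ifs with hw
  · simp [hw]
  · simp only [hw, iff_false]
    exact fun h0 => i.2.ne_zero h0.symm

theorem augIdem_mul_eq_self {Γ' : Subgroup Γ} {g : MonoidAlgebra ℚ Γ}
    (h : ∀ i ∈ Components (augIdem Γ'), i.1 * g = i.1) : augIdem Γ' * g = augIdem Γ' := by
  classical
  unfold augIdem
  rw [Finset.sum_mul]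
  refine Finset.sum_congr rfl fun i _ => ?_
  split_ifs with hw
  · exact h i (mem_components_augIdem.mpr hw)
  · exact zero_mul g

theorem cosetAction_single (Γ' : Subgroup Γ) (g : Γ) (x : Γ ⧸ Γ') :
    cosetAction Γ' (MonoidAlgebra.single g 1) (MonoidAlgebra.single x 1) =
      MonoidAlgebra.single (g • x) 1 := by
  simp [cosetAction]

theorem cosetAction_unitIdem (Γ' : Subgroup Γ) :
    cosetAction Γ' (unitIdem Γ') (MonoidAlgebra.single ((1 : Γ) : Γ ⧸ Γ') 1) =
      MonoidAlgebra.single ((1 : Γ) : Γ ⧸ Γ') 1 := by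
  classical
  unfold unitIdem
  have h : ∀ h : Γ', cosetAction Γ' (MonoidAlgebra.single (h : Γ) ((Nat.card Γ' : ℚ)⁻¹))
      (MonoidAlgebra.single ((1 : Γ) : Γ ⧸ Γ') 1) =
      ((Nat.card Γ' : ℚ)⁻¹) • MonoidAlgebra.single ((1 : Γ) : Γ ⧸ Γ') (1 : ℚ) := by
    intro h
    have h1 : MonoidAlgebra.single (h : Γ) ((Nat.card Γ' : ℚ)⁻¹)
        = ((Nat.card Γ' : ℚ)⁻¹) • MonoidAlgebra.single (h : Γ) (1 : ℚ) := by simp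
    rw [h1, map_smul, LinearMap.smul_apply, cosetAction_single]
    congr 2
    change (((h : Γ) * 1 : Γ) : Γ ⧸ Γ') = _
    rw [mul_one, QuotientGroup.eq]
    simp
  rw [map_sum, LinearMap.sum_apply, Finset.sum_congr rfl (fun k _ => h k), Finset.sum_const,
    Finset.card_univ, ← Nat.card_eq_fintype_card, ← Nat.cast_smul_eq_nsmul ℚ, smul_smul,
    mul_inv_cancel₀ (by exact_mod_cast Nat.card_pos.ne'), one_smul]

/-- The permutation module is generated by the coset of `1`, which e₁' fixes. If e_ie₁' vanished,
then e_i would kill this generator and hence, being central, the whole module. -/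
theorem mul_unitIdem_ne_zero {Γ' : Subgroup Γ} {i : IrrIdem Γ}
    (hi : i ∈ Components (augIdem Γ')) : i.1 * unitIdem Γ' ≠ 0 := by
  classical
  intro h0
  obtain ⟨w, -, hw⟩ := mem_components_augIdem.mp hi
  refine hw ?_
  clear hw
  have h1 : ∀ x : Γ ⧸ Γ', cosetAction Γ' i.1 (MonoidAlgebra.single x 1) = 0 := by
    intro x
    obtain ⟨g, rfl⟩ := QuotientGroup.mk_surjective x
    have h2 : MonoidAlgebra.single ((g : Γ) : Γ ⧸ Γ') (1 : ℚ) =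
        cosetAction Γ' (MonoidAlgebra.single g 1) (MonoidAlgebra.single ((1 : Γ) : Γ ⧸ Γ') 1) := by
      rw [cosetAction_single]
      congr 1
      change _ = ((g * 1 : Γ) : Γ ⧸ Γ')
      rw [mul_one]
    rw [h2, ← Module.End.mul_apply, ← map_mul, i.2.central, map_mul, Module.End.mul_apply,
      ← cosetAction_unitIdem, ← Module.End.mul_apply (cosetAction Γ' i.1), ← map_mul, h0, map_zero,
      LinearMap.zero_apply, map_zero]
  induction w using MonoidAlgebra.induction_linear with
  | zero => exact map_zero _
  | add a b ha hb => rw [map_add, ha, hb, add_zero]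
  | single x r =>
    have : MonoidAlgebra.single x r = r • MonoidAlgebra.single x (1 : ℚ) := by simp
    rw [this, map_smul, h1, smul_zero]

end CentralIdempotents

/-! ### An integral idempotent in place of e₁' -/

section LocalIdempotent

variable {Γ : Type u} [Group Γ] [Fintype Γ] {S : Set Nat.Primes}

theorem card_smul_unitIdem (H : Subgroup Γ) :
    (Nat.card H : ℚ) • unitIdem H = open Classical in ∑ h : H, MonoidAlgebra.single (h : Γ) (1 : ℚ) := by
  classical
  unfold unitIdem
  rw [Finset.smul_sum]
  refine Finset.sum_congr rfl fun h _ => ?_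
  rw [MonoidAlgebra.smul_single, smul_eq_mul,
    mul_inv_cancel₀ (by exact_mod_cast Nat.card_pos.ne')]

theorem card_smul_unitIdem_mem (R : Subring ℚ) (H : Subgroup Γ) :
    (Nat.card H : ℚ) • unitIdem H ∈ intGroupRing Γ R := by
  classical
  rw [card_smul_unitIdem]
  exact sum_mem fun h _ => single_mem_intGroupRing R _

/-- Over a ring in which every left ideal `I` of finite index with `1 - ε ∈ I` is projective, an
element `ν` with `ν² = nν` has a "normalized" version `c` with `cν = ν`. -/
theorem exists_linear_retraction {B : Type*} [Ring B] {ν ρ : B}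
    (hproj : Module.Projective B (Ideal.span {ν} ⊔ Ideal.span {ρ} : Ideal B)) :
    ∃ s t : (Ideal.span {ν} ⊔ Ideal.span {ρ} : Ideal B) →ₗ[B] B,
      ∀ x, s x * ν + t x * ρ = x.1 := by
  let φ : B × B →ₗ[B] (Ideal.span {ν} ⊔ Ideal.span {ρ} : Ideal B) :=
    (LinearMap.coprod (LinearMap.toSpanSingleton B B ν) (LinearMap.toSpanSingleton B B ρ)).codRestrict
      _ (fun x => Submodule.add_mem_sup (Ideal.mem_span_singleton'.mpr ⟨x.1, rfl⟩)
        (Ideal.mem_span_singleton'.mpr ⟨x.2, rfl⟩))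
  have hφ : Function.Surjective φ := by
    rintro ⟨x, hx⟩
    obtain ⟨y, hy, z, hz, rfl⟩ := Submodule.mem_sup.mp hx
    obtain ⟨a, rfl⟩ := Ideal.mem_span_singleton'.mp hy
    obtain ⟨b, rfl⟩ := Ideal.mem_span_singleton'.mp hz
    exact ⟨(a, b), rfl⟩
  obtain ⟨σ, hσ⟩ := Module.projective_lifting_property φ LinearMap.id hφ
  exact ⟨LinearMap.fst B B B ∘ₗ σ, LinearMap.snd B B B ∘ₗ σ, fun x =>
    congrArg Subtype.val (LinearMap.congr_fun hσ x)⟩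

/-- Put f = ee₁', n = |Γ'|, ν = nf and ρ = n(e - f) + (1 - e). The left ideal Bν + Bρ contains n and
1 - e, so it is projective and there are linear maps s, t with s(x)ν + t(x)ρ = x on it. Take c =
s(ν). Whatever fixes ν from the left fixes c, hence ec = c and γc = c; multiplying the identity for
x = ν by f from the right kills the second term, as ρf = 0, and leaves cf = f. -/
theorem exists_localIdempotent {e : MonoidAlgebra ℚ Γ} (he : IsCentralIdempotent e)
    (hS : ∀ p ∈ S, IsGoodPrime p e) (Γ' : Subgroup Γ) :
    ∃ c ∈ intGroupRing Γ (ZS S), e * c = c ∧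
      (∀ γ ∈ Γ', MonoidAlgebra.single γ (1 : ℚ) * c = c) ∧ c * unitIdem Γ' = e * unitIdem Γ' := by
  have heS := mem_of_good hS
  set n := Nat.card Γ' with hn
  have hn0 : (n : ℚ) ≠ 0 := by exact_mod_cast Nat.card_pos.ne'
  set f := e * unitIdem Γ' with hf
  have hff : f * f = f := unitProd_idem he Γ'
  have hef : e * f = f := by rw [hf, ← mul_assoc, he.idem.eq]
  have hfe : f * e = f := by rw [← he.central, hef]
  have hfS : (n : ℚ) • f ∈ intGroupRing Γ (ZS S) := by
    rw [hf, ← mul_smul_comm]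
    exact mul_mem heS (card_smul_unitIdem_mem _ Γ')
  have hneS : (n : ℚ) • e ∈ intGroupRing Γ (ZS S) := by
    rw [Nat.cast_smul_eq_nsmul]; exact nsmul_mem heS n
  let ν : intGroupRing Γ (ZS S) := ⟨(n : ℚ) • f, hfS⟩
  have hρS : (n : ℚ) • e - (n : ℚ) • f + (1 - e) ∈ intGroupRing Γ (ZS S) :=
    add_mem (sub_mem hneS hfS) (sub_mem (one_mem _) heS)
  let ρ : intGroupRing Γ (ZS S) := ⟨(n : ℚ) • e - (n : ℚ) • f + (1 - e), hρS⟩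
  let ε := idemElt heS
  let I : Ideal (intGroupRing Γ (ZS S)) := Ideal.span {ν} ⊔ Ideal.span {ρ}
  have hνI : ν ∈ I := Submodule.mem_sup_left (Ideal.mem_span_singleton_self ν)
  have hρI : ρ ∈ I := Submodule.mem_sup_right (Ideal.mem_span_singleton_self ρ)
  have hε : 1 - ε ∈ I := by
    have : 1 - ε = (1 - ε) * ρ := Subtype.ext (by
      rw [Subring.coe_mul, coe_one_sub_idemElt]
      change 1 - e = (1 - e) * ((n : ℚ) • e - (n : ℚ) • f + (1 - e))
      rw [mul_add, mul_sub, he.idem.one_sub.eq, mul_smul_comm, mul_smul_comm, sub_mul, sub_mul,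
        one_mul, one_mul, he.idem.eq, hef]
      simp)
    rw [this]
    exact I.mul_mem_left _ hρI
  have hnI : (n : intGroupRing Γ (ZS S)) ∈ I := by
    have : (n : intGroupRing Γ (ZS S)) = ν + ε * ρ + (n : intGroupRing Γ (ZS S)) * (1 - ε) :=
      Subtype.ext (by
        rw [Subring.coe_add, Subring.coe_add, Subring.coe_mul, Subring.coe_mul,
          coe_one_sub_idemElt, Subring.coe_natCast]
        change (n : MonoidAlgebra ℚ Γ) = (n : ℚ) • f +
          e * ((n : ℚ) • e - (n : ℚ) • f + (1 - e)) + n * (1 - e)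
        rw [mul_add, mul_sub, mul_smul_comm, mul_smul_comm, he.idem.eq, hef, mul_sub, mul_one,
          he.idem.eq, mul_sub, mul_one, ← nsmul_eq_mul, Nat.cast_smul_eq_nsmul,
          Nat.cast_smul_eq_nsmul]
        abel)
    rw [this]
    exact I.add_mem (I.add_mem hνI (I.mul_mem_left _ hρI)) (I.mul_mem_left _ hε)
  have := finite_quotient_of_natCast_mem (Nat.card_pos (α := Γ')).ne' hnI
  have hann : 1 - ε ∈ Module.annihilator (intGroupRing Γ (ZS S)) (intGroupRing Γ (ZS S) ⧸ I) := by
    rw [Module.mem_annihilator]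
    intro m
    obtain ⟨m, rfl⟩ := Submodule.Quotient.mk_surjective _ m
    rw [← Submodule.Quotient.mk_smul, Submodule.Quotient.mk_eq_zero]
    have : (1 - ε) • m = m * (1 - ε) := Subtype.ext (by
      rw [smul_eq_mul, Subring.coe_mul, Subring.coe_mul, coe_one_sub_idemElt, sub_mul, mul_sub,
        one_mul, mul_one, he.central])
    rw [this]
    exact I.mul_mem_left _ hε
  have hproj : Module.Projective (intGroupRing Γ (ZS S)) I :=
    projective_of_finite_quotient_of_good he hS I hann
  obtain ⟨s, t, hst⟩ := exists_linear_retraction hproj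
  let ν' : I := ⟨ν, hνI⟩
  have hsmul : ∀ x : intGroupRing Γ (ZS S), x.1 * f = f → x.1 * (s ν').1 = (s ν').1 := by
    intro x hx
    have h1 : x • ν' = ν' := Subtype.ext (Subtype.ext (by
      change x.1 * ((n : ℚ) • f) = (n : ℚ) • f
      rw [mul_smul_comm, hx]))
    have h2 := congrArg Subtype.val (congrArg s h1)
    rw [map_smul, smul_eq_mul, Subring.coe_mul] at h2
    exact h2
  refine ⟨(s ν').1, (s ν').2, hsmul ε hef, fun γ hγ => ?_, ?_⟩
  · refine hsmul (groupElt _ γ) ?_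
    change MonoidAlgebra.single γ 1 * f = f
    rw [hf, ← mul_assoc, ← he.central, mul_assoc, single_mul_unitIdem Γ' γ hγ]
  · have h1 := congrArg Subtype.val (hst ν')
    rw [Subring.coe_add, Subring.coe_mul, Subring.coe_mul] at h1
    have h2 : (s ν').1 * ((n : ℚ) • f) + (t ν').1 * ((n : ℚ) • e - (n : ℚ) • f + (1 - e)) =
      (n : ℚ) • f := h1
    have h3 := congrArg (· * f) h2
    simp only [add_mul, mul_assoc, sub_mul, smul_mul_assoc, hff, hef, one_mul, sub_self, mul_zero,
      add_zero, mul_smul_comm] at h3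
    have h4 : (s ν').1 * f = f := smul_right_injective _ hn0 h3
    have hce : (s ν').1 * e = (s ν').1 := by
      rw [← he.central]; exact hsmul ε hef
    rw [hf, ← mul_assoc, hce] at h4
    exact h4

/-- The conclusion is BcB = eB, with explicit coefficients. Put P = BcB and Q = B(1 - e). Then P + Q
is a two-sided ideal, idempotent since c and 1 - e are, and it contains a nonzero integer because no
component of e is killed by c. So it contains 1, and multiplying by e puts e into P. -/
theorem exists_full_of_localIdempotent {Γ' : Subgroup Γ}
    (hS : ∀ p ∈ S, IsGoodPrime p (augIdem Γ')) {c : MonoidAlgebra ℚ Γ}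
    (hcS : c ∈ intGroupRing Γ (ZS S)) (hec : augIdem Γ' * c = c)
    (hγ : ∀ γ ∈ Γ', MonoidAlgebra.single γ (1 : ℚ) * c = c)
    (hcu : c * unitIdem Γ' = augIdem Γ' * unitIdem Γ') :
    ∃ (n : ℕ) (x y : Fin n → MonoidAlgebra ℚ Γ), (∀ k, x k ∈ intGroupRing Γ (ZS S)) ∧
      (∀ k, y k ∈ intGroupRing Γ (ZS S)) ∧ ∑ k, x k * c * y k = augIdem Γ' := by
  set e := augIdem Γ' with he'
  have he : IsCentralIdempotent e := augIdem_central Γ'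
  have heS := mem_of_good hS
  have hcc : c * c = c := by
    have h1 : unitIdem Γ' * c = c := unitIdem_mul_of_invariant hγ
    calc c * c = c * (unitIdem Γ' * c) := by rw [h1]
      _ = e * c := by rw [← mul_assoc, hcu, mul_assoc, h1]
      _ = c := hec
  set L := groupLattice Γ (ZS S) with hL
  have hLL : L * L = L := by
    refine le_antisymm (Submodule.mul_le.mpr fun x hx y hy => mul_mem_groupLattice hx hy) ?_
    intro x hx
    have := Submodule.mul_mem_mul (one_mem_groupLattice (R := ZS S)) hx
    rwa [one_mul] at this
  let P : Submodule (ZS S) (MonoidAlgebra ℚ Γ) := L * Submodule.span (ZS S) {c} * L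
  let Q : Submodule (ZS S) (MonoidAlgebra ℚ Γ) := L * Submodule.span (ZS S) {1 - e}
  have hcP : ∀ x ∈ L, ∀ y ∈ L, x * c * y ∈ P := fun x hx y hy =>
    Submodule.mul_mem_mul (Submodule.mul_mem_mul hx (Submodule.mem_span_singleton_self c)) hy
  have hQ : ∀ x ∈ L, x * (1 - e) ∈ Q := fun x hx =>
    Submodule.mul_mem_mul hx (Submodule.mem_span_singleton_self _)
  have hP_ind : ∀ {p : MonoidAlgebra ℚ Γ → Prop}, (∀ x ∈ L, ∀ y ∈ L, p (x * c * y)) →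
      (∀ a b, p a → p b → p (a + b)) → ∀ z ∈ P, p z := by
    intro p h1 h2 z hz
    refine Submodule.mul_induction_on hz (fun w hw y hy => ?_) h2
    refine Submodule.mul_induction_on (C := fun w => p (w * y)) hw (fun x hx d hd => ?_)
      (fun a b ha hb => by rw [add_mul]; exact h2 _ _ ha hb)
    obtain ⟨r, rfl⟩ := Submodule.mem_span_singleton.mp hd
    have : x * r • c * y = (r • x) * c * y := by
      rw [mul_smul_comm, smul_mul_assoc, smul_mul_assoc, smul_mul_assoc]
    rw [this]
    exact h1 _ (L.smul_mem r hx) _ hy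
  have hQ_mem : ∀ z ∈ Q, ∃ x ∈ L, z = x * (1 - e) := by
    intro z hz
    refine Submodule.mul_induction_on hz (fun x hx d hd => ?_) ?_
    · obtain ⟨r, rfl⟩ := Submodule.mem_span_singleton.mp hd
      exact ⟨r • x, L.smul_mem r hx, by rw [mul_smul_comm, smul_mul_assoc]⟩
    · rintro _ _ ⟨x, hx, rfl⟩ ⟨y, hy, rfl⟩
      exact ⟨x + y, add_mem hx hy, by rw [add_mul]⟩
  have hone_sub : ∀ y, (1 - e) * y = y * (1 - e) := fun y => by
    rw [sub_mul, mul_sub, one_mul, mul_one, he.central]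
  have hPleft : ∀ y ∈ L, ∀ z ∈ P, y * z ∈ P := fun y hy z hz => by
    have := Submodule.mul_mem_mul hy hz
    rwa [← mul_assoc, ← mul_assoc, hLL] at this
  have hPright : ∀ y ∈ L, ∀ z ∈ P, z * y ∈ P := fun y hy z hz => by
    have := Submodule.mul_mem_mul hz hy
    rwa [mul_assoc, hLL] at this
  have hfull : ∃ a : ℕ, a ≠ 0 ∧ (a : ℚ) • e ∈ P := by
    -- Over ℚ the two-sided ideal of c is generated by a central idempotent g. A component e_i of e
    -- outside g would satisfy e_ic = 0, hence e_ie₁' = e_ice₁' = 0, which is excluded. So e lies in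
    -- this ideal, and some multiple of e lies in P.
    let T : Ideal (MonoidAlgebra ℚ Γ) := Ideal.span {z | ∃ y, z = c * y}
    have hT : T.IsTwoSided := ⟨fun {x} y hx => by
      induction hx using Submodule.span_induction with
      | mem x h =>
        obtain ⟨z, rfl⟩ := h
        exact Ideal.subset_span ⟨z * y, mul_assoc _ _ _⟩
      | zero => rw [zero_mul]; exact zero_mem _
      | add x y _ _ h1 h2 => rw [add_mul]; exact add_mem h1 h2
      | smul r x _ h => rw [smul_eq_mul, mul_assoc]; exact T.mul_mem_left r h⟩
    obtain ⟨g, hgT, hg, hxg⟩ := exists_centralIdempotent_of_isTwoSided T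
    have hcg : c * g = c := hxg c (Ideal.subset_span ⟨1, (mul_one c).symm⟩)
    have heg : e * g = e := by
      refine augIdem_mul_eq_self fun i hi => ?_
      rcases i.2.minimal (i.1 * g) (i.2.toIsCentralIdempotent.mul hg)
        (by rw [mul_assoc, hg.central, ← mul_assoc, i.mul_self]) with h0 | h1
      · exfalso
        apply mul_unitIdem_ne_zero hi
        have hic : i.1 * c = 0 := by
          rw [← hcg, ← hg.central, ← mul_assoc, h0, zero_mul]
        have hie : i.1 * e = i.1 := hi
        rw [← hie, mul_assoc, ← hcu, ← mul_assoc, hic, zero_mul]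
      · exact h1
    have heT : e ∈ T := by rw [← heg]; exact T.mul_mem_left e hgT
    have hT_den : ∀ z ∈ T, ∃ a : ℕ, a ≠ 0 ∧ (a : ℚ) • z ∈ P := by
      intro z hz
      induction hz using Submodule.span_induction with
      | mem z h =>
        obtain ⟨y, rfl⟩ := h
        obtain ⟨a, ha, hy⟩ := exists_int_mul_mem (ZS S) y
        refine ⟨a, ha, ?_⟩
        have := hcP 1 one_mem_groupLattice _ hy
        rwa [one_mul, mul_smul_comm] at this
      | zero => exact ⟨1, one_ne_zero, by rw [smul_zero]; exact zero_mem _⟩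
      | add x y _ _ h1 h2 =>
        obtain ⟨a, ha, hx⟩ := h1
        obtain ⟨b, hb, hy⟩ := h2
        refine ⟨a * b, mul_ne_zero ha hb, ?_⟩
        have : ((a * b : ℕ) : ℚ) • (x + y) = b • (a : ℚ) • x + a • (b : ℚ) • y := by
          rw [smul_add, ← Nat.cast_smul_eq_nsmul ℚ b, ← Nat.cast_smul_eq_nsmul ℚ a, smul_smul,
            smul_smul, Nat.cast_mul, mul_comm (b : ℚ)]
        rw [this]
        exact add_mem (nsmul_mem hx b) (nsmul_mem hy a)
      | smul r x _ h =>
        obtain ⟨a, ha, hx⟩ := h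
        obtain ⟨b, hb, hr⟩ := exists_int_mul_mem (ZS S) r
        refine ⟨b * a, mul_ne_zero hb ha, ?_⟩
        have := hPleft _ hr _ hx
        rwa [smul_mul_assoc, mul_smul_comm, smul_smul, ← Nat.cast_mul] at this
    exact hT_den e heT
  have hJ : IsFullIdeal (P ⊔ Q) := by
    refine ⟨sup_le (fun z hz => ?_) (fun z hz => ?_), fun x hx y hy => ?_, fun x hx y hy => ?_, ?_⟩
    · refine hP_ind (p := fun z => z ∈ L) (fun x hx y hy => ?_) (fun a b => add_mem) z hz
      exact mul_mem_groupLattice (mul_mem_groupLattice hx hcS) hy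
    · obtain ⟨x, hx, rfl⟩ := hQ_mem z hz
      exact mul_mem_groupLattice hx (sub_mem one_mem_groupLattice heS)
    · obtain ⟨a, ha, b, hb, rfl⟩ := Submodule.mem_sup.mp hx
      obtain ⟨b, hb', rfl⟩ := hQ_mem b hb
      rw [mul_add, ← mul_assoc y b]
      exact Submodule.add_mem_sup (hPleft y hy a ha) (hQ _ (mul_mem_groupLattice hy hb'))
    · obtain ⟨a, ha, b, hb, rfl⟩ := Submodule.mem_sup.mp hx
      obtain ⟨b, hb', rfl⟩ := hQ_mem b hb
      rw [add_mul, mul_assoc b, hone_sub, ← mul_assoc b]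
      exact Submodule.add_mem_sup (hPright y hy a ha) (hQ _ (mul_mem_groupLattice hb' hy))
    · obtain ⟨a, ha, haP⟩ := hfull
      refine ⟨a, ha, ?_⟩
      have : (a : MonoidAlgebra ℚ Γ) = (a : ℚ) • e + (a : MonoidAlgebra ℚ Γ) * (1 - e) := by
        rw [mul_sub, mul_one, ← nsmul_eq_mul, Nat.cast_smul_eq_nsmul]; abel
      rw [this]
      exact Submodule.add_mem_sup haP (hQ _ (natCast_mem (intGroupRing Γ (ZS S)) a))
  have h1e : 1 - e ∈ P ⊔ Q := by
    have := hQ 1 one_mem_groupLattice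
    rw [one_mul] at this
    exact Submodule.mem_sup_right this
  -- Since c is idempotent, xcy is the product of xc and cy; similarly for 1 - e.
  have hJJ : P ⊔ Q ≤ (P ⊔ Q) * (P ⊔ Q) := by
    refine sup_le (fun z hz => ?_) (fun z hz => ?_)
    · refine hP_ind (p := fun z => z ∈ (P ⊔ Q) * (P ⊔ Q)) (fun x hx y hy => ?_)
        (fun a b => add_mem) z hz
      have h1 := Submodule.mul_mem_mul
        (Submodule.mem_sup_left (T := Q) (hcP x hx 1 one_mem_groupLattice))
        (Submodule.mem_sup_left (T := Q) (hcP 1 one_mem_groupLattice y hy))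
      rwa [mul_one, one_mul, mul_assoc x c, ← mul_assoc c c, hcc, ← mul_assoc] at h1
    · obtain ⟨x, hx, rfl⟩ := hQ_mem z hz
      have h1 := Submodule.mul_mem_mul (Submodule.mem_sup_right (S := P) (hQ x hx)) h1e
      rwa [mul_assoc, he.idem.one_sub.eq] at h1
  have h1 := hJ.one_mem_of_le_mul he hS h1e hJJ
  obtain ⟨a, ha, b, hb, hab⟩ := Submodule.mem_sup.mp h1
  obtain ⟨b, hb, rfl⟩ := hQ_mem b hb
  have hea : e * a = e := by
    have := congrArg (e * ·) hab
    simp only [mul_add, mul_one] at this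
    rwa [← hone_sub, ← mul_assoc, mul_sub, mul_one, he.idem.eq, sub_self, zero_mul, add_zero] at this
  have heP : e ∈ P := by
    rw [← hea]; exact hPleft e heS a ha
  obtain ⟨n, w, y, hw, hy, hsum⟩ := exists_sum_of_mem_mul heP
  have hw' : ∀ k, ∃ x ∈ L, w k = x * c := fun k => by
    refine Submodule.mul_induction_on (hw k) (fun x hx d hd => ?_) ?_
    · obtain ⟨r, rfl⟩ := Submodule.mem_span_singleton.mp hd
      exact ⟨r • x, L.smul_mem r hx, by rw [mul_smul_comm, smul_mul_assoc]⟩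
    · rintro _ _ ⟨x, hx, rfl⟩ ⟨y, hy, rfl⟩
      exact ⟨x + y, add_mem hx hy, by rw [add_mul]⟩
  choose x hx hwx using hw'
  exact ⟨n, x, y, hx, hy, by rw [hsum]; exact Finset.sum_congr rfl fun k _ => by rw [hwx]⟩

end LocalIdempotent

/-! ### Morita equivalence for a full idempotent -/

section FullIdempotent

variable {O A : Type*} [Ring O] [Ring A]

/-- The map `i` identifies the `A`-module `X` with the part `cG` of the `O`-module `G` fixed by `c`,
where elements of `A` act through `lift`. -/
structure IsCornerPart (c : O) (lift : A → O) {G X : Type*} [AddCommGroup G] [Module O G]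
    [AddCommGroup X] [Module A X] (i : X →+ G) : Prop where
  inj : Function.Injective i
  mem_iff : ∀ g, c • g = g ↔ g ∈ Set.range i
  smul : ∀ a x, i (a • x) = lift a • i x

/-- A full idempotent `c` of `O` and a lift of the elements of `A`, which represents `cOc`. -/
structure IsFullCorner (c : O) (lift : A → O) {n : ℕ} (p q : Fin n → O) : Prop where
  idem : c * c = c
  exists_lift : ∀ x, c * x = x → ∃ a, lift a * c = x * c
  lift_inj : ∀ a b, lift a * c = lift b * c → a = b
  full : ∑ k, p k * c * q k = 1

variable {c : O} {lift : A → O} {n : ℕ} {p q : Fin n → O}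
  {G X : Type*} [AddCommGroup G] [Module O G] [AddCommGroup X] [Module A X] {i : X →+ G}
  {H Y : Type*} [AddCommGroup H] [Module O H] [AddCommGroup Y] [Module A Y] {j : Y →+ H}

namespace IsCornerPart

theorem smul_self (hi : IsCornerPart c lift i) (x : X) : c • i x = i x :=
  (hi.mem_iff _).mpr ⟨x, rfl⟩

theorem exists_proj (hc : c * c = c) (hi : IsCornerPart c lift i) :
    ∃ π : G →+ X, ∀ g, i (π g) = c • g := by
  have h : ∀ g, ∃ x, i x = c • g := fun g => (hi.mem_iff _).mp (by rw [smul_smul, hc])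
  choose π hπ using h
  exact ⟨{ toFun := π
           map_zero' := hi.inj (by rw [hπ, smul_zero, map_zero])
           map_add' := fun a b => hi.inj (by rw [hπ, map_add, hπ, hπ, smul_add]) }, hπ⟩

theorem exists_restrict (hi : IsCornerPart c lift i) (hj : IsCornerPart c lift j)
    (φ : G →ₗ[O] H) : ∃ ψ : X →ₗ[A] Y, ∀ x, j (ψ x) = φ (i x) := by
  have h : ∀ x, ∃ y, j y = φ (i x) := fun x => (hj.mem_iff _).mp (by
    rw [← map_smul, hi.smul_self])
  choose ψ hψ using h
  exact ⟨{ toFun := ψ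
           map_add' := fun a b => hj.inj (by rw [hψ, map_add, map_add, map_add, hψ, hψ])
           map_smul' := fun a x => hj.inj (by
            rw [hψ, hi.smul, map_smul, RingHom.id_apply, hj.smul, hψ]) }, hψ⟩

/-- Fullness writes g = ∑ pₖ(cqₖg), so a module is generated by its corner part. -/
theorem hom_ext (hF : IsFullCorner c lift p q) (hi : IsCornerPart c lift i) {φ φ' : G →ₗ[O] H}
    (h : ∀ x, φ (i x) = φ' (i x)) : φ = φ' := by
  obtain ⟨π, hπ⟩ := hi.exists_proj hF.idem
  refine LinearMap.ext fun g => ?_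
  have hg : g = ∑ k, p k • i (π (q k • g)) := by
    conv_lhs => rw [← one_smul O g, ← hF.full, Finset.sum_smul]
    exact Finset.sum_congr rfl fun k _ => by rw [hπ, smul_smul, smul_smul, mul_assoc]
  rw [hg, map_sum, map_sum]
  exact Finset.sum_congr rfl fun k _ => by rw [φ.map_smul, φ'.map_smul, h]

/-- The formula φ(g) = ∑ pₖψ(cqₖg) is forced by fullness. It is linear because, on the corner part,
cz acts as czc, which comes from an element of `A` and so commutes with ψ; expanding g once more by
fullness moves any scalar through. -/
theorem exists_extend (hF : IsFullCorner c lift p q) (hi : IsCornerPart c lift i)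
    (hj : IsCornerPart c lift j) (ψ : X →ₗ[A] Y) :
    ∃ φ : G →ₗ[O] H, ∀ x, φ (i x) = j (ψ x) := by
  obtain ⟨π, hπ⟩ := hi.exists_proj hF.idem
  have key : ∀ (z : O) (x : X), j (ψ (π (z • i x))) = (c * z) • j (ψ x) := by
    intro z x
    obtain ⟨a, ha⟩ := hF.exists_lift (c * z) (by rw [← mul_assoc, hF.idem])
    have h1 : π (z • i x) = a • x := hi.inj (by
      rw [hπ, hi.smul, ← hi.smul_self x, smul_smul, smul_smul, smul_smul, ha, mul_assoc])
    rw [h1, map_smul, hj.smul, ← hj.smul_self (ψ x), smul_smul, smul_smul, ha]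
  have hg : ∀ g, ∑ k, p k • i (π (q k • g)) = g := fun g => by
    conv_rhs => rw [← one_smul O g, ← hF.full, Finset.sum_smul]
    exact Finset.sum_congr rfl fun k _ => by rw [hπ, smul_smul, smul_smul, mul_assoc]
  refine ⟨{ toFun := fun g => ∑ k, p k • j (ψ (π (q k • g)))
            map_add' := fun a b => by
              simp only [smul_add, map_add, Finset.sum_add_distrib]
            map_smul' := fun r g => ?_ }, fun x => ?_⟩
  · have h2 : ∀ k, j (ψ (π (q k • r • g))) =
        ∑ l, (c * (q k * r * p l)) • j (ψ (π (q l • g))) := fun k => by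
      conv_lhs => rw [← hg g, smul_smul, Finset.smul_sum, map_sum, map_sum, map_sum]
      exact Finset.sum_congr rfl fun l _ => by rw [smul_smul, key]
    rw [RingHom.id_apply, Finset.smul_sum]
    rw [Finset.sum_congr rfl fun k _ => by rw [h2, Finset.smul_sum], Finset.sum_comm]
    simp only [smul_smul]
    refine Finset.sum_congr rfl fun l _ => ?_
    rw [← Finset.sum_smul]
    congr 1
    have : ∀ k, p k * (c * (q k * r * p l)) = (p k * c * q k) * (r * p l) := fun k => by
      simp only [mul_assoc]
    simp only [this]
    rw [← Finset.sum_mul, hF.full, one_mul]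
  · change ∑ k, p k • j (ψ (π (q k • i x))) = _
    simp only [key, smul_smul, ← mul_assoc]
    rw [← Finset.sum_smul, hF.full, one_smul]

/-- Two corner parts of the same module are isomorphic. -/
theorem exists_equivOfRange {X' : Type*} [AddCommGroup X'] [Module A X'] {i' : X' →+ G}
    (hi : IsCornerPart c lift i) (hi' : IsCornerPart c lift i') : Nonempty (X ≃ₗ[A] X') := by
  obtain ⟨ψ, hψ⟩ := hi.exists_restrict hi' (LinearMap.id : G →ₗ[O] G)
  obtain ⟨ψ', hψ'⟩ := hi'.exists_restrict hi (LinearMap.id : G →ₗ[O] G)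
  refine ⟨LinearEquiv.ofLinearMap ψ ψ' (LinearMap.ext fun x => hi'.inj ?_)
    (LinearMap.ext fun x => hi.inj ?_)⟩
  · rw [LinearMap.comp_apply, hψ, hψ']; rfl
  · rw [LinearMap.comp_apply, hψ', hψ]; rfl

/-- Isomorphisms of `O`-modules correspond to isomorphisms of their corner parts. -/
theorem exists_equiv (hF : IsFullCorner c lift p q) (hi : IsCornerPart c lift i)
    (hj : IsCornerPart c lift j) : Nonempty ((G ≃ₗ[O] H) ≃ (X ≃ₗ[A] Y)) := by
  have h1 : ∀ φ : G ≃ₗ[O] H, ∃ ψ : X ≃ₗ[A] Y, ∀ x, j (ψ x) = φ (i x) := fun φ => by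
    obtain ⟨ψ, hψ⟩ := hi.exists_restrict hj φ.toLinearMap
    obtain ⟨ψ', hψ'⟩ := hj.exists_restrict hi φ.symm.toLinearMap
    refine ⟨LinearEquiv.ofLinearMap ψ ψ' (LinearMap.ext fun x => hj.inj ?_)
      (LinearMap.ext fun x => hi.inj ?_), hψ⟩
    · rw [LinearMap.comp_apply, hψ, hψ']; simp
    · rw [LinearMap.comp_apply, hψ', hψ]; simp
  have h2 : ∀ ψ : X ≃ₗ[A] Y, ∃ φ : G ≃ₗ[O] H, ∀ x, φ (i x) = j (ψ x) := fun ψ => by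
    obtain ⟨φ, hφ⟩ := hi.exists_extend hF hj ψ.toLinearMap
    obtain ⟨φ', hφ'⟩ := hj.exists_extend hF hi ψ.symm.toLinearMap
    refine ⟨LinearEquiv.ofLinearMap φ φ' (hom_ext hF hj fun x => ?_) (hom_ext hF hi fun x => ?_), hφ⟩
    · rw [LinearMap.comp_apply, hφ', hφ]; simp
    · rw [LinearMap.comp_apply, hφ, hφ']; simp
  choose f hf using h1
  choose g hg using h2
  exact ⟨{ toFun := f
           invFun := g
           left_inv := fun φ => LinearEquiv.toLinearMap_injective (hom_ext hF hi fun x => by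
            simp only [LinearEquiv.coe_coe]
            rw [hg, hf])
           right_inv := fun ψ => LinearEquiv.ext fun x => hj.inj (by rw [hf, hg]) }⟩

/-- Every `A`-module is the corner part of an `O`-module. -/
theorem exists_module {Q : Type u} {Z : Type u} [AddCommGroup Q] [Module A Q] {O : Type u} [Ring O]
    {c : O} {lift : A → O} {n : ℕ} {p q : Fin n → O} [AddCommGroup Z] [Module A Z] {k : Z →+ O}
    (hF : IsFullCorner c lift p q) (hk : IsCornerPart c lift k) [Finite Q] :
    ∃ (G : Type u) (_ : AddCommGroup G) (_ : Module O G) (_ : Finite G) (i : Q →+ G),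
      IsCornerPart c lift i := by
  -- The module sought is Hom_A(cO, Q), with `O` acting through right multiplication on cO. Its
  -- corner part is Hom_A(cOc, Q) = Q, via z ↦ α(z)m where α(z) ∈ A represents zc.
  have hR : ∀ r : O, ∃ ρ : Z →ₗ[A] Z, ∀ z, k (ρ z) = k z * r := fun r =>
    hk.exists_restrict hk (LinearMap.toSpanSingleton O O r)
  choose ρ hρ using hR
  let M : Module O (Z →ₗ[A] Q) :=
    { smul := fun r h => h ∘ₗ ρ r
      one_smul := fun h => LinearMap.ext fun z => congrArg h (hk.inj (by rw [hρ, mul_one]))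
      mul_smul := fun r s h => LinearMap.ext fun z => congrArg h (hk.inj (by
        rw [hρ, hρ, hρ, mul_assoc]))
      smul_zero := fun r => rfl
      smul_add := fun r h h' => rfl
      add_smul := fun r s h => LinearMap.ext fun z => by
        change h (ρ (r + s) z) = h (ρ r z) + h (ρ s z)
        rw [← map_add]
        exact congrArg h (hk.inj (by rw [hρ, map_add, hρ, hρ, mul_add]))
      zero_smul := fun h => LinearMap.ext fun z => by
        change h (ρ 0 z) = 0
        rw [← map_zero h]
        exact congrArg h (hk.inj (by rw [hρ, map_zero, mul_zero])) }
  have hsmul : ∀ (r : O) (h : Z →ₗ[A] Q) z, (r • h) z = h (ρ r z) := fun r h z => rfl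
  -- the element `c` of `cO`
  obtain ⟨z₀, hz₀⟩ := (hk.mem_iff c).mp (by rw [smul_eq_mul, hF.idem])
  have hcz : ∀ z, c * k z = k z := hk.smul_self
  -- for `z` in `cO` the element `zc` of `cOc`, as an element of `A`
  have hα : ∀ z, ∃ a : A, lift a * c = k z * c := fun z => hF.exists_lift _ (hcz z)
  choose α hα using hα
  have hz : ∀ a : A, k (a • z₀) = lift a * c := fun a => by rw [hk.smul, hz₀, smul_eq_mul]
  have hcl : ∀ a : A, c * (lift a * c) = lift a * c := fun a => by rw [← hz, hcz]
  have hαu : ∀ z a, lift a * c = k z * c → α z = a := fun z a h =>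
    hF.lift_inj _ _ ((hα z).trans h.symm)
  have hlm : ∀ a b, lift (a * b) * c = lift a * (lift b * c) := fun a b => by
    rw [← hz, mul_smul, hk.smul, hz, smul_eq_mul]
  have hla : ∀ a b, lift (a + b) * c = lift a * c + lift b * c := fun a b => by
    rw [← hz, add_smul, map_add, hz, hz]
  let i : Q →+ (Z →ₗ[A] Q) :=
    { toFun := fun m =>
        { toFun := fun z => α z • m
          map_add' := fun z z' => by
            rw [← add_smul]
            congr 1
            exact hαu _ _ (by rw [hla, hα, hα, map_add, add_mul])
          map_smul' := fun a z => by
            rw [RingHom.id_apply, ← mul_smul]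
            congr 1
            exact hαu _ _ (by rw [hlm, hα, hk.smul, smul_eq_mul, mul_assoc]) }
      map_zero' := LinearMap.ext fun z => smul_zero _
      map_add' := fun m m' => LinearMap.ext fun z => smul_add _ _ _ }
  have hi : ∀ m z, i m z = α z • m := fun m z => rfl
  have hρz : ∀ z, ρ c z = α z • z₀ := fun z => hk.inj (by rw [hρ, hz, hα])
  have hi₀ : ∀ m, i m z₀ = m := fun m => by
    rw [hi, hαu z₀ 1, one_smul]
    rw [← hz, one_smul, hz₀, hF.idem]
  have hy : ∀ l, ∃ y, k y = c * q l := fun l => (hk.mem_iff _).mp (by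
    rw [smul_eq_mul, ← mul_assoc, hF.idem])
  choose y hy using hy
  refine ⟨Z →ₗ[A] Q, inferInstance, M, ?_, i, fun m m' h => ?_, fun h => ⟨fun hc => ?_, ?_⟩,
    fun a m => LinearMap.ext fun z => ?_⟩
  · refine Finite.of_injective (fun (h : Z →ₗ[A] Q) l => h (y l)) fun h h' hh => ?_
    -- Over `A` the elements cqₗ generate cO, because z = ∑ (zpₗc)(cqₗ); a homomorphism is
    -- determined by finitely many values in `Q`.
    have hexp : ∀ z, z = ∑ l, α (ρ (p l) z) • y l := fun z => hk.inj (by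
      rw [map_sum]
      conv_lhs => rw [← mul_one (k z), ← hF.full, Finset.mul_sum]
      refine Finset.sum_congr rfl fun l _ => ?_
      rw [hk.smul, hy, smul_eq_mul, ← mul_assoc (lift _), hα, hρ, mul_assoc, mul_assoc, mul_assoc])
    refine LinearMap.ext fun z => ?_
    rw [hexp z, map_sum, map_sum]
    exact Finset.sum_congr rfl fun l _ => by
      rw [h.map_smul, h'.map_smul]
      exact congrArg _ (congrFun hh l)
  · rw [← hi₀ m, h, hi₀]
  · refine ⟨h z₀, LinearMap.ext fun z => ?_⟩
    conv_rhs => rw [← hc, hsmul, hρz, h.map_smul]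
    rfl
  · rintro ⟨m, rfl⟩
    refine LinearMap.ext fun z => ?_
    rw [hsmul, hi, hi, hαu (ρ c z) (α z) (by rw [hα, hρ, mul_assoc, hF.idem])]
  · rw [hsmul, hi, hi, hαu (ρ (lift a) z) (α z * a), mul_smul]
    rw [hlm, ← hcl, ← mul_assoc, hα, hρ, mul_assoc, hcl, mul_assoc]

end IsCornerPart

end FullIdempotent

/-! ### The order 𝔬 as a corner ring -/

section LocalIdempotent

variable {Γ : Type u} [Group Γ] [Fintype Γ] {R : Subring ℚ} {e c : MonoidAlgebra ℚ Γ}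
  {he : IsCentralIdempotent e} {Γ' : Subgroup Γ}

theorem ambient_injective : Function.Injective (ambient (R := R) (he := he)) := fun x y h =>
  Subtype.ext (Subtype.ext h)

theorem e_mul_ambient (x : idemOrder R he) : e * ambient x = ambient x :=
  ((Subsemigroup.mem_corner_iff he.idem).mp x.1.2).1

theorem ambient_mul_e (x : idemOrder R he) : ambient x * e = ambient x :=
  ((Subsemigroup.mem_corner_iff he.idem).mp x.1.2).2

theorem ambient_mul (x y : idemOrder R he) : ambient (x * y) = ambient x * ambient y := rfl

theorem ambient_toIdemOrder (x : intGroupRing Γ R) : ambient (toIdemOrder R he x) = e * x.1 := rfl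

/-- The element `y` of `𝔬` attached to an element `x` of `eR[Γ]` fixed by `Γ'`: `y = xe₁'`. -/
theorem exists_heckeOrder_of_invariant (x : idemOrder R he)
    (hx : ∀ γ ∈ Γ', MonoidAlgebra.single γ (1 : ℚ) * ambient x = ambient x) :
    ∃ y : heckeOrder R he Γ', y.1.1 = ambient x * unitIdem Γ' := by
  have h1 : e * unitIdem Γ' * (ambient x * unitIdem Γ') = ambient x * unitIdem Γ' := by
    rw [mul_assoc, ← mul_assoc (unitIdem Γ'), unitIdem_mul_of_invariant hx, ← mul_assoc,
      e_mul_ambient]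
  have h2 : ambient x * unitIdem Γ' * (e * unitIdem Γ') = ambient x * unitIdem Γ' := by
    rw [he.central, ← mul_assoc, mul_assoc (ambient x), unitIdem_idem, mul_assoc, ← he.central,
      ← mul_assoc, ← he.central, e_mul_ambient]
  obtain ⟨z, hz, hxz⟩ := x.2
  refine ⟨⟨⟨ambient x * unitIdem Γ', (Subsemigroup.mem_corner_iff (unitProd_idem he Γ')).mpr
    ⟨h1, h2⟩⟩, ⟨z, hz, by rw [← hxz]; rfl⟩, fun γ hγ => ?_⟩, rfl⟩
  change _ * (ambient x * unitIdem Γ') = ambient x * unitIdem Γ'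
  rw [← mul_assoc, hx γ hγ]

theorem localIdempotent_mul_self (he : IsCentralIdempotent e) (hec : e * c = c)
    (hγ : ∀ γ ∈ Γ', MonoidAlgebra.single γ (1 : ℚ) * c = c)
    (hcu : c * unitIdem Γ' = e * unitIdem Γ') : c * c = c := by
  calc c * c = c * unitIdem Γ' * c := by rw [mul_assoc, unitIdem_mul_of_invariant hγ]
    _ = c := by rw [hcu, mul_assoc, unitIdem_mul_of_invariant hγ, hec]

/-- Right multiplication by c and by e₁' are inverse to each other: (xe₁')c = xc because e₁'c = c,
and (xc)e₁' = xe₁' for x in eB because ce₁' = ee₁'. This identifies 𝔬 with cBc. -/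
theorem isFullCorner_localIdempotent (hcR : c ∈ intGroupRing Γ R) (hec : e * c = c)
    (hγ : ∀ γ ∈ Γ', MonoidAlgebra.single γ (1 : ℚ) * c = c)
    (hcu : c * unitIdem Γ' = e * unitIdem Γ') {n : ℕ} {x y : Fin n → MonoidAlgebra ℚ Γ}
    (hx : ∀ k, x k ∈ intGroupRing Γ R) (hy : ∀ k, y k ∈ intGroupRing Γ R)
    (hxy : ∑ k, x k * c * y k = e) :
    IsFullCorner (toIdemOrder R he ⟨c, hcR⟩)
      (heckeOrder.lift : heckeOrder R he Γ' → idemOrder R he)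
      (fun k => toIdemOrder R he ⟨x k, hx k⟩) (fun k => toIdemOrder R he ⟨y k, hy k⟩) where
  idem := ambient_injective (by
    rw [ambient_mul, ambient_toIdemOrder, hec]
    exact localIdempotent_mul_self he hec hγ hcu)
  exists_lift z hz := by
    have hz' : c * ambient z = ambient z := by
      conv_rhs => rw [← hz, ambient_mul, ambient_toIdemOrder, hec]
    obtain ⟨a, ha⟩ := exists_heckeOrder_of_invariant (Γ' := Γ') z fun γ h => by
      rw [← hz', ← mul_assoc, hγ γ h]
    refine ⟨a, ambient_injective ?_⟩
    rw [ambient_mul, ambient_mul, ambient_toIdemOrder, hec]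
    conv_lhs => rw [← unitIdem_mul_of_invariant hγ, ← mul_assoc, heckeOrder.lift_spec, ha, mul_assoc,
      unitIdem_mul_of_invariant hγ]
  lift_inj a b hab := by
    have h := congrArg (fun z => ambient z * unitIdem Γ') hab
    simp only [ambient_mul, ambient_toIdemOrder, hec, mul_assoc, hcu] at h
    rw [← mul_assoc, ambient_mul_e, ← mul_assoc, ambient_mul_e, heckeOrder.lift_spec,
      heckeOrder.lift_spec] at h
    exact Subtype.ext (Subtype.ext h)
  full := by
    have h : ∑ k, (⟨x k, hx k⟩ : intGroupRing Γ R) * ⟨c, hcR⟩ * ⟨y k, hy k⟩ =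
        ⟨e, hxy ▸ sum_mem fun k _ => mul_mem (mul_mem (hx k) hcR) (hy k)⟩ := by
      refine Subtype.ext ?_
      rw [AddSubmonoidClass.coe_finsetSum]
      exact hxy
    refine ambient_injective ?_
    simp only [← map_mul, ← map_sum]
    rw [h]
    exact he.idem

variable {G : Type*} [AddCommGroup G] [Module (idemOrder R he) G]

/-- From γc = c every element of cG is fixed by Γ'. Conversely c and 1 have the same product with
e₁', and elements of eB with the same product with e₁' act alike on fixed elements, even when e₁'
itself is not integral. -/
theorem isCornerPart_fixedPart (heR : e ∈ intGroupRing Γ R) (hcR : c ∈ intGroupRing Γ R)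
    (hec : e * c = c) (hγ : ∀ γ ∈ Γ', MonoidAlgebra.single γ (1 : ℚ) * c = c)
    (hcu : c * unitIdem Γ' = e * unitIdem Γ') :
    letI := fixedPartModule (hc := he) heR Γ' G
    IsCornerPart (A := heckeOrder R he Γ') (toIdemOrder R he ⟨c, hcR⟩) heckeOrder.lift
      (fixedPart R he Γ' G).subtype :=
  letI := fixedPartModule (hc := he) heR Γ' G
  { inj := Subtype.val_injective
    mem_iff := fun g => by
      constructor
      · intro h
        refine ⟨⟨g, fun γ hγ' => ?_⟩, rfl⟩
        rw [← h, smul_smul, ← map_mul]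
        congr 2
        exact Subtype.ext (hγ γ hγ')
      · rintro ⟨m, rfl⟩
        change _ • m.1 = m.1
        conv_rhs => rw [← one_smul (idemOrder R he) m.1]
        refine smul_eq_smul_of_mul_unitIdem heR ?_ m.2
        rw [ambient_toIdemOrder, hec, hcu]
        rfl
    smul := fun a x => rfl }

end LocalIdempotent

/-! ### The bijection between classes of eℤ_S[Γ]-modules and 𝔬-modules -/

section FixedClass

variable {Γ : Type u} [Group Γ] [Fintype Γ] {Γ' : Subgroup Γ} {S : Set Nat.Primes}

theorem exists_isFullCorner (hS : ∀ p ∈ S, IsGoodPrime p (augIdem Γ')) :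
    ∃ (c : intGroupRing Γ (ZS S)), augIdem Γ' * c.1 = c.1 ∧
      (∀ γ ∈ Γ', MonoidAlgebra.single γ (1 : ℚ) * c.1 = c.1) ∧
      c.1 * unitIdem Γ' = augIdem Γ' * unitIdem Γ' ∧
      ∃ (n : ℕ) (p q : Fin n → idemOrder (ZS S) (augIdem_central Γ')),
      IsFullCorner (toIdemOrder (ZS S) (augIdem_central Γ') c)
        (heckeOrder.lift : heckeOrder (ZS S) (augIdem_central Γ') Γ' → _) p q := by
  obtain ⟨c, hcR, hec, hγ, hcu⟩ := exists_localIdempotent (augIdem_central Γ') hS Γ'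
  obtain ⟨n, x, y, hx, hy, h⟩ := exists_full_of_localIdempotent hS hcR hec hγ hcu
  exact ⟨⟨c, hcR⟩, hec, hγ, hcu, n, _, _, isFullCorner_localIdempotent hcR hec hγ hcu hx hy h⟩

/-- Isomorphisms of fixed parts extend to the modules. A module with prescribed fixed part is a
module of homomorphisms from the fixed part of the ring eB itself. -/
theorem fixedClass_bijective (hS : ∀ p ∈ S, IsGoodPrime p (augIdem Γ')) :
    Function.Bijective (fixedClass (mem_of_good hS) (augIdem_central Γ') Γ') := by
  obtain ⟨⟨c, hcR⟩, hec, hγ, hcu, n, p, q, hF⟩ := exists_isFullCorner hS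
  have hcp := fun (G : Type u) [AddCommGroup G] [Module (idemOrder (ZS S) (augIdem_central Γ')) G] =>
    isCornerPart_fixedPart (G := G) (mem_of_good hS) hcR hec hγ hcu
  constructor
  · rintro ⟨G⟩ ⟨H⟩ h
    obtain ⟨ψ⟩ := Quotient.exact h
    let _ := fixedPartModule (hc := augIdem_central Γ') (mem_of_good hS) Γ' G.carrier
    let _ := fixedPartModule (hc := augIdem_central Γ') (mem_of_good hS) Γ' H.carrier
    obtain ⟨E⟩ := (hcp G.carrier).exists_equiv hF (hcp H.carrier)
    exact Quotient.sound ⟨E.symm ψ⟩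
  · rintro ⟨Q⟩
    let _ := fixedPartModule (hc := augIdem_central Γ') (mem_of_good hS) Γ'
      (idemOrder (ZS S) (augIdem_central Γ'))
    obtain ⟨G, _, _, _, i, hi⟩ := IsCornerPart.exists_module (Q := Q.carrier) hF (hcp _)
    let _ := fixedPartModule (hc := augIdem_central Γ') (mem_of_good hS) Γ' G
    obtain ⟨ψ⟩ := (hcp G).exists_equivOfRange hi
    exact ⟨FinModClass.of _ G, Quotient.sound ⟨ψ⟩⟩

theorem card_aut_fixedPart (hS : ∀ p ∈ S, IsGoodPrime p (augIdem Γ')) (G : Type*) [AddCommGroup G]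
    [Module (idemOrder (ZS S) (augIdem_central Γ')) G] :
    letI := fixedPartModule (hc := augIdem_central Γ') (mem_of_good hS) Γ' G
    Nat.card (fixedPart (ZS S) (augIdem_central Γ') Γ' G ≃ₗ[heckeOrder (ZS S) (augIdem_central Γ') Γ']
      fixedPart (ZS S) (augIdem_central Γ') Γ' G) =
    Nat.card (G ≃ₗ[idemOrder (ZS S) (augIdem_central Γ')] G) := by
  obtain ⟨⟨c, hcR⟩, hec, hγ, hcu, n, p, q, hF⟩ := exists_isFullCorner hS
  let _ := fixedPartModule (hc := augIdem_central Γ') (mem_of_good hS) Γ' G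
  have hcp := isCornerPart_fixedPart (G := G) (mem_of_good hS) hcR hec hγ hcu
  obtain ⟨E⟩ := hcp.exists_equiv hF hcp
  exact (Nat.card_congr E).symm

end FixedClass

/-! ### Counting homomorphisms from projective modules -/

section HomCount

variable {B : Type u} [Ring B]

theorem finite_linearMap (F G : Type*) [AddCommGroup F] [Module B F] [Module.Finite B F]
    [AddCommGroup G] [Module B G] [Finite G] : Finite (F →ₗ[B] G) := by
  obtain ⟨s, hs⟩ := (Module.Finite.fg_top : (⊤ : Submodule B F).FG)
  exact Finite.of_injective (fun (h : F →ₗ[B] G) (x : s) => h x.1) fun h h' hh =>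
    LinearMap.ext_on hs fun x hx => congrFun hh ⟨x, hx⟩

theorem card_linearMap_pos (F G : Type*) [AddCommGroup F] [Module B F] [Module.Finite B F]
    [AddCommGroup G] [Module B G] [Finite G] : 0 < Nat.card (F →ₗ[B] G) := by
  have := finite_linearMap (B := B) F G
  exact Nat.card_pos

theorem card_linearMap_congr {F F' : Type*} (G : Type*) [AddCommGroup F] [Module B F]
    [AddCommGroup F'] [Module B F'] [AddCommGroup G] [Module B G] (θ : F ≃ₗ[B] F') :
    Nat.card (F →ₗ[B] G) = Nat.card (F' →ₗ[B] G) :=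
  Nat.card_congr (LinearEquiv.congrLeft G ℕ θ).toEquiv

/-- The homomorphisms from a split extension. -/
theorem card_linearMap_of_surjective {P F K G : Type*} [AddCommGroup P] [Module B P]
    [AddCommGroup F] [Module B F] [AddCommGroup K] [Module B K] [AddCommGroup G] [Module B G]
    [Module.Projective B F] (f : P →ₗ[B] F) (hf : Function.Surjective f) (j : K →ₗ[B] P)
    (hj : Function.Injective j) (hjf : LinearMap.range j = LinearMap.ker f) :
    Nat.card (P →ₗ[B] G) = Nat.card (F →ₗ[B] G) * Nat.card (K →ₗ[B] G) := by
  obtain ⟨σ, hσ⟩ := Module.projective_lifting_property f LinearMap.id hf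
  have hσ' : ∀ x, f (σ x) = x := fun x => LinearMap.congr_fun hσ x
  have hfj : ∀ x, f (j x) = 0 := fun x => by
    rw [← LinearMap.mem_ker, ← hjf]; exact ⟨x, rfl⟩
  let ρ : P →ₗ[B] K := (LinearEquiv.ofInjective j hj).symm.toLinearMap ∘ₗ
    (LinearMap.id - σ ∘ₗ f).codRestrict (LinearMap.range j) (fun x => by
      rw [hjf, LinearMap.mem_ker]
      simp [hσ'])
  have hρ : ∀ x, j (ρ x) = x - σ (f x) := fun x => congrArg Subtype.val
    (LinearEquiv.apply_symm_apply (LinearEquiv.ofInjective j hj) _)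
  rw [← Nat.card_prod]
  refine Nat.card_congr
    { toFun := fun h => (h ∘ₗ σ, h ∘ₗ j)
      invFun := fun p => p.1 ∘ₗ f + p.2 ∘ₗ ρ
      left_inv := fun h => LinearMap.ext fun x => ?_
      right_inv := fun p => Prod.ext (LinearMap.ext fun x => ?_) (LinearMap.ext fun x => ?_) }
  · simp [hρ]
  · have : ρ (σ x) = 0 := hj (by rw [hρ, hσ', sub_self, map_zero])
    simp [hσ', this]
  · have : ρ (j x) = x := hj (by rw [hρ, hfj, map_zero, sub_zero])
    simp [hfj, this]

/-- Schanuel's lemma for the numbers of homomorphisms. -/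
theorem card_linearMap_schanuel {F F' T G : Type*} [AddCommGroup F] [Module B F]
    [AddCommGroup F'] [Module B F'] [AddCommGroup T] [Module B T] [AddCommGroup G] [Module B G]
    [Module.Projective B F] [Module.Projective B F'] (π : F →ₗ[B] T) (π' : F' →ₗ[B] T)
    (hπ : Function.Surjective π) (hπ' : Function.Surjective π') :
    Nat.card (F →ₗ[B] G) * Nat.card (LinearMap.ker π' →ₗ[B] G) =
      Nat.card (F' →ₗ[B] G) * Nat.card (LinearMap.ker π →ₗ[B] G) := by
  -- The fibre product over T projects onto F with kernel ker π' and onto F' with kernel ker π. Both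
  -- extensions split, so Hom(P, G) is counted in two ways.
  let P : Submodule B (F × F') :=
    LinearMap.ker (π ∘ₗ LinearMap.fst B F F' - π' ∘ₗ LinearMap.snd B F F')
  have hP : ∀ {x y}, (x, y) ∈ P ↔ π x = π' y := fun {x y} => by
    rw [LinearMap.mem_ker, LinearMap.sub_apply, sub_eq_zero]; rfl
  let j₁ : LinearMap.ker π' →ₗ[B] P := (LinearMap.inr B F F' ∘ₗ (LinearMap.ker π').subtype).codRestrict
    P (fun y => hP.mpr ((map_zero π).trans y.2.symm))
  let j₂ : LinearMap.ker π →ₗ[B] P := (LinearMap.inl B F F' ∘ₗ (LinearMap.ker π).subtype).codRestrict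
    P (fun y => hP.mpr (y.2.trans (map_zero π').symm))
  have h₁ := card_linearMap_of_surjective (P := P) (G := G) (LinearMap.fst B F F' ∘ₗ P.subtype)
    (fun x => by
      obtain ⟨y, hy⟩ := hπ' (π x)
      exact ⟨⟨(x, y), hP.mpr hy.symm⟩, rfl⟩) j₁
    (fun a b h => Subtype.ext (congrArg (fun z : P => z.1.2) h)) (by
      ext z
      obtain ⟨⟨x, y⟩, h⟩ := z
      constructor
      · rintro ⟨z, hz⟩
        exact (congrArg (fun z : P => z.1.1) hz).symm
      · intro (hx : x = 0)
        subst hx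
        exact ⟨⟨y, by rw [LinearMap.mem_ker, ← hP.mp h, map_zero]⟩, rfl⟩)
  have h₂ := card_linearMap_of_surjective (P := P) (G := G) (LinearMap.snd B F F' ∘ₗ P.subtype)
    (fun x => by
      obtain ⟨y, hy⟩ := hπ (π' x)
      exact ⟨⟨(y, x), hP.mpr hy⟩, rfl⟩) j₂
    (fun a b h => Subtype.ext (congrArg (fun z : P => z.1.1) h)) (by
      ext z
      obtain ⟨⟨x, y⟩, h⟩ := z
      constructor
      · rintro ⟨z, hz⟩
        exact (congrArg (fun z : P => z.1.2) hz).symm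
      · intro (hy : y = 0)
        subst hy
        exact ⟨⟨x, by rw [LinearMap.mem_ker, hP.mp h, map_zero]⟩, rfl⟩)
  rw [← h₁, ← h₂]

/-- The homomorphisms from a projective module to an extension. -/
theorem card_linearMap_of_submodule {F G : Type*} [AddCommGroup F] [Module B F]
    [Module.Projective B F] [AddCommGroup G] [Module B G] (N : Submodule B G) :
    Nat.card (F →ₗ[B] G) = Nat.card (F →ₗ[B] N) * Nat.card (F →ₗ[B] G ⧸ N) := by
  have h : ∀ q : F →ₗ[B] G ⧸ N, ∃ h : F →ₗ[B] G, N.mkQ ∘ₗ h = q := fun q =>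
    Module.projective_lifting_property _ q N.mkQ_surjective
  choose s hs using h
  have hmem : ∀ (h : F →ₗ[B] G) x, h x - s (N.mkQ ∘ₗ h) x ∈ N := fun h x => by
    rw [← Submodule.Quotient.eq]
    exact (LinearMap.congr_fun (hs (N.mkQ ∘ₗ h)) x).symm
  rw [← Nat.card_prod]
  refine Nat.card_congr
    { toFun := fun h => ((h - s (N.mkQ ∘ₗ h)).codRestrict N (hmem h), N.mkQ ∘ₗ h)
      invFun := fun p => N.subtype ∘ₗ p.1 + s p.2
      left_inv := fun h => LinearMap.ext fun x => sub_add_cancel _ _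
      right_inv := fun p => ?_ }
  have h2 : N.mkQ ∘ₗ (N.subtype ∘ₗ p.1 + s p.2) = p.2 := by
    rw [LinearMap.comp_add, hs, add_eq_right]
    exact LinearMap.ext fun x => (Submodule.Quotient.mk_eq_zero N).mpr (p.1 x).2
  refine Prod.ext (LinearMap.ext fun x => Subtype.ext ?_) h2
  change (p.1 x : G) + s p.2 x - s (N.mkQ ∘ₗ (N.subtype ∘ₗ p.1 + s p.2)) x = p.1 x
  rw [h2, add_sub_cancel_right]

/-- A simple module killed by the annihilator of a finite simple module is isomorphic to it. -/
theorem nonempty_linearEquiv_of_annihilator_le {G T : Type*} [AddCommGroup G] [Module B G] [Finite G]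
    [IsSimpleModule B G] [AddCommGroup T] [Module B T] [IsSimpleModule B T]
    (h : Module.annihilator B G ≤ Module.annihilator B T) : Nonempty (T ≃ₗ[B] G) := by
  let f : B →ₗ[B] (G → G) :=
    { toFun := fun b x => b • x
      map_add' := fun a b => funext fun x => add_smul a b x
      map_smul' := fun a b => funext fun x => mul_smul a b x }
  have hss : IsSemisimpleModule B (B ⧸ LinearMap.ker f) :=
    IsSemisimpleModule.congr f.quotKerEquivRange
  have := IsSimpleModule.nontrivial B T
  obtain ⟨t, ht⟩ := exists_ne (0 : T)
  have hle : LinearMap.ker f ≤ LinearMap.ker (LinearMap.toSpanSingleton B T t) := fun b hb =>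
    Module.mem_annihilator.mp (h (Module.mem_annihilator.mpr fun m => congrFun hb m)) t
  have hsurj : Function.Surjective ((LinearMap.ker f).liftQ _ hle) := by
    rw [← LinearMap.range_eq_top, Submodule.range_liftQ]
    exact LinearMap.range_eq_top.mpr (IsSimpleModule.toSpanSingleton_surjective B ht)
  obtain ⟨s, hs⟩ := IsSemisimpleModule.lifting_property _ hsurj LinearMap.id
  -- The simple module T splits off from the semisimple quotient of `B`, so it embeds in a power of
  -- G; by Schur a coordinate that does not vanish on t is an isomorphism.
  let k : T →ₗ[B] (G → G) := (LinearMap.range f).subtype ∘ₗ f.quotKerEquivRange.toLinearMap ∘ₗ s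
  have hk : Function.Injective k :=
    (Subtype.val_injective.comp f.quotKerEquivRange.injective).comp
      (Function.LeftInverse.injective fun x => LinearMap.congr_fun hs x)
  have hkt : k t ≠ 0 := fun h0 => ht (hk (h0.trans (map_zero k).symm))
  obtain ⟨g, hg⟩ := Function.ne_iff.mp hkt
  exact ⟨LinearEquiv.ofBijective (LinearMap.proj g ∘ₗ k)
    ((LinearMap.bijective_or_eq_zero _).resolve_right fun h0 => hg (LinearMap.congr_fun h0 t))⟩

/-- The part of the ring `B` at which all modules are killed by the ideal `E` is hereditary, and the
maximal ideals there commute. -/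
structure IsHereditaryAt (E : Ideal B) : Prop where
  projective : ∀ (F : Type u) [AddCommGroup F] [Module B F] [Module.Projective B F]
    (F₁ : Submodule B F) [Finite (F ⧸ F₁)], E ≤ Module.annihilator B (F ⧸ F₁) →
    Module.Projective B F₁
  inf_le : ∀ (G T : Type u) [AddCommGroup G] [Module B G] [Finite G] [AddCommGroup T] [Module B T]
    [IsSimpleModule B T], E ≤ Module.annihilator B G →
    ¬ Module.annihilator B G ≤ Module.annihilator B T →
    Module.annihilator B G ⊓ Module.annihilator B T ≤
      Module.annihilator B G * Module.annihilator B T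
  exists_regular : ∀ n : ℕ, n ≠ 0 → ∃ z ∈ E ⊔ Ideal.span {(n : B)}, (∀ x, x * z = 0 → x = 0) ∧
    Finite (B ⧸ Ideal.span {z}) ∧ E ≤ Module.annihilator B (B ⧸ Ideal.span {z})

theorem isSemisimpleModule_prod (M N : Type*) [AddCommGroup M] [Module B M] [IsSemisimpleModule B M]
    [AddCommGroup N] [Module B N] [IsSemisimpleModule B N] : IsSemisimpleModule B (M × N) := by
  have h := IsSemisimpleModule.sup (p := LinearMap.range (LinearMap.inl B M N))
    (q := LinearMap.range (LinearMap.inr B M N)) (IsSemisimpleModule.range _)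
    (IsSemisimpleModule.range _)
  rw [LinearMap.sup_range_inl_inr] at h
  exact IsSemisimpleModule.congr Submodule.topEquiv.symm

variable {E : Ideal B} {G : Type u} [AddCommGroup G] [Module B G] [Finite G] [IsSimpleModule B G]

/-- Restriction to F₁ is bijective. It is injective by Schur's lemma. For h : F₁ → G with kernel K,
the module F/K is killed by the product of the annihilators of G and F/F₁, which contains their
intersection because the two simple modules are not isomorphic. Hence F/K is semisimple and h
extends. -/
theorem IsHereditaryAt.card_linearMap_of_not_iso (hE : IsHereditaryAt E)
    (hG : E ≤ Module.annihilator B G) {F : Type u} [AddCommGroup F] [Module B F]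
    (F₁ : Submodule B F) [Finite (F ⧸ F₁)] [IsSimpleModule B (F ⧸ F₁)]
    (hT : ¬ Nonempty ((F ⧸ F₁) ≃ₗ[B] G)) :
    Nat.card (F →ₗ[B] G) = Nat.card (F₁ →ₗ[B] G) := by
  refine Nat.card_eq_of_bijective (fun h => h ∘ₗ F₁.subtype) ⟨fun h h' hh => ?_, fun h => ?_⟩
  · rw [← sub_eq_zero]
    have hle : F₁ ≤ LinearMap.ker (h - h') := fun x hx => by
      rw [LinearMap.mem_ker, LinearMap.sub_apply, sub_eq_zero]
      exact LinearMap.congr_fun hh ⟨x, hx⟩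
    rcases LinearMap.bijective_or_eq_zero (F₁.liftQ _ hle) with hb | h0
    · exact absurd ⟨LinearEquiv.ofBijective _ hb⟩ hT
    · rw [← F₁.liftQ_mkQ _ hle, h0, LinearMap.zero_comp]
  · let K : Submodule B F := (LinearMap.ker h).map F₁.subtype
    have hK : ∀ x : F₁, (x : F) ∈ K ↔ h x = 0 := fun x => by
      constructor
      · rintro ⟨y, hy, hyx⟩
        rw [← Subtype.ext hyx]; exact hy
      · exact fun hx => ⟨x, hx, rfl⟩
    have hann : Module.annihilator B G * Module.annihilator B (F ⧸ F₁) ≤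
        Module.annihilator B (F ⧸ K) := by
      refine Ideal.mul_le.mpr fun a ha b hb => ?_
      rw [Module.mem_annihilator]
      intro m
      obtain ⟨m, rfl⟩ := Submodule.Quotient.mk_surjective _ m
      rw [← Submodule.Quotient.mk_smul, Submodule.Quotient.mk_eq_zero, mul_smul]
      have hbm : b • m ∈ F₁ := by
        rw [← Submodule.Quotient.mk_eq_zero, Submodule.Quotient.mk_smul]
        exact Module.mem_annihilator.mp hb _
      refine (hK (a • ⟨b • m, hbm⟩)).mpr ?_
      rw [map_smul]
      exact Module.mem_annihilator.mp ha _
    have hss : IsSemisimpleModule B (F ⧸ K) := by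
      have := isSemisimpleModule_prod (B := B) G (F ⧸ F₁)
      refine isSemisimpleModule_of_annihilator_le (G × (F ⧸ F₁)) ?_
      have hle : Module.annihilator B (G × (F ⧸ F₁)) ≤
          Module.annihilator B G ⊓ Module.annihilator B (F ⧸ F₁) := fun b hb =>
        ⟨Module.mem_annihilator.mpr fun g =>
          congrArg Prod.fst (Module.mem_annihilator.mp hb (g, 0)),
          Module.mem_annihilator.mpr fun g =>
          congrArg Prod.snd (Module.mem_annihilator.mp hb (0, g))⟩
      exact hle.trans <| (hE.inf_le G (F ⧸ F₁) hG fun hle => hT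
        (nonempty_linearEquiv_of_annihilator_le hle)).trans hann
    let i : (F₁ ⧸ LinearMap.ker h) →ₗ[B] F ⧸ K :=
      Submodule.mapQ _ K F₁.subtype (fun x hx => ⟨x, hx, rfl⟩)
    have hi : Function.Injective i := by
      rw [← LinearMap.ker_eq_bot]
      refine (Submodule.ker_mapQ _ _ _ _).trans ?_
      rw [eq_bot_iff]
      rintro _ ⟨x, hx, rfl⟩
      rw [Submodule.mem_bot, Submodule.mkQ_apply, Submodule.Quotient.mk_eq_zero]
      exact (hK x).mp hx
    obtain ⟨h', hh'⟩ := IsSemisimpleModule.extension_property i hi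
      ((LinearMap.ker h).liftQ h le_rfl)
    exact ⟨h' ∘ₗ K.mkQ, LinearMap.ext fun x =>
      LinearMap.congr_fun hh' (Submodule.Quotient.mk x)⟩

end HomCount

/-! ### Commensurable projective modules have equal Hom counts -/

section HomCountCommensurable

variable {B : Type u} [Ring B] [IsNoetherianRing B] {E : Ideal B}

/-- In descending from F to F₁ through maximal submodules, a simple quotient isomorphic to G changes
the count by the fixed factor |Hom(B, G)| / |Hom(ker π, G)|, by Schanuel's lemma, and any other
quotient leaves it unchanged. The exponent m is the multiplicity of G in F/F₁; the last clause
records that m cannot be 0 if F/F₁ maps nontrivially to G. -/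
theorem IsHereditaryAt.exists_card_linearMap_mul_pow (hE : IsHereditaryAt E)
    {G : Type u} [AddCommGroup G] [Module B G] [Finite G] [IsSimpleModule B G]
    (hG : E ≤ Module.annihilator B G) (π : B →ₗ[B] G) (hπ : Function.Surjective π) (n : ℕ) :
    ∀ (F : Type u) [AddCommGroup F] [Module B F] [Module.Projective B F] [Module.Finite B F]
      (F₁ : Submodule B F) [Finite (F ⧸ F₁)], E ≤ Module.annihilator B (F ⧸ F₁) →
      Nat.card (F ⧸ F₁) = n →
      ∃ m : ℕ, Nat.card (F →ₗ[B] G) * Nat.card (LinearMap.ker π →ₗ[B] G) ^ m =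
        Nat.card (F₁ →ₗ[B] G) * Nat.card (B →ₗ[B] G) ^ m ∧
        (m = 0 → ∀ φ : F →ₗ[B] G, F₁ ≤ LinearMap.ker φ → φ = 0) := by
  induction n using Nat.strong_induction_on with
  | _ n IH =>
  intro F _ _ _ _ F₁ _ hEF hn
  by_cases htop : F₁ = ⊤
  · subst htop
    refine ⟨0, ?_, fun _ φ h => ?_⟩
    · rw [card_linearMap_congr G (Submodule.topEquiv (R := B) (M := F)), pow_zero, pow_zero]
    · exact LinearMap.ker_eq_top.mp (top_le_iff.mp h)
  obtain ⟨M, hM, hMs⟩ := exists_isCoatom_of_finite_quotient F₁ htop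
  have : Finite (F ⧸ M) := Finite.of_surjective (Submodule.factor hM) (Submodule.factor_surjective hM)
  have hEM : E ≤ Module.annihilator B (F ⧸ M) := hEF.trans
    ((Submodule.factor hM).annihilator_le_of_surjective (Submodule.factor_surjective hM))
  have := hE.projective F M hEM
  let q : (M ⧸ F₁.comap M.subtype) →ₗ[B] (F ⧸ F₁) := Submodule.mapQ _ _ M.subtype le_rfl
  have hq : Function.Injective q := by
    rw [← LinearMap.ker_eq_bot]
    refine (Submodule.ker_mapQ _ _ _ _).trans ?_
    exact Submodule.mkQ_map_self _
  have hfin : Finite (M ⧸ F₁.comap M.subtype) := Finite.of_injective q hq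
  have hlt : Nat.card (M ⧸ F₁.comap M.subtype) < n := by
    rw [← hn]
    refine (Nat.card_le_card_of_injective q hq).lt_of_ne fun heq => ?_
    have hsurj := ((Nat.bijective_iff_injective_and_card q).mpr ⟨hq, heq⟩).2
    refine (isSimpleModule_iff_isCoatom.mp hMs).1 (eq_top_iff.mpr fun x _ => ?_)
    obtain ⟨y, hy⟩ := hsurj (Submodule.Quotient.mk x)
    obtain ⟨y, rfl⟩ := Submodule.Quotient.mk_surjective _ y
    have h1 : (y : F) - x ∈ F₁ := (Submodule.Quotient.eq _).mp hy
    have h2 := M.sub_mem y.2 (hM h1)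
    rwa [sub_sub_cancel] at h2
  obtain ⟨m, hm, hm0⟩ := IH _ hlt M (F₁.comap M.subtype)
    (hEF.trans (q.annihilator_le_of_injective hq)) rfl
  rw [card_linearMap_congr G (Submodule.comapSubtypeEquivOfLe hM)] at hm
  by_cases hiso : Nonempty ((F ⧸ M) ≃ₗ[B] G)
  · obtain ⟨ψ⟩ := hiso
    have hk : LinearMap.ker (ψ.toLinearMap ∘ₗ M.mkQ) = M := by
      rw [LinearEquiv.ker_comp, Submodule.ker_mkQ]
    have h1 := card_linearMap_schanuel (G := G) (ψ.toLinearMap ∘ₗ M.mkQ) π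
      (ψ.surjective.comp M.mkQ_surjective) hπ
    rw [card_linearMap_congr G (LinearEquiv.ofEq _ _ hk)] at h1
    refine ⟨m + 1, ?_, fun h => absurd h (Nat.succ_ne_zero m)⟩
    calc _ = Nat.card (F →ₗ[B] G) * Nat.card (LinearMap.ker π →ₗ[B] G) *
          Nat.card (LinearMap.ker π →ₗ[B] G) ^ m := by ring
      _ = Nat.card (B →ₗ[B] G) * (Nat.card (M →ₗ[B] G) *
          Nat.card (LinearMap.ker π →ₗ[B] G) ^ m) := by rw [h1]; ring
      _ = _ := by rw [hm]; ring
  · refine ⟨m, by rw [hE.card_linearMap_of_not_iso hG M hiso, hm], fun h φ hφ => ?_⟩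
    have h1 : φ ∘ₗ M.subtype = 0 := hm0 h _ fun x hx => hφ hx
    have hle : M ≤ LinearMap.ker φ := fun x hx => LinearMap.congr_fun h1 ⟨x, hx⟩
    rcases LinearMap.bijective_or_eq_zero (M.liftQ φ hle) with hb | h0
    · exact absurd ⟨LinearEquiv.ofBijective _ hb⟩ hiso
    · rw [← M.liftQ_mkQ _ hle, h0, LinearMap.zero_comp]

/-- The factor |Hom(B, G)| / |Hom(ker π, G)| equals 1: compare B with the isomorphic module Bz for a
regular z annihilating G. The two counts agree, while the exponent is nonzero because π is a nonzero
map vanishing on Bz. -/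
theorem IsHereditaryAt.card_linearMap_of_isSimpleModule (hE : IsHereditaryAt E)
    {G : Type u} [AddCommGroup G] [Module B G] [Finite G] [IsSimpleModule B G]
    (hG : E ≤ Module.annihilator B G) {F : Type u} [AddCommGroup F] [Module B F]
    [Module.Projective B F] [Module.Finite B F] (F₁ : Submodule B F) [Finite (F ⧸ F₁)]
    (hF : E ≤ Module.annihilator B (F ⧸ F₁)) :
    Nat.card (F →ₗ[B] G) = Nat.card (F₁ →ₗ[B] G) := by
  have := IsSimpleModule.nontrivial B G
  obtain ⟨g, hg⟩ := exists_ne (0 : G)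
  have hπ := IsSimpleModule.toSpanSingleton_surjective B hg
  set π := LinearMap.toSpanSingleton B G g
  obtain ⟨z, hz, hreg, hfin, hEz⟩ := hE.exists_regular (Nat.card G) Nat.card_pos.ne'
  obtain ⟨m, hm, hm0⟩ := hE.exists_card_linearMap_mul_pow hG π hπ _ B (Ideal.span {z}) hEz rfl
  have hinj : Function.Injective (LinearMap.toSpanSingleton B B z) :=
    (injective_iff_map_eq_zero _).mpr hreg
  have hrange : LinearMap.range (LinearMap.toSpanSingleton B B z) = Ideal.span {z} :=
    LinearMap.range_toSpanSingleton z
  rw [← card_linearMap_congr G ((LinearEquiv.ofInjective _ hinj).trans (LinearEquiv.ofEq _ _ hrange))]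
    at hm
  have hzG : z ∈ Module.annihilator B G := by
    refine (sup_le hG ?_) hz
    rw [Ideal.span_le, Set.singleton_subset_iff]
    exact natCard_mem_annihilator B G
  have hm' : m ≠ 0 := fun h0 => by
    have hπ0 := hm0 h0 π (by
      rw [Ideal.span_le, Set.singleton_subset_iff]
      exact Module.mem_annihilator.mp hzG g)
    apply hg
    rw [← one_smul B g]
    exact LinearMap.congr_fun hπ0 1
  have hκ : Nat.card (LinearMap.ker π →ₗ[B] G) = Nat.card (B →ₗ[B] G) :=
    Nat.pow_left_injective hm' (Nat.eq_of_mul_eq_mul_left (card_linearMap_pos B G) hm)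
  obtain ⟨k, hk, -⟩ := hE.exists_card_linearMap_mul_pow hG π hπ _ F F₁ hF rfl
  rw [hκ] at hk
  exact Nat.eq_of_mul_eq_mul_right (pow_pos (card_linearMap_pos B G) k) hk

/-- Projective modules that differ by a finite module at which `B` is hereditary have the same
number of homomorphisms to a finite module. -/
theorem IsHereditaryAt.card_linearMap (hE : IsHereditaryAt E)
    {F : Type u} [AddCommGroup F] [Module B F]
    [Module.Projective B F] [Module.Finite B F] (F₁ : Submodule B F) [Finite (F ⧸ F₁)]
    (hF : E ≤ Module.annihilator B (F ⧸ F₁)) (n : ℕ) :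
    ∀ (G : Type u) [AddCommGroup G] [Module B G] [Finite G], E ≤ Module.annihilator B G →
      Nat.card G = n → Nat.card (F →ₗ[B] G) = Nat.card (F₁ →ₗ[B] G) := by
  induction n using Nat.strong_induction_on with
  | _ n IH =>
  intro G _ _ _ hG hn
  have := hE.projective F F₁ hF
  rcases subsingleton_or_nontrivial G with hs | hnt
  · rw [Nat.card_of_subsingleton (0 : F →ₗ[B] G), Nat.card_of_subsingleton (0 : F₁ →ₗ[B] G)]
  have hbt : (⊥ : Submodule B G) ≠ ⊤ := bot_ne_top
  have : Finite (G ⧸ (⊥ : Submodule B G)) := Finite.of_surjective _ (Submodule.mkQ_surjective _)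
  obtain ⟨N, -, hN⟩ := exists_isCoatom_of_finite_quotient (⊥ : Submodule B G) hbt
  have : Finite (G ⧸ N) := Finite.of_surjective _ (Submodule.mkQ_surjective _)
  have hlt : Nat.card N < n := by
    rw [← hn]
    refine (Nat.card_le_card_of_injective N.subtype Subtype.val_injective).lt_of_ne fun heq => ?_
    have hsurj := ((Nat.bijective_iff_injective_and_card N.subtype).mpr
      ⟨Subtype.val_injective, heq⟩).2
    refine (isSimpleModule_iff_isCoatom.mp hN).1 (eq_top_iff.mpr fun x _ => ?_)
    obtain ⟨y, rfl⟩ := hsurj x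
    exact y.2
  -- For projective modules the count is multiplicative along 0 → N → G → G/N → 0; N is smaller and
  -- G/N is simple.
  rw [card_linearMap_of_submodule N, card_linearMap_of_submodule (F := F₁) N,
    IH _ hlt N (hG.trans (N.subtype.annihilator_le_of_injective Subtype.val_injective)) rfl,
    hE.card_linearMap_of_isSimpleModule
      (hG.trans (N.mkQ.annihilator_le_of_surjective N.mkQ_surjective)) F₁ hF]

/-- Projective modules that are commensurable through maps `f`, `f'` have the same number of
homomorphisms to a finite module. -/
theorem IsHereditaryAt.card_linearMap_of_comp_eq_natCast (hE : IsHereditaryAt E)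
    {F F' : Type u} [AddCommGroup F] [Module B F] [AddCommGroup F'] [Module B F']
    [Module.Projective B F'] [Module.Finite B F'] (f : F →ₗ[B] F')
    (f' : F' →ₗ[B] F) {N : ℕ} (hN : ∀ x, f' (f x) = N • x) (hN' : ∀ x, f (f' x) = N • x)
    (hF : ∀ x : F, N • x = 0 → x = 0) (hEF : ∀ x : F', ∀ b ∈ E, b • x = 0)
    (hfin : Finite (B ⧸ Ideal.span {(N : B)})) {G : Type u} [AddCommGroup G] [Module B G] [Finite G]
    (hG : E ≤ Module.annihilator B G) :
    Nat.card (F →ₗ[B] G) = Nat.card (F' →ₗ[B] G) := by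
  have hinj : Function.Injective f := (injective_iff_map_eq_zero f).mpr fun x hx =>
    hF x (by rw [← hN, hx, map_zero])
  have hfinq : Finite (F' ⧸ LinearMap.range f) := by
    obtain ⟨n, s, hs⟩ := Module.Finite.exists_fin (R := B) (M := F')
    refine Finite.of_surjective (fun (c : Fin n → B ⧸ Ideal.span {(N : B)}) =>
      (LinearMap.range f).mkQ (∑ i, Quotient.out (c i) • s i)) fun y => ?_
    obtain ⟨y, rfl⟩ := Submodule.mkQ_surjective _ y
    have hy : y ∈ Submodule.span B (Set.range s) := by rw [hs]; trivial
    obtain ⟨b, rfl⟩ := (Submodule.mem_span_range_iff_exists_fun B).mp hy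
    refine ⟨fun i => Submodule.Quotient.mk (b i), ?_⟩
    refine (Submodule.Quotient.eq _).mpr ?_
    rw [← Finset.sum_sub_distrib]
    refine Submodule.sum_mem _ fun i _ => ?_
    rw [← sub_smul]
    have h1 : Quotient.out (Submodule.Quotient.mk (p := Ideal.span {(N : B)}) (b i)) - b i ∈
        Ideal.span {(N : B)} := (Submodule.Quotient.eq _).mp (Quotient.out_eq _)
    obtain ⟨a, ha⟩ := Ideal.mem_span_singleton'.mp h1
    rw [← ha, mul_smul, Nat.cast_smul_eq_nsmul, ← hN', ← map_smul]
    exact ⟨_, rfl⟩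
  rw [card_linearMap_congr G (LinearEquiv.ofInjective f hinj)]
  refine (hE.card_linearMap (LinearMap.range f) (fun b hb => ?_) _ G hG rfl).symm
  rw [Module.mem_annihilator]
  intro m
  obtain ⟨m, rfl⟩ := Submodule.Quotient.mk_surjective _ m
  rw [← Submodule.Quotient.mk_smul, hEF m b hb, Submodule.Quotient.mk_zero]

end HomCountCommensurable

/-! ### The left ideals Bz of idempotents z -/

section LeftFix

variable {B : Type*} [Ring B]

/-- The left ideal `Bz` of an idempotent `z`. -/
def leftFix (z : B) : Submodule B B where
  carrier := {y | y * z = y}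
  zero_mem' := zero_mul z
  add_mem' {a b} ha hb := by
    change (a + b) * z = a + b
    rw [add_mul, ha, hb]
  smul_mem' b y hy := by
    change b * y * z = b * y
    rw [mul_assoc, hy]

theorem mem_leftFix {z y : B} : y ∈ leftFix z ↔ y * z = y := Iff.rfl

/-- The projection `B → Bz`. -/
def toLeftFix {z : B} (hz : z * z = z) : B →ₗ[B] leftFix z :=
  (LinearMap.toSpanSingleton B B z).codRestrict _ fun y => by
    change y * z * z = y * z
    rw [mul_assoc, hz]

theorem toLeftFix_coe {z : B} (hz : z * z = z) (y : leftFix z) : toLeftFix hz y = y :=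
  Subtype.ext y.2

theorem projective_leftFix {z : B} (hz : z * z = z) : Module.Projective B (leftFix z) :=
  Module.Projective.of_split (leftFix z).subtype (toLeftFix hz)
    (LinearMap.ext fun y => toLeftFix_coe hz y)

theorem finite_leftFix {z : B} (hz : z * z = z) : Module.Finite B (leftFix z) :=
  Module.Finite.of_surjective (toLeftFix hz) fun y => ⟨y, toLeftFix_coe hz y⟩

variable {G : Type*} [AddCommGroup G] [Module B G] (𝕜 : Type*) [Semiring 𝕜] [Module 𝕜 G]
  [SMulCommClass B 𝕜 G]

/-- The part `zG` of a module, for an idempotent `z`. -/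
def fixedBy (z : B) (G : Type*) [AddCommGroup G] [Module B G] [Module 𝕜 G]
    [SMulCommClass B 𝕜 G] : Submodule 𝕜 G where
  carrier := {g | z • g = g}
  zero_mem' := smul_zero z
  add_mem' {a b} ha hb := by
    change z • (a + b) = a + b
    rw [smul_add, ha, hb]
  smul_mem' c g hg := by
    change z • c • g = c • g
    rw [smul_comm, hg]

/-- A homomorphism from `Bz` to `G` is determined by the image of `z`. -/
def leftFixHomEquiv {z : B} (hz : z * z = z) : (leftFix z →ₗ[B] G) ≃ₗ[𝕜] fixedBy 𝕜 z G where
  toFun h := ⟨h ⟨z, hz⟩, by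
    change z • h ⟨z, hz⟩ = h ⟨z, hz⟩
    rw [← map_smul]
    exact congrArg h (Subtype.ext hz)⟩
  map_add' h h' := rfl
  map_smul' c h := rfl
  invFun g := (LinearMap.toSpanSingleton B G g.1) ∘ₗ (leftFix z).subtype
  left_inv h := LinearMap.ext fun y => by
    change (y : B) • h ⟨z, hz⟩ = h y
    rw [← map_smul]
    exact congrArg h (Subtype.ext y.2)
  right_inv g := Subtype.ext g.2

/-- An isomorphism `(Bz)^a ≅ (Bz')^b` induces an isomorphism `(zG)^a ≅ (z'G)^b`. -/
theorem nonempty_fixedBy_equiv {z z' : B} (hz : z * z = z) (hz' : z' * z' = z') {a b : ℕ}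
    (θ : (Fin a → leftFix z) ≃ₗ[B] (Fin b → leftFix z')) :
    Nonempty ((Fin a → fixedBy 𝕜 z G) ≃ₗ[𝕜] (Fin b → fixedBy 𝕜 z' G)) :=
  ⟨(LinearEquiv.piCongrRight fun _ => (leftFixHomEquiv 𝕜 hz).symm) ≪≫ₗ
    LinearMap.lsum B (fun _ : Fin a => leftFix z) 𝕜 ≪≫ₗ LinearEquiv.congrLeft G 𝕜 θ ≪≫ₗ
    (LinearMap.lsum B (fun _ : Fin b => leftFix z') 𝕜).symm ≪≫ₗ
    LinearEquiv.piCongrRight fun _ => leftFixHomEquiv 𝕜 hz'⟩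

theorem card_linearMap_leftFix {z : B} (hz : z * z = z) (a : ℕ) :
    Nat.card ((Fin a → leftFix z) →ₗ[B] G) = Nat.card {g : G // z • g = g} ^ a := by
  rw [Nat.card_congr (LinearMap.lsum B (fun _ : Fin a => leftFix z) ℕ).symm.toEquiv, Nat.card_fun,
    Nat.card_fin, Nat.card_congr (leftFixHomEquiv (G := G) ℕ hz).toEquiv]
  rfl

theorem smul_eq_zero_of_mem_leftFix {z ε : B} (hc : ∀ x, ε * x = x * ε) (hz : ε * z = z) {b : B}
    (hb : b ∈ Ideal.span {1 - ε}) (y : leftFix z) : b • y = 0 := by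
  obtain ⟨a, rfl⟩ := Ideal.mem_span_singleton'.mp hb
  refine Subtype.ext ?_
  change a * (1 - ε) * y = 0
  rw [← y.2, mul_assoc, sub_mul, one_mul, ← mul_assoc ε, hc, mul_assoc _ ε, hz, sub_self, mul_zero]

/-- Take z to be n on the ε-part and 1 on the complement, and w the other way round. Then zw = wz =
n, which makes z regular with Bz of finite index, while (1 - ε)z = 1 - ε shows that 1 - ε kills
B/Bz. -/
theorem exists_regular_of_isIdempotent {ε : B} (hε : ε * ε = ε) (hc : ∀ x, ε * x = x * ε)
    (htf : ∀ n : ℕ, n ≠ 0 → ∀ x : B, x * n = 0 → x = 0)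
    (hfin : ∀ n : ℕ, n ≠ 0 → ∀ I : Ideal B, (n : B) ∈ I → Finite (B ⧸ I)) (n : ℕ) (hn : n ≠ 0) :
    ∃ z ∈ Ideal.span {1 - ε} ⊔ Ideal.span {(n : B)}, (∀ x, x * z = 0 → x = 0) ∧
      Finite (B ⧸ Ideal.span {z}) ∧
      Ideal.span {1 - ε} ≤ Module.annihilator B (B ⧸ Ideal.span {z}) := by
  have h1 : (1 - ε) * ε = 0 := by rw [sub_mul, one_mul, hε, sub_self]
  have h2 : ε * (1 - ε) = 0 := by rw [mul_sub, mul_one, hε, sub_self]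
  have h3 : (1 - ε) * (1 - ε) = 1 - ε := by rw [mul_sub, mul_one, h1, sub_zero]
  have hzw : (1 - ε + ε * n) * (ε + (1 - ε) * n) = n := by
    rw [add_mul, mul_add, mul_add, h1, ← mul_assoc, h3, mul_assoc ε, mul_assoc ε, ← mul_assoc _ (1 - ε),
      Nat.cast_comm, Nat.cast_comm, mul_assoc (1 - ε), ← mul_assoc ε, hε, ← mul_assoc ε, h2]
    rw [sub_mul]
    simp
  have hwz : (ε + (1 - ε) * n) * (1 - ε + ε * n) = n := by
    rw [add_mul, mul_add, mul_add, h2, ← mul_assoc, hε, mul_assoc (1 - ε), mul_assoc (1 - ε),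
      Nat.cast_comm, Nat.cast_comm, ← mul_assoc (1 - ε), h3, mul_assoc ε, ← mul_assoc (1 - ε), h1]
    rw [sub_mul]
    simp
  refine ⟨1 - ε + ε * n, add_mem (Ideal.mem_sup_left (Ideal.mem_span_singleton_self _))
    (Ideal.mem_sup_right (Ideal.mul_mem_left _ _ (Ideal.mem_span_singleton_self _))),
    fun x hx => htf n hn x ?_, hfin n hn _ ?_, ?_⟩
  · rw [← hzw, ← mul_assoc, hx, zero_mul]
  · exact Ideal.mem_span_singleton'.mpr ⟨_, hwz⟩
  · rw [Ideal.span_le, Set.singleton_subset_iff]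
    refine Module.mem_annihilator.mpr fun m => ?_
    obtain ⟨m, rfl⟩ := Submodule.Quotient.mk_surjective _ m
    rw [← Submodule.Quotient.mk_smul, Submodule.Quotient.mk_eq_zero]
    refine Ideal.mem_span_singleton'.mpr ⟨m * (1 - ε), ?_⟩
    rw [mul_assoc, mul_add, h3, ← mul_assoc, h1, zero_mul, add_zero, smul_eq_mul, mul_sub, sub_mul,
      one_mul, mul_one, hc]

end LeftFix

/-! ### ℤ_S[Γ] is hereditary at e -/

section GroupRing

variable {Γ : Type u} [Group Γ] [Fintype Γ] {S : Set Nat.Primes} {e : MonoidAlgebra ℚ Γ}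

instance isNoetherianRing_intGroupRing (R : Subring ℚ) : IsNoetherianRing (intGroupRing Γ R) := by
  have : IsNoetherianRing (MonoidAlgebra R Γ) := IsNoetherianRing.of_finite R _
  exact isNoetherianRing_of_ringEquiv _ (groupRingEquiv Γ R)

theorem idemElt_mul_self (he : IsCentralIdempotent e) {R : Subring ℚ} (heR : e ∈ intGroupRing Γ R) :
    idemElt heR * idemElt heR = idemElt heR := Subtype.ext he.idem

theorem idemElt_comm (he : IsCentralIdempotent e) {R : Subring ℚ} (heR : e ∈ intGroupRing Γ R)
    (x : intGroupRing Γ R) : idemElt heR * x = x * idemElt heR := Subtype.ext (he.central x.1)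

theorem eq_zero_of_mul_natCast {R : Subring ℚ} {n : ℕ} (hn : n ≠ 0) {x : intGroupRing Γ R}
    (h : x * n = 0) : x = 0 := by
  have h1 : x.1 * (n : MonoidAlgebra ℚ Γ) = 0 := by
    have := congrArg Subtype.val h
    rwa [Subring.coe_mul, Subring.coe_natCast] at this
  rw [← Nat.cast_comm, ← nsmul_eq_mul] at h1
  exact Subtype.ext ((smul_eq_zero.mp h1).resolve_left hn)

/-- If every prime in `S` is good for `e`, then `ℤ_S[Γ]` is hereditary at `e`. -/
theorem isHereditaryAt_of_good (he : IsCentralIdempotent e) (hS : ∀ p ∈ S, IsGoodPrime p e) :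
    IsHereditaryAt (Ideal.span {1 - idemElt (mem_of_good hS)} : Ideal (intGroupRing Γ (ZS S))) where
  projective F _ _ _ F₁ _ h :=
    projective_of_finite_quotient_of_good he hS F₁ (h (Ideal.mem_span_singleton_self _))
  inf_le G T _ _ _ _ _ _ hG h :=
    inf_annihilator_le_mul he hS G T (hG (Ideal.mem_span_singleton_self _)) h
  exists_regular := exists_regular_of_isIdempotent (idemElt_mul_self he _) (idemElt_comm he _)
    (fun n hn x => eq_zero_of_mul_natCast hn) fun n hn I => finite_quotient_of_natCast_mem hn

end GroupRing

/-! ### Isotypic left ideals of semisimple rings -/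

section Isotypic

variable {A : Type*} [Ring A]

theorem leftFix_mul_le {z c : A} (hz : z * z = z) (hc : ∀ x, z * x = x * z) :
    leftFix (z * c) ≤ leftFix z := fun y hy => by
  rw [mem_leftFix] at hy ⊢
  conv_lhs => rw [← hy, mul_assoc, mul_assoc, ← hc c, ← mul_assoc z, hz]
  exact hy

/-- The left ideal of an irreducible central idempotent of a semisimple ring is isotypic. -/
theorem exists_isIsotypicOfType_leftFix [IsSemisimpleRing A] {z : A}
    (hz : IsIrreducibleCentralIdempotent z) :
    ∃ V : Submodule A (leftFix z), IsIsotypicOfType A (leftFix z) V := by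
  have hzz : z * z = z := hz.idem
  have : Nontrivial (leftFix z) := ⟨⟨⟨z, hzz⟩, 0, fun h => hz.ne_zero (congrArg Subtype.val h)⟩⟩
  obtain ⟨V, hV⟩ := IsAtomic.exists_atom (Submodule A (leftFix z))
  rw [← isSimpleModule_iff_isAtom] at hV
  refine ⟨V, ?_⟩
  -- The isotypic component of V is a two-sided ideal, hence generated by a central idempotent g,
  -- and gz is 0 or z. As V lies both in Az and in the component, gz = z, so Az is contained in the
  -- component.
  let T : Ideal A := isotypicComponent A A V
  have hT : T.IsTwoSided := isFullyInvariant_iff_isTwoSided.mp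
    (Submodule.IsFullyInvariant.isotypicComponent A A V)
  obtain ⟨g, hgT, hg, hxg⟩ := exists_centralIdempotent_of_isTwoSided T
  have hgz : g * z = z := by
    rcases hz.minimal _ (hg.mul hz.toIsCentralIdempotent) (by rw [mul_assoc, hzz]) with h0 | h1
    · exfalso
      have := IsSimpleModule.nontrivial A V
      obtain ⟨v, hv⟩ := exists_ne (0 : V)
      have hvT : (v.1 : A) ∈ T :=
        V.map_le_isotypicComponent (leftFix z).subtype ⟨v.1, v.2, rfl⟩
      apply hv
      refine Subtype.ext (Subtype.ext ?_)
      have hvz : (v.1 : A) * z = v.1 := v.1.2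
      rw [← hxg _ hvT, ← hvz, mul_assoc, ← hg.central, h0, mul_zero]
      rfl
    · exact h1
  have hle : leftFix z ≤ T := fun x hx => by
    rw [mem_leftFix] at hx
    rw [← hx, ← hgz, hg.central, ← mul_assoc]
    exact T.mul_mem_left _ hgT
  exact (IsIsotypicOfType.isotypicComponent A A V).of_injective (Submodule.inclusion hle)
    (Submodule.inclusion_injective hle)

/-- The left ideals `Azc` and `Az` are commensurable. -/
theorem exists_leftFix_equiv [IsSemisimpleRing A] {z c : A}
    (hz : IsIrreducibleCentralIdempotent z) (hc : z * c * (z * c) = z * c) (h0 : z * c ≠ 0) :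
    ∃ a b : ℕ, a ≠ 0 ∧ b ≠ 0 ∧
      Nonempty ((Fin a → leftFix (z * c)) ≃ₗ[A] (Fin b → leftFix z)) := by
  obtain ⟨V, hV⟩ := exists_isIsotypicOfType_leftFix hz
  have hle : leftFix (z * c) ≤ leftFix z := leftFix_mul_le hz.idem hz.central
  have := finite_leftFix (B := A) (z := z) hz.idem
  have := finite_leftFix hc
  obtain ⟨s, ⟨θ⟩⟩ := hV.linearEquiv_fun
  obtain ⟨t, ⟨θ'⟩⟩ := (hV.of_injective (Submodule.inclusion hle)
    (Submodule.inclusion_injective hle)).linearEquiv_fun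
  let sw : (Fin s → Fin t → V) ≃ₗ[A] (Fin t → Fin s → V) :=
    { toFun := fun f i j => f j i
      invFun := fun f i j => f j i
      map_add' := fun _ _ => rfl
      map_smul' := fun _ _ => rfl
      left_inv := fun _ => rfl
      right_inv := fun _ => rfl }
  -- Az ≅ V^s and Azc ≅ V^t, so the exponents are crossed: (Azc)^s ≅ V^(st) ≅ (Az)^t.
  refine ⟨s, t, fun hs => ?_, fun ht => ?_, ⟨(LinearEquiv.piCongrRight fun _ => θ') ≪≫ₗ sw ≪≫ₗ
    LinearEquiv.piCongrRight fun _ => θ.symm⟩⟩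
  · subst hs
    exact hz.ne_zero (congrArg Subtype.val (θ.injective (Subsingleton.elim _ _) :
      (⟨z, hz.idem⟩ : leftFix z) = 0))
  · subst ht
    exact h0 (congrArg Subtype.val (θ'.injective (Subsingleton.elim _ _) :
      (⟨z * c, hc⟩ : leftFix (z * c)) = 0))

end Isotypic

/-! ### From homomorphisms over the algebra to homomorphisms of lattices -/

section Scaling

variable {A : Type*} [Ring A] [Algebra ℚ A] {B : Subring A}

theorem exists_common_denominator (hB : ∀ x : A, ∃ n : ℕ, n ≠ 0 ∧ n • x ∈ B) {ι : Type*} [Finite ι]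
    (x : ι → A) : ∃ n : ℕ, n ≠ 0 ∧ ∀ i, n • x i ∈ B := by
  have := Fintype.ofFinite ι
  classical
  choose n hn hx using fun i => hB (x i)
  refine ⟨∏ i, n i, Finset.prod_ne_zero_iff.mpr fun i _ => hn i, fun i => ?_⟩
  rw [← Finset.prod_erase_mul _ _ (Finset.mem_univ i), mul_smul]
  exact nsmul_mem (hx i) _

/-- Homomorphisms over the algebra restrict to the lattices after multiplication with an integer. -/
theorem exists_scaled_hom (hB : ∀ x : A, ∃ n : ℕ, n ≠ 0 ∧ n • x ∈ B) {z z' : B} (hz : z * z = z)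
    {a b : ℕ} (θ : (Fin a → leftFix (z : A)) →ₗ[A] (Fin b → leftFix (z' : A))) :
    ∃ n : ℕ, n ≠ 0 ∧ ∃ f : (Fin a → leftFix z) →ₗ[B] (Fin b → leftFix z'), ∀ x l,
      ((f x l : B) : A) = n • (θ (fun k => ⟨x k, congrArg Subtype.val (x k).2⟩) l : A) := by
  have hzA : (z : A) * z = z := congrArg Subtype.val hz
  let ζ : leftFix (z : A) := ⟨z, hzA⟩
  -- θ is determined by the images of the finitely many generators `Pi.single k ζ`, so clearing the
  -- denominators of their entries makes it integral on all lattice elements.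
  obtain ⟨n, hn, hnB⟩ := exists_common_denominator hB
    (fun p : Fin a × Fin b => (θ (Pi.single p.1 ζ) p.2 : A))
  have hexp : ∀ x : Fin a → leftFix (z : A), ∀ l, (θ x l : A) =
      ∑ k, (x k : A) * (θ (Pi.single k ζ) l : A) := fun x l => by
    have hx : x = ∑ k, (x k : A) • Pi.single k ζ := by
      refine funext fun j => Subtype.ext ?_
      rw [Finset.sum_apply, Finset.sum_eq_single j]
      · rw [Pi.smul_apply, Pi.single_eq_same]
        exact (x j).2.symm
      · intro k _ hk
        rw [Pi.smul_apply, Pi.single_eq_of_ne hk.symm, smul_zero]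
      · simp
    conv_lhs => rw [hx, map_sum, Finset.sum_apply, AddSubmonoidClass.coe_finsetSum]
    refine Finset.sum_congr rfl fun k _ => ?_
    rw [map_smul]
    rfl
  have hmem : ∀ (x : Fin a → leftFix z) l,
      n • (θ (fun k => ⟨x k, congrArg Subtype.val (x k).2⟩) l : A) ∈ B := fun x l => by
    rw [hexp, Finset.smul_sum]
    refine sum_mem fun k _ => ?_
    rw [← mul_smul_comm]
    exact mul_mem (x k).1.2 (hnB (k, l))
  refine ⟨n, hn, { toFun := fun x l => ⟨⟨_, hmem x l⟩, Subtype.ext ?_⟩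
                   map_add' := fun x y => funext fun l => Subtype.ext (Subtype.ext ?_)
                   map_smul' := fun r x => funext fun l => Subtype.ext (Subtype.ext ?_) },
    fun x l => rfl⟩
  · change n • (θ _ l : A) * (z' : A) = n • (θ _ l : A)
    rw [smul_mul_assoc]
    exact congrArg _ (θ _ l).2
  · change n • (θ (fun k => ⟨(x k + y k : leftFix z), _⟩) l : A) = n • (θ _ l : A) + n • (θ _ l : A)
    rw [← smul_add, hexp, hexp, hexp, ← Finset.sum_add_distrib]
    exact congrArg _ (Finset.sum_congr rfl fun k _ => add_mul _ _ _)
  · change n • (θ (fun k => ⟨(r • x k : leftFix z), _⟩) l : A) = (r : A) * n • (θ _ l : A)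
    rw [mul_smul_comm, hexp, hexp, Finset.mul_sum]
    exact congrArg _ (Finset.sum_congr rfl fun k _ => mul_assoc _ _ _)

theorem exists_scaled_equiv (hB : ∀ x : A, ∃ n : ℕ, n ≠ 0 ∧ n • x ∈ B) {z z' : B} (hz : z * z = z)
    (hz' : z' * z' = z') {a b : ℕ}
    (θ : (Fin a → leftFix (z : A)) ≃ₗ[A] (Fin b → leftFix (z' : A))) :
    ∃ n : ℕ, n ≠ 0 ∧ ∃ (f : (Fin a → leftFix z) →ₗ[B] (Fin b → leftFix z'))
      (f' : (Fin b → leftFix z') →ₗ[B] (Fin a → leftFix z)),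
      (∀ x, f' (f x) = n • x) ∧ ∀ x, f (f' x) = n • x := by
  obtain ⟨n, hn, f, hf⟩ := exists_scaled_hom hB hz θ.toLinearMap
  obtain ⟨n', hn', f', hf'⟩ := exists_scaled_hom hB hz' θ.symm.toLinearMap
  refine ⟨n' * n, mul_ne_zero hn' hn, f, f', fun x => funext fun l => Subtype.ext (Subtype.ext ?_),
    fun x => funext fun l => Subtype.ext (Subtype.ext ?_)⟩
  · rw [hf']
    have h : (fun k => (⟨f x k, congrArg Subtype.val (f x k).2⟩ : leftFix (z' : A))) =
        n • θ (fun k => ⟨x k, congrArg Subtype.val (x k).2⟩) :=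
      funext fun k => Subtype.ext (hf x k)
    rw [h, map_nsmul, LinearEquiv.coe_coe, θ.symm_apply_apply, mul_smul]
    rfl
  · rw [hf]
    have h : (fun k => (⟨f' x k, congrArg Subtype.val (f' x k).2⟩ : leftFix (z : A))) =
        n' • θ.symm (fun k => ⟨x k, congrArg Subtype.val (x k).2⟩) :=
      funext fun k => Subtype.ext (hf' x k)
    rw [h, map_nsmul, LinearEquiv.coe_coe, θ.apply_symm_apply, mul_comm n' n, mul_smul]
    rfl

end Scaling

/-! ### Commensurable idempotents cut out parts of equal size -/

section Weights

variable {Γ : Type u} [Group Γ] [Fintype Γ] {S : Set Nat.Primes} {e : MonoidAlgebra ℚ Γ}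

/-- Commensurable left ideals cut out parts of the same size of every finite module. -/
theorem card_fixedBy_pow (he : IsCentralIdempotent e) (hS : ∀ p ∈ S, IsGoodPrime p e)
    {z z' : intGroupRing Γ (ZS S)} (hz : z * z = z) (hz' : z' * z' = z') (hez' : e * z'.1 = z'.1)
    {a b : ℕ} (θ : (Fin a → leftFix z.1) ≃ₗ[MonoidAlgebra ℚ Γ] (Fin b → leftFix z'.1))
    {G : Type u} [AddCommGroup G] [Module (intGroupRing Γ (ZS S)) G] [Finite G]
    (hG : ∀ g : G, (⟨e, mem_of_good hS⟩ : intGroupRing Γ (ZS S)) • g = g) :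
    Nat.card {g : G // z • g = g} ^ a = Nat.card {g : G // z' • g = g} ^ b := by
  obtain ⟨n, hn, f, f', h1, h2⟩ := exists_scaled_equiv (fun x => by
    obtain ⟨n, hn, h⟩ := exists_int_mul_mem (ZS S) x
    exact ⟨n, hn, by rwa [Nat.cast_smul_eq_nsmul] at h⟩) hz hz' θ
  -- Since zG = Hom(Bz, G), both sides count homomorphisms from lattices that the scaled maps make
  -- commensurable.
  rw [← card_linearMap_leftFix hz, ← card_linearMap_leftFix hz']
  classical
  have := projective_leftFix hz'
  have : Module.Projective (intGroupRing Γ (ZS S)) (Fin b → leftFix z') :=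
    Module.Projective.of_equiv ((finsuppLequivDFinsupp (ι := Fin b) (M := leftFix z')
      (intGroupRing Γ (ZS S))).symm ≪≫ₗ
      Finsupp.linearEquivFunOnFinite (intGroupRing Γ (ZS S)) (leftFix z') (Fin b))
  have := finite_leftFix hz'
  refine (isHereditaryAt_of_good he hS).card_linearMap_of_comp_eq_natCast f f' h1 h2
    (fun x hx => funext fun k => Subtype.ext ?_) (fun x b hb => funext fun k => ?_)
    (finite_quotient_of_natCast_mem hn (Ideal.mem_span_singleton_self _)) ?_
  · refine eq_zero_of_mul_natCast hn ?_
    rw [← Nat.cast_comm, ← nsmul_eq_mul]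
    exact congrArg Subtype.val (congrFun hx k)
  · exact smul_eq_zero_of_mem_leftFix (idemElt_comm he _) (Subtype.ext hez') hb _
  · rw [Ideal.span_le, Set.singleton_subset_iff]
    refine Module.mem_annihilator.mpr fun g => ?_
    rw [sub_smul, one_smul, sub_eq_zero]
    exact (hG g).symm

end Weights

/-! ### Components of G and of its fixed part -/

section ComponentCard

/-- The component of a module at a central idempotent of the order. -/
theorem card_component {A : Type u} [Ring A] (O : Subring A) (ε : O) (hε : ε * ε = ε)
    (hc : ∀ x : O, ε * x = x * ε) (M : Type*) [AddCommGroup M] [Module O M] :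
    Nat.card (component O (ε : A) M) = Nat.card {m : M // ε • m = m} := by
  let N : Submodule O M :=
    { carrier := {m | ε • m = m}
      zero_mem' := smul_zero ε
      add_mem' := fun {a b} ha hb => by
        change ε • (a + b) = a + b
        rw [smul_add, ha, hb]
      smul_mem' := fun x m hm => by
        change ε • x • m = x • m
        rw [smul_smul, hc, mul_smul, hm] }
  have h : component O (ε : A) M = N := by
    refine le_antisymm (Submodule.span_le.mpr ?_) fun m hm => Submodule.subset_span ?_
    · rintro _ ⟨x, hx, g, rfl⟩
      have hx' : ε * x = x := Subtype.ext hx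
      change ε • x • g = x • g
      rw [smul_smul, hx']
    · exact ⟨ε, congrArg Subtype.val hε, m, hm.symm⟩
  rw [h]
  rfl

variable {Γ : Type u} [Group Γ] [Fintype Γ] {Γ' : Subgroup Γ} {S : Set Nat.Primes}

theorem e_mul_component {e : MonoidAlgebra ℚ Γ} (he : IsCentralIdempotent e) (i : Components e) :
    e * i.1.1 = i.1.1 := by
  rw [he.central]
  exact i.2

/-- The number of elements of the components of `{}^{Γ'}G` and `G`. -/
theorem card_component_fixedPart_pow (hS : ∀ p ∈ S, IsGoodPrime p (augIdem Γ')) {c : intGroupRing Γ (ZS S)}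
    (hec : augIdem Γ' * c.1 = c.1) (hγ : ∀ γ ∈ Γ', MonoidAlgebra.single γ (1 : ℚ) * c.1 = c.1)
    (hcu : c.1 * unitIdem Γ' = augIdem Γ' * unitIdem Γ') (i : Components (augIdem Γ')) {a b : ℕ}
    (θ : (Fin a → leftFix (i.1.1 * c.1)) ≃ₗ[MonoidAlgebra ℚ Γ] (Fin b → leftFix i.1.1))
    (G : Type u) [AddCommGroup G] [Module (idemOrder (ZS S) (augIdem_central Γ')) G] [Finite G] :
    letI := fixedPartModule (hc := augIdem_central Γ') (mem_of_good hS) Γ' G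
    Nat.card (component (heckeOrder (ZS S) (augIdem_central Γ') Γ')
      (toCorner (unitProd_idem (augIdem_central Γ') Γ') i.1.1)
      (fixedPart (ZS S) (augIdem_central Γ') Γ' G)) ^ a =
    Nat.card (component (idemOrder (ZS S) (augIdem_central Γ'))
      (toCorner (augIdem_central Γ').idem i.1.1) G) ^ b := by
  let _ := fixedPartModule (hc := augIdem_central Γ') (mem_of_good hS) Γ' G
  have he := augIdem_central Γ'
  have heS := mem_of_good hS
  have hiS : i.1.1 ∈ intGroupRing Γ (ZS S) :=
    he.mem_of_good hS i.1.2.toIsCentralIdempotent i.2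
  have hei := e_mul_component he i
  have hic := i.1.2.central
  have hii := i.1.mul_self
  let _ : Module (intGroupRing Γ (ZS S)) G := Module.compHom G (toIdemOrder (ZS S) he)
  have hsmul : ∀ (x : intGroupRing Γ (ZS S)) (g : G), x • g = toIdemOrder (ZS S) he x • g :=
    fun x g => rfl
  let z' : intGroupRing Γ (ZS S) := ⟨i.1.1, hiS⟩
  have hz' : z' * z' = z' := Subtype.ext hii
  have hcc : c * c = c := Subtype.ext (localIdempotent_mul_self he hec hγ hcu)
  have hz'c : ∀ x, z' * x = x * z' := fun x => Subtype.ext (hic x.1)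
  have hz : z' * c * (z' * c) = z' * c := by
    rw [mul_assoc, ← mul_assoc c, ← hz'c c, mul_assoc z' c, hcc, ← mul_assoc, hz']
  -- The component of G is e_iG and that of the fixed part is e_icG, so the isomorphism θ compares
  -- their orders.
  have key := card_fixedBy_pow he hS hz hz' hei θ (G := G) fun g => by
    rw [hsmul]
    conv_rhs => rw [← one_smul (idemOrder (ZS S) he) g]
    congr 1
    exact ambient_injective he.idem
  let ε : idemOrder (ZS S) he := toIdemOrder (ZS S) he z'
  have hε : (ε : he.idem.Corner) = toCorner he.idem i.1.1 := Subtype.ext (by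
    change augIdem Γ' * i.1.1 = augIdem Γ' * i.1.1 * augIdem Γ'
    rw [hei, i.2])
  have h1 : Nat.card (component (idemOrder (ZS S) he) (toCorner he.idem i.1.1) G) =
      Nat.card {g : G // z' • g = g} := by
    rw [← hε, card_component _ ε (by rw [← map_mul, hz'])]
    · rfl
    · intro x
      refine ambient_injective ?_
      rw [ambient_mul, ambient_mul, ambient_toIdemOrder]
      change augIdem Γ' * i.1.1 * _ = _ * (augIdem Γ' * i.1.1)
      rw [hei, hic]
  have hcorner : augIdem Γ' * unitIdem Γ' * i.1.1 * (augIdem Γ' * unitIdem Γ') =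
      i.1.1 * unitIdem Γ' := by
    have h : augIdem Γ' * unitIdem Γ' * i.1.1 = i.1.1 * unitIdem Γ' := by
      rw [mul_assoc, ← hic, ← mul_assoc, hei]
    rw [h, mul_assoc, ← mul_assoc (unitIdem Γ'), ← he.central, mul_assoc (augIdem Γ'),
      unitIdem_idem, ← mul_assoc, i.2]
  obtain ⟨δ, hδ⟩ : ∃ δ : heckeOrder (ZS S) he Γ',
      (δ : (unitProd_idem he Γ').Corner) = toCorner (unitProd_idem he Γ') i.1.1 := by
    refine ⟨⟨toCorner (unitProd_idem he Γ') i.1.1, ⟨i.1.1, hiS, ?_⟩, fun γ h => ?_⟩, rfl⟩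
    · refine hcorner.trans ?_
      rw [hei]
    · change _ * (augIdem Γ' * unitIdem Γ' * i.1.1 * _) = augIdem Γ' * unitIdem Γ' * i.1.1 * _
      rw [hcorner, ← mul_assoc, ← hic, mul_assoc, single_mul_unitIdem Γ' γ h]
  have hδ' : δ.1.1 = i.1.1 * unitIdem Γ' := by
    rw [hδ]
    exact hcorner
  have hux : ∀ x : heckeOrder (ZS S) he Γ', unitIdem Γ' * x.1.1 = x.1.1 := fun x =>
    unitIdem_mul_of_invariant x.2.2
  have hxu : ∀ x : heckeOrder (ZS S) he Γ', x.1.1 * unitIdem Γ' = x.1.1 := fun x => by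
    obtain ⟨⟨y, hy, h⟩, -⟩ := x.2
    rw [h, mul_assoc, unitIdem_idem]
  have h2 : Nat.card (component (heckeOrder (ZS S) he Γ') (toCorner (unitProd_idem he Γ') i.1.1)
      (fixedPart (ZS S) he Γ' G)) = Nat.card {g : G // (z' * c) • g = g} := by
    rw [← hδ, card_component _ δ]
    · have hδε : ∀ m : fixedPart (ZS S) he Γ' G, ((δ • m : fixedPart (ZS S) he Γ' G) : G) =
          z' • (m : G) := fun m => by
        refine smul_eq_smul_of_mul_unitIdem heS ?_ m.2
        refine (heckeOrder.lift_spec δ).trans ?_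
        change δ.1.1 = augIdem Γ' * i.1.1 * _
        rw [hδ', hei]
      have hcp := isCornerPart_fixedPart (G := G) heS c.2 hec hγ hcu
      refine Nat.card_congr
        { toFun := fun m => ⟨m.1.1, ?_⟩
          invFun := fun g => ⟨⟨g.1, ?_⟩, Subtype.ext ?_⟩
          left_inv := fun _ => rfl
          right_inv := fun _ => rfl }
      · have h3 : c • (m.1.1 : G) = m.1.1 := hcp.smul_self m.1
        rw [mul_smul, h3, ← hδε, m.2]
      · have h3 : c • g.1 = g.1 := by
          have h4 : c * (z' * c) = z' * c := by rw [← mul_assoc, ← hz'c, mul_assoc, hcc]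
          conv_lhs => rw [← g.2, smul_smul, h4, g.2]
        obtain ⟨m, hm⟩ := (hcp.mem_iff g.1).mp h3
        rw [← hm]
        exact m.2
      · rw [hδε]
        change z' • g.1 = g.1
        conv_lhs => rw [← g.2, smul_smul, ← mul_assoc, hz', g.2]
    · refine Subtype.ext (Subtype.ext ?_)
      change δ.1.1 * δ.1.1 = δ.1.1
      conv_lhs => rw [hδ', mul_assoc, ← hδ', hux, hδ', ← mul_assoc, hii]
      exact hδ'.symm
    · intro x
      refine Subtype.ext (Subtype.ext ?_)
      change δ.1.1 * x.1.1 = x.1.1 * δ.1.1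
      rw [hδ', mul_assoc, hux, hic, ← mul_assoc, ← hic, mul_assoc, hxu, hic]
  rw [h1, h2, key]

end ComponentCard

/-! ### Complex characters and the idempotents e_i -/

section Characters

variable {Γ : Type u} [Group Γ] [Fintype Γ] {n : ℕ}

open scoped ComplexOrder in
-- Averaging gives the positive definite matrix M = ∑ A(k)*A(k), invariant in the sense A(g)*MA(g) =
-- M. So A(g⁻¹) is conjugate to A(g)* and has the conjugate trace.
theorem conj_character (ρ : Representation ℂ Γ (Fin n → ℂ)) (g : Γ) :
    starRingEnd ℂ (ρ.character g) = ρ.character g⁻¹ := by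
  classical
  let A : Γ → Matrix (Fin n) (Fin n) ℂ := fun g => LinearMap.toMatrix' (ρ g)
  have hA : ∀ g h, A (g * h) = A g * A h := fun g h => by
    simp only [A]
    rw [map_mul, Module.End.mul_eq_comp, LinearMap.toMatrix'_comp]
  have hA1 : A 1 = 1 := by
    simp only [A]
    rw [map_one, Module.End.one_eq_id, LinearMap.toMatrix'_id]
  have htr : ∀ g, ρ.character g = (A g).trace := fun g => by
    rw [Representation.character, LinearMap.trace_eq_matrix_trace ℂ (Pi.basisFun ℂ (Fin n)),
      LinearMap.toMatrix_eq_toMatrix']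
  let M := ∑ k, (A k).conjTranspose * A k
  have hM : M.PosDef := by
    have h1 : M = 1 + ∑ k ∈ Finset.univ.erase 1, (A k).conjTranspose * A k := by
      simp only [M]
      rw [← Finset.add_sum_erase _ _ (Finset.mem_univ (1 : Γ)), hA1]
      simp
    rw [h1]
    exact Matrix.PosDef.one.add_posSemidef
      (Matrix.posSemidef_sum _ fun k _ => Matrix.posSemidef_conjTranspose_mul_self _)
  have hinv : (A g).conjTranspose * M * A g = M := by
    simp only [M]
    rw [Finset.mul_sum, Finset.sum_mul]
    refine Fintype.sum_equiv (Equiv.mulRight g) _ _ fun k => ?_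
    rw [Equiv.coe_mulRight, hA, Matrix.conjTranspose_mul]
    simp only [mul_assoc]
  have hgg : A g * A g⁻¹ = 1 := by rw [← hA, mul_inv_cancel, hA1]
  have h2 : A g⁻¹ = M⁻¹ * ((A g).conjTranspose * M) := by
    have h3 : (A g).conjTranspose * M = M * A g⁻¹ := by
      conv_rhs => rw [← hinv, mul_assoc, hgg, mul_one]
    rw [h3, ← mul_assoc, Matrix.nonsing_inv_mul _ ((Matrix.isUnit_iff_isUnit_det _).mp hM.isUnit),
      one_mul]
  rw [htr, htr, h2, Matrix.trace_mul_comm, mul_assoc,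
    Matrix.mul_nonsing_inv _ ((Matrix.isUnit_iff_isUnit_det _).mp hM.isUnit), mul_one,
    Matrix.trace_conjTranspose]
  rfl

/-- Each coset xH fixed by g accounts for its |H| elements x, which are those with x⁻¹gx ∈ H. -/
theorem card_mul_permChar (H : Subgroup Γ) (g : Γ) [DecidablePred (· ∈ H)] :
    (Nat.card H : ℂ) * permChar H g = ∑ x : Γ, if x⁻¹ * g * x ∈ H then 1 else 0 := by
  have h : Nat.card H * Nat.card (MulAction.fixedBy (Γ ⧸ H) g) =
      (Finset.univ.filter fun x : Γ => x⁻¹ * g * x ∈ H).card := by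
    rw [← Nat.card_prod, ← Nat.card_congr (QuotientGroup.preimageMkEquivSubgroupProdSet H _),
      ← Fintype.card_coe, ← Nat.card_eq_fintype_card]
    refine Nat.card_congr (Equiv.subtypeEquivRight fun x => ?_)
    simp only [Set.mem_preimage, MulAction.mem_fixedBy, Finset.mem_filter, Finset.mem_univ, true_and]
    rw [eq_comm]
    change (x : Γ ⧸ H) = ((g * x : Γ) : Γ ⧸ H) ↔ _
    rw [QuotientGroup.eq, mul_assoc]
  rw [permChar, ← Nat.cast_mul, h, Finset.sum_boole]

/-- Frobenius reciprocity for the unit character. -/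
theorem charInner_permChar (ρ : Representation ℂ Γ (Fin n → ℂ)) (H : Subgroup Γ) :
    charInner ρ.character (permChar H) =
      Module.finrank ℂ (Representation.invariants (MonoidHom.comp ρ H.subtype)) := by
  classical
  have hH : (Nat.card H : ℂ) ≠ 0 := by exact_mod_cast Nat.card_pos.ne'
  have hΓ : (Nat.card Γ : ℂ) ≠ 0 := by exact_mod_cast Nat.card_pos.ne'
  have : Invertible (Nat.card H : ℂ) := invertibleOfNonzero hH
  rw [← Representation.card_inv_mul_sum_char_eq_finrank]
  have hreal : ∀ g, starRingEnd ℂ (permChar H g) = permChar H g := fun g => by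
    rw [permChar, Complex.conj_natCast]
  have h1 : (Nat.card H : ℂ) * ∑ g, ρ.character g * permChar H g =
      Nat.card Γ * ∑ h : H, ρ.character h := by
    calc _ = ∑ g, ∑ x : Γ, ρ.character g * (if x⁻¹ * g * x ∈ H then 1 else 0) := by
          rw [Finset.mul_sum]
          refine Finset.sum_congr rfl fun g _ => ?_
          rw [mul_left_comm, card_mul_permChar, Finset.mul_sum]
      _ = ∑ x : Γ, ∑ k, ρ.character k * (if k ∈ H then 1 else 0) := by
          rw [Finset.sum_comm]
          refine Finset.sum_congr rfl fun x _ => ?_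
          refine Fintype.sum_equiv (MulAut.conj x⁻¹).toEquiv _ _ fun g => ?_
          have : (MulAut.conj x⁻¹).toEquiv g = x⁻¹ * g * x := by simp
          rw [this]
          congr 1
          have h := ρ.char_conj g x⁻¹
          rw [inv_inv] at h
          exact h.symm
      _ = _ := by
          rw [Finset.sum_const, Finset.card_univ, ← Nat.card_eq_fintype_card, nsmul_eq_mul]
          congr 1
          simp only [mul_ite, mul_one, mul_zero]
          rw [← Finset.sum_filter, Finset.sum_subtype (p := fun k => k ∈ H) _ (by simp)]
  rw [charInner, Finset.sum_congr rfl fun g _ => by rw [hreal]]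
  have h2 : ∑ g, ρ.character g * permChar H g =
      (Nat.card H : ℂ)⁻¹ * (Nat.card Γ * ∑ h : H, ρ.character h) := by
    rw [← h1, ← mul_assoc, inv_mul_cancel₀ hH, one_mul]
  rw [h2, mul_left_comm, ← mul_assoc (Nat.card Γ : ℂ)⁻¹, inv_mul_cancel₀ hΓ, one_mul]
  rfl

theorem permChar_top (g : Γ) : permChar (⊤ : Subgroup Γ) g = 1 := by
  have := QuotientGroup.subsingleton_quotient_top (G := Γ)
  have h : MulAction.fixedBy (Γ ⧸ (⊤ : Subgroup Γ)) g = Set.univ :=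
    Set.eq_univ_of_forall fun x => Subsingleton.elim _ _
  rw [permChar, h, Nat.card_univ, Nat.card_of_subsingleton (1 : Γ ⧸ (⊤ : Subgroup Γ)), Nat.cast_one]

theorem charInner_augChar (ρ : Representation ℂ Γ (Fin n → ℂ)) (H : Subgroup Γ) :
    charInner ρ.character (augChar H) =
      Module.finrank ℂ (Representation.invariants (MonoidHom.comp ρ H.subtype)) -
      Module.finrank ℂ (Representation.invariants (MonoidHom.comp ρ (⊤ : Subgroup Γ).subtype)) := by
  rw [← charInner_permChar, ← charInner_permChar]
  unfold charInner augChar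
  simp only [permChar_top, map_sub, mul_sub, Finset.sum_sub_distrib]

/-- The `ℚ[Γ]`-module attached to a complex representation. -/
abbrev ratModule (ρ : Representation ℂ Γ (Fin n → ℂ)) : Module (MonoidAlgebra ℚ Γ) (Fin n → ℂ) :=
  Module.compHom _ ((ρ.asAlgebraHom : MonoidAlgebra ℂ Γ →+* Module.End ℂ (Fin n → ℂ)).comp
    (MonoidAlgebra.mapRingHom Γ (algebraMap ℚ ℂ)))

theorem ratModule_single_smul (ρ : Representation ℂ Γ (Fin n → ℂ)) (g : Γ) (w : Fin n → ℂ) :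
    letI := ratModule ρ
    MonoidAlgebra.single g (1 : ℚ) • w = ρ g w := by
  change ρ.asAlgebraHom (MonoidAlgebra.mapRingHom Γ (algebraMap ℚ ℂ) (MonoidAlgebra.single g 1)) w = _
  simp

/-- The trace of the action of an element of `ℚ[Γ]`. -/
def ratTrace (ρ : Representation ℂ Γ (Fin n → ℂ)) : MonoidAlgebra ℚ Γ →+ ℂ :=
  ((LinearMap.trace ℂ (Fin n → ℂ)).toAddMonoidHom).comp
    ((ρ.asAlgebraHom : MonoidAlgebra ℂ Γ →+* Module.End ℂ (Fin n → ℂ)).comp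
    (MonoidAlgebra.mapRingHom Γ (algebraMap ℚ ℂ))).toAddMonoidHom

theorem sum_coeff_single (x : MonoidAlgebra ℚ Γ) :
    x = ∑ h, x.coeff h • MonoidAlgebra.single h (1 : ℚ) := by
  ext g
  simp [MonoidAlgebra.coeff_sum]

theorem ratTrace_single_smul (ρ : Representation ℂ Γ (Fin n → ℂ)) (q : ℚ) (g : Γ) :
    ratTrace ρ (q • MonoidAlgebra.single g 1) = q * ρ.character g := by
  change LinearMap.trace ℂ _ (ρ.asAlgebraHom (MonoidAlgebra.mapRingHom Γ (algebraMap ℚ ℂ) _)) = _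
  rw [MonoidAlgebra.smul_single, smul_eq_mul, mul_one]
  simp [Representation.character, Representation.asAlgebraHom_single]

/-- The idempotent `e_i` acts as the identity on the representations with a character contained in
`χ_i`. -/
theorem exists_representation_of_isConstituent {i : IrrIdem Γ} {φ : Γ → ℂ} (h : IsConstituent i φ) :
    ∃ (n : ℕ) (ρ : Representation ℂ Γ (Fin n → ℂ)), n ≠ 0 ∧ (∀ g, φ g = ρ.character g) ∧
      letI := ratModule ρ
      ∀ w : Fin n → ℂ, i.1 • w = w := by
  obtain ⟨⟨n, ρ, hρ, hφ⟩, χ, ⟨n', ρ', hρ', hi, hχ⟩, hne⟩ := h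
  have hn : n ≠ 0 := by
    rintro rfl
    apply hne
    have : ∀ g, φ g = 0 := fun g => by
      rw [hφ, Representation.character, Subsingleton.elim (ρ g) 0, map_zero]
    simp [charInner, this]
  refine ⟨n, ρ, hn, hφ, ?_⟩
  let _ := ratModule ρ
  let P : Module.End ℂ (Fin n → ℂ) :=
    ρ.asAlgebraHom (MonoidAlgebra.mapRingHom Γ (algebraMap ℚ ℂ) i.1)
  have hPw : ∀ w, i.1 • w = P w := fun w => rfl
  have hcomm : ∀ g w, P (ρ g w) = ρ g (P w) := fun g w => by
    rw [← hPw, ← hPw, ← ratModule_single_smul, ← ratModule_single_smul, smul_smul, smul_smul,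
      i.2.central]
  have hPP : ∀ w, P (P w) = P w := fun w => by
    rw [← hPw, ← hPw, smul_smul, i.mul_self]
  -- By Schur the action of the central idempotent is bijective, hence the identity, or zero. Zero
  -- would contradict that φ occurs in χ.
  rcases Representation.IsIrreducible.bijective_or_eq_zero
    (P.intertwiningMap_of_isIntertwiningMap (ρ := ρ) (σ := ρ) hcomm) with hb | h0
  · exact fun w => hb.1 (hPP w)
  · exfalso
    apply hne
    have hP0 : P = 0 := LinearMap.ext fun w => congrArg (fun f => f.toLinearMap w) h0
    -- If e_i acts as zero, then φ convolved with the coefficients of e_i vanishes, whereas χ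
    -- convolved with them reproduces χ. Moving the convolution from χ to φ gives ⟨χ, φ⟩ = 0.
    have hL : ∀ k, ∑ h, (i.1.coeff h : ℂ) * ρ.character (h * k) = 0 := fun k => by
      have h1 : ratTrace ρ (i.1 * MonoidAlgebra.single k 1) = 0 := by
        change LinearMap.trace ℂ _ (ρ.asAlgebraHom (MonoidAlgebra.mapRingHom Γ (algebraMap ℚ ℂ) _)) = 0
        rw [map_mul, map_mul]
        change LinearMap.trace ℂ _ (P * _) = 0
        rw [hP0, zero_mul, map_zero]
      rw [← h1]
      conv_rhs => rw [sum_coeff_single i.1, Finset.sum_mul, map_sum]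
      refine Finset.sum_congr rfl fun h _ => ?_
      rw [smul_mul_assoc, MonoidAlgebra.single_mul_single, mul_one, ratTrace_single_smul]
    have hX : ∀ g, χ g = ∑ h, (i.1.coeff h : ℂ) * χ (g * h) := fun g => by
      have h1 : ρ' g = ∑ h, i.1.coeff h • ρ' (g * h) := by
        calc ρ' g = ρ' g * ρ'.asAlgebraHom i.1 := by rw [hi, mul_one]
          _ = _ := by
            conv_lhs => rw [sum_coeff_single i.1, map_sum, Finset.mul_sum]
            refine Finset.sum_congr rfl fun h _ => ?_
            rw [map_smul, Representation.asAlgebraHom_single, one_smul, mul_smul_comm, map_mul]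
      rw [hχ, Representation.character, h1, map_sum, Rat.cast_sum]
      refine Finset.sum_congr rfl fun h _ => ?_
      rw [map_smul, smul_eq_mul, Rat.cast_mul, hχ]
      rfl
    rw [charInner, mul_eq_zero]
    right
    calc _ = ∑ g, ∑ h, (i.1.coeff h : ℂ) * χ (g * h) * ρ.character g⁻¹ :=
          Finset.sum_congr rfl fun g _ => by
            conv_lhs => rw [hφ, conj_character, hX, Finset.sum_mul]
      _ = ∑ h, ∑ k, (i.1.coeff h : ℂ) * χ k * ρ.character (h * k⁻¹) := by
          rw [Finset.sum_comm]
          refine Finset.sum_congr rfl fun h _ => ?_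
          refine Fintype.sum_equiv (Equiv.mulRight h) _ _ fun g => ?_
          rw [Equiv.coe_mulRight, mul_inv_rev, mul_inv_cancel_left]
      _ = ∑ k, χ k * ∑ h, (i.1.coeff h : ℂ) * ρ.character (h * k⁻¹) := by
          rw [Finset.sum_comm]
          refine Finset.sum_congr rfl fun k _ => ?_
          rw [Finset.mul_sum]
          exact Finset.sum_congr rfl fun h _ => by ring
      _ = 0 := Finset.sum_eq_zero fun k _ => by rw [hL, mul_zero]

end Characters

/-! ### Character multiplicities and ranks of left ideals -/

section CharacterRatio

variable {Γ : Type u} [Group Γ] [Fintype Γ]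

theorem exists_unitIdem_top_mul (x : MonoidAlgebra ℚ Γ) :
    ∃ q : ℚ, x * unitIdem (⊤ : Subgroup Γ) = q • unitIdem (⊤ : Subgroup Γ) := by
  refine ⟨∑ h, x.coeff h, ?_⟩
  conv_lhs => rw [sum_coeff_single x, Finset.sum_mul]
  rw [Finset.sum_smul]
  refine Finset.sum_congr rfl fun h _ => ?_
  rw [smul_mul_assoc, single_mul_unitIdem _ _ (Subgroup.mem_top h)]

theorem unitIdem_top_mul_single (g : Γ) :
    unitIdem (⊤ : Subgroup Γ) * MonoidAlgebra.single g 1 = unitIdem ⊤ := by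
  classical
  unfold unitIdem
  rw [Finset.sum_mul]
  simp only [MonoidAlgebra.single_mul_single, mul_one]
  exact Fintype.sum_equiv (Equiv.mulRight (⟨g, Subgroup.mem_top g⟩ : (⊤ : Subgroup Γ))) _ _
    (fun h => rfl)

/-- Every x satisfies xe₁ ∈ ℚe₁. By minimality e_ie₁ is 0 or e_i; in the second case e_i is a
multiple of e₁ and, being idempotent, equals it. -/
theorem IrrIdem.mul_unitIdem_top {i : IrrIdem Γ} (h : i.1 ≠ unitIdem (⊤ : Subgroup Γ)) :
    i.1 * unitIdem (⊤ : Subgroup Γ) = 0 := by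
  classical
  set t := unitIdem (⊤ : Subgroup Γ) with ht
  obtain ⟨q, hq⟩ := exists_unitIdem_top_mul i.1
  rw [← ht] at hq
  have htc : IsCentralIdempotent (i.1 * t) := by
    refine ⟨?_, fun y => ?_⟩
    · rw [IsIdempotentElem, mul_assoc, ← mul_assoc t, ← i.2.central t, mul_assoc, unitIdem_idem,
        ← mul_assoc, i.mul_self]
    · have hty : t * y = y * t := by
        rw [sum_coeff_single y, Finset.mul_sum, Finset.sum_mul]
        refine Finset.sum_congr rfl fun g _ => ?_
        rw [mul_smul_comm, smul_mul_assoc, ht, single_mul_unitIdem _ _ (Subgroup.mem_top g)]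
        rw [unitIdem_top_mul_single]
      rw [mul_assoc, hty, ← mul_assoc, i.2.central, mul_assoc]
  rcases i.2.minimal _ htc (by rw [mul_assoc, ← i.2.central t, ← mul_assoc, i.mul_self]) with h0 | h1
  · exact h0
  · exfalso
    have h2 : i.1 = q • t := by rw [← hq, h1]
    have h3 : t * i.1 = i.1 := by rw [← i.2.central, h1]
    have h4 : q • i.1 = i.1 := by
      conv_rhs => rw [← i.mul_self]
      conv_rhs => rw [h2, smul_mul_assoc, ← h2, h3]
    have h5 : (q - 1) • i.1 = 0 := by rw [sub_smul, one_smul, h4, sub_self]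
    have h6 : q = 1 := sub_eq_zero.mp ((smul_eq_zero.mp h5).resolve_right i.2.ne_zero)
    exact h (by rw [h2, h6, one_smul])

variable {Γ' : Subgroup Γ} {n : ℕ} (ρ : Representation ℂ Γ (Fin n → ℂ))

theorem ratModule_smulCommClass :
    letI := ratModule ρ
    SMulCommClass (MonoidAlgebra ℚ Γ) ℂ (Fin n → ℂ) :=
  let _ := ratModule ρ
  ⟨fun x r w => (ρ.asAlgebraHom (MonoidAlgebra.mapRingHom Γ (algebraMap ℚ ℂ) x)).map_smul r w⟩

/-- The ratio of the values of the characters `a_Γ` and `a_{Γ/Γ'}` is the ratio of the ranks of the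
left ideals generated by `e_i` and `e_ic`. -/
theorem charInner_augChar_ratio {i : IrrIdem Γ} {φ : Γ → ℂ} (hφ : IsConstituent i φ)
    (hi : i ∈ Components (augIdem Γ')) (hne : i.1 ≠ unitIdem (⊤ : Subgroup Γ)) {c : MonoidAlgebra ℚ Γ}
    (hec : augIdem Γ' * c = c) (hγ : ∀ γ ∈ Γ', MonoidAlgebra.single γ (1 : ℚ) * c = c)
    (hcu : c * unitIdem Γ' = augIdem Γ' * unitIdem Γ') {a b : ℕ} (ha : a ≠ 0) (hb : b ≠ 0)
    (θ : (Fin a → leftFix (i.1 * c)) ≃ₗ[MonoidAlgebra ℚ Γ] (Fin b → leftFix i.1)) :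
    charInner φ (augChar Γ') ≠ 0 ∧
      a * charInner φ (augChar Γ') = b * charInner φ (augChar ⊥) := by
  classical
  obtain ⟨n, ρ, hn, hφρ, hiw⟩ := exists_representation_of_isConstituent hφ
  obtain rfl : φ = ρ.character := funext hφρ
  let _ := ratModule ρ
  have := ratModule_smulCommClass ρ
  have hcc : c * c = c := localIdempotent_mul_self (augIdem_central Γ') hec hγ hcu
  have hic : i.1 * c * (i.1 * c) = i.1 * c := by
    rw [mul_assoc, ← mul_assoc c, ← i.2.central c, mul_assoc i.1 c, hcc, ← mul_assoc, i.mul_self]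
  have hew : ∀ w : Fin n → ℂ, augIdem Γ' • w = w := fun w => by
    conv_lhs => rw [← hiw w, smul_smul, (augIdem_central Γ').central, show i.1 * augIdem Γ' = i.1 from hi]
    exact hiw w
  have hinv : ∀ (H : Subgroup Γ) (w : Fin n → ℂ),
      w ∈ Representation.invariants (MonoidHom.comp ρ H.subtype) ↔
      ∀ γ ∈ H, MonoidAlgebra.single γ (1 : ℚ) • w = w := fun H w => by
    rw [Representation.mem_invariants]
    constructor
    · intro h γ hγ
      rw [ratModule_single_smul]
      exact h ⟨γ, hγ⟩
    · intro h γ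
      have := h γ.1 γ.2
      rwa [ratModule_single_smul] at this
  have hunit : ∀ (H : Subgroup Γ) (w : Fin n → ℂ),
      w ∈ Representation.invariants (MonoidHom.comp ρ H.subtype) → unitIdem H • w = w := by
    intro H w hw
    have h1 : ∀ h : H, (MonoidAlgebra.single (h : Γ) ((Nat.card H : ℚ)⁻¹) : MonoidAlgebra ℚ Γ) • w =
        (MonoidAlgebra.single (1 : Γ) ((Nat.card H : ℚ)⁻¹) : MonoidAlgebra ℚ Γ) • w := fun h => by
      have h2 : (MonoidAlgebra.single (h : Γ) ((Nat.card H : ℚ)⁻¹) : MonoidAlgebra ℚ Γ) =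
          MonoidAlgebra.single (1 : Γ) ((Nat.card H : ℚ)⁻¹) * MonoidAlgebra.single (h : Γ) 1 := by
        rw [MonoidAlgebra.single_mul_single, one_mul, mul_one]
      rw [h2, mul_smul, (hinv H w).mp hw _ h.2]
    unfold unitIdem
    rw [Finset.sum_smul, Finset.sum_congr rfl fun h _ => h1 h, ← Finset.sum_smul, Finset.sum_const,
      Finset.card_univ, ← Nat.card_eq_fintype_card, MonoidAlgebra.smul_single, nsmul_eq_mul,
      mul_inv_cancel₀ (by exact_mod_cast Nat.card_pos.ne')]
    exact one_smul _ w
  -- A vector fixed by Γ is fixed by both e_i and e₁, whose product is 0. So subtracting the unit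
  -- character from the permutation characters does not affect the multiplicities.
  have htop : Module.finrank ℂ (Representation.invariants
      (MonoidHom.comp ρ (⊤ : Subgroup Γ).subtype)) = 0 := by
    suffices h : ∀ w : Representation.invariants (MonoidHom.comp ρ (⊤ : Subgroup Γ).subtype), w = 0 by
      have : Subsingleton (Representation.invariants
        (MonoidHom.comp ρ (⊤ : Subgroup Γ).subtype)) := ⟨fun x y => (h x).trans (h y).symm⟩
      exact Module.finrank_zero_of_subsingleton
    intro w
    refine Subtype.ext ?_
    rw [← hiw w.1]
    conv_lhs => rw [← hunit _ _ w.2, smul_smul, IrrIdem.mul_unitIdem_top hne, zero_smul]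
    rfl
  have hbot : Module.finrank ℂ (Representation.invariants
      (MonoidHom.comp ρ (⊥ : Subgroup Γ).subtype)) = n := by
    have : Representation.invariants (MonoidHom.comp ρ (⊥ : Subgroup Γ).subtype) = ⊤ := by
      refine eq_top_iff.mpr fun w _ => (hinv _ _).mpr fun γ h => ?_
      rw [Subgroup.mem_bot.mp h]
      exact one_smul _ w
    rw [this, finrank_top, Module.finrank_fin_fun]
  -- On this representation e_i and e act as the identity, so e_ic projects onto the Γ'-invariants.
  have hfix : fixedBy ℂ (i.1 * c) (Fin n → ℂ) =
      Representation.invariants (MonoidHom.comp ρ Γ'.subtype) := by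
    ext w
    have h1 : (i.1 * c) • w = c • w := by rw [mul_smul, hiw]
    change (i.1 * c) • w = w ↔ _
    rw [h1]
    constructor
    · intro hw
      refine (hinv _ _).mpr fun γ h => ?_
      rw [← hw, smul_smul, hγ γ h]
    · intro hw
      conv_lhs => rw [← hunit _ _ hw, smul_smul, hcu, mul_smul, hunit _ _ hw, hew]
  have htopi : fixedBy ℂ i.1 (Fin n → ℂ) = ⊤ := eq_top_iff.mpr fun w _ => hiw w
  -- Taking dimensions in (e_icV)^a ≅ (e_iV)^b gives a · dim V^{Γ'} = b · dim V.
  obtain ⟨E⟩ := nonempty_fixedBy_equiv (G := Fin n → ℂ) ℂ hic i.mul_self θ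
  have hE := E.finrank_eq
  rw [Module.finrank_pi_fintype, Module.finrank_pi_fintype, Finset.sum_const, Finset.sum_const,
    Finset.card_univ, Finset.card_univ, Fintype.card_fin, Fintype.card_fin, hfix, htopi, finrank_top,
    Module.finrank_fin_fun, smul_eq_mul, smul_eq_mul] at hE
  rw [charInner_augChar, charInner_augChar, htop, hbot, Nat.cast_zero, sub_zero, sub_zero]
  refine ⟨fun h0 => ?_, by exact_mod_cast hE⟩
  have h0' : Module.finrank ℂ (Representation.invariants (MonoidHom.comp ρ Γ'.subtype)) = 0 := by
    exact_mod_cast h0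
  rw [h0', mul_zero] at hE
  exact mul_ne_zero hb hn hE.symm

end CharacterRatio

/-! ### The random module X is carried to Y -/

section Expectation

variable {Γ : Type u} [Group Γ] [Fintype Γ] {Γ' : Subgroup Γ} {S : Set Nat.Primes}

/-- Component by component, the orders satisfy X^a = Y^b and the exponents bv = aw, with the same
positive integers a and b coming from one isomorphism of left ideals. Hence X^v = Y^(bv/a) = Y^w. -/
theorem powCard_fixedPart (hS : ∀ p ∈ S, IsGoodPrime p (augIdem Γ'))
    {φ : IrrIdem Γ → Γ → ℂ} (hφ : ∀ i, IsConstituent i (φ i))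
    (hne : ∀ i ∈ Components (augIdem Γ'), i.1 ≠ unitIdem (⊤ : Subgroup Γ))
    {w v : IrrIdem Γ → ℚ} (hv : IsFixedFieldRank φ Γ' w v)
    (G : Type u) [AddCommGroup G] [Module (idemOrder (ZS S) (augIdem_central Γ')) G] [Finite G] :
    letI := fixedPartModule (hc := augIdem_central Γ') (mem_of_good hS) Γ' G
    powCard (heckeOrder (ZS S) (augIdem_central Γ') Γ')
      (fun i : Components (augIdem Γ') => toCorner (unitProd_idem (augIdem_central Γ') Γ') i.1.1)
      (fun i => v i) (fixedPart (ZS S) (augIdem_central Γ') Γ' G) =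
    powCard (idemOrder (ZS S) (augIdem_central Γ'))
      (fun i : Components (augIdem Γ') => toCorner (augIdem_central Γ').idem i.1.1)
      (fun i => w i) G := by
  let _ := fixedPartModule (hc := augIdem_central Γ') (mem_of_good hS) Γ' G
  obtain ⟨c, hec, hγ, hcu, -⟩ := exists_isFullCorner hS
  unfold powCard
  refine Finset.prod_congr rfl fun i _ => ?_
  have hcc : c.1 * c.1 = c.1 := localIdempotent_mul_self (augIdem_central Γ') hec hγ hcu
  have hic : i.1.1 * c.1 * (i.1.1 * c.1) = i.1.1 * c.1 := by
    rw [mul_assoc, ← mul_assoc c.1, ← i.1.2.central c.1, mul_assoc i.1.1 c.1, hcc, ← mul_assoc,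
      i.1.mul_self]
  have h0 : i.1.1 * c.1 ≠ 0 := fun h => by
    apply mul_unitIdem_ne_zero i.2
    rw [show i.1.1 = i.1.1 * augIdem Γ' from i.2.symm, mul_assoc, ← hcu, ← mul_assoc, h, zero_mul]
  obtain ⟨a, b, ha, hb, ⟨θ⟩⟩ := exists_leftFix_equiv i.1.2 hic h0
  obtain ⟨hne0, hratio⟩ := charInner_augChar_ratio (hφ i.1) i.2 (hne i.1 i.2) hec hγ hcu ha hb θ
  have hcard := card_component_fixedPart_pow hS hec hγ hcu i θ G
  set X := Nat.card (component (heckeOrder (ZS S) (augIdem_central Γ') Γ')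
    (toCorner (unitProd_idem (augIdem_central Γ') Γ') i.1.1)
    (fixedPart (ZS S) (augIdem_central Γ') Γ' G))
  set Y := Nat.card (component (idemOrder (ZS S) (augIdem_central Γ'))
    (toCorner (augIdem_central Γ').idem i.1.1) G)
  have hvw : (b : ℚ) * v i.1 = a * w i.1 := by
    have hb' : (b : ℂ) ≠ 0 := by exact_mod_cast hb
    have h1 := hv i.1 i.2
    have h2 : (b : ℂ) * (v i.1 : ℂ) = a * (w i.1 : ℂ) := by
      rw [h1, ← mul_assoc, ← mul_div_assoc, ← hratio, mul_div_assoc, div_self hne0, mul_one]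
    exact_mod_cast h2
  have hX : (X : ℝ) ^ (a : ℝ) = (Y : ℝ) ^ (b : ℝ) := by
    rw [Real.rpow_natCast, Real.rpow_natCast]
    exact_mod_cast hcard
  have hX0 : (0 : ℝ) ≤ X := Nat.cast_nonneg X
  have hY0 : (0 : ℝ) ≤ Y := Nat.cast_nonneg Y
  have ha' : (a : ℝ) ≠ 0 := by exact_mod_cast ha
  have hvw' : (b : ℝ) * (v i.1 : ℝ) = a * (w i.1 : ℝ) := by exact_mod_cast hvw
  calc (X : ℝ) ^ ((v i.1 : ℚ) : ℝ) = ((X : ℝ) ^ (a : ℝ)) ^ ((v i.1 : ℝ) / a) := by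
        rw [← Real.rpow_mul hX0, mul_div_cancel₀ _ ha']
    _ = (Y : ℝ) ^ ((w i.1 : ℚ) : ℝ) := by
        rw [hX, ← Real.rpow_mul hY0, ← mul_div_assoc, hvw', mul_div_cancel_left₀ _ ha']

/-- The map `G ↦ {}^{Γ'}G` takes the random module `X` to the random module `Y`. -/
theorem expectation_fixedClass (hS : ∀ p ∈ S, IsGoodPrime p (augIdem Γ'))
    {φ : IrrIdem Γ → Γ → ℂ} (hφ : ∀ i, IsConstituent i (φ i))
    (hne : ∀ i ∈ Components (augIdem Γ'), i.1 ≠ unitIdem (⊤ : Subgroup Γ))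
    {w v : IrrIdem Γ → ℚ} (hv : IsFixedFieldRank φ Γ' w v)
    (f : FinModClass (heckeOrder (ZS S) (augIdem_central Γ') Γ') → ℝ≥0) :
    expectationX S (augIdem_central Γ') w
      (fun c => f (fixedClass (mem_of_good hS) (augIdem_central Γ') Γ' c)) =
    expectationY S (augIdem_central Γ') Γ' v f := by
  have hb := fixedClass_bijective hS
  let F := Equiv.ofBijective _ hb
  have hw : ∀ c, classWeight (idemOrder (ZS S) (augIdem_central Γ'))
      (fun i : Components (augIdem Γ') => toCorner (augIdem_central Γ').idem i.1.1)
      (fun i => w i) c = classWeight (heckeOrder (ZS S) (augIdem_central Γ') Γ')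
      (fun i : Components (augIdem Γ') => toCorner (unitProd_idem (augIdem_central Γ') Γ') i.1.1)
      (fun i => v i) (F c) := by
    rintro ⟨G⟩
    change modWeight _ _ _ G = modWeight _ _ _ _
    unfold modWeight
    rw [← powCard_fixedPart hS hφ hne hv G.carrier, ← card_aut_fixedPart hS G.carrier]
  unfold expectationX expectationY modExpectation modProb
  have htot := (tsum_congr hw).trans (F.tsum_eq (classWeight
    (heckeOrder (ZS S) (augIdem_central Γ') Γ') (fun i : Components (augIdem Γ') =>
      toCorner (unitProd_idem (augIdem_central Γ') Γ') i.1.1) (fun i => v i)))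
  rw [htot]
  refine (tsum_congr fun c => ?_).trans (F.tsum_eq _)
  rw [hw]
  rfl

end Expectation

/-! ### Norm and extension of ideals -/

section IdealNorm

open scoped nonZeroDivisors

/-- Extension of nonzero ideals as a homomorphism. -/
def idealExtend (A B : Type*) [CommRing A] [IsDedekindDomain A] [CommRing B] [IsDedekindDomain B]
    [Algebra A B] [Module.IsTorsionFree A B] : (Ideal A)⁰ →* (Ideal B)⁰ where
  toFun := ClassGroup.extendedIdeal A B
  map_one' := Subtype.ext (by simp [Ideal.one_eq_top, Ideal.map_top])
  map_mul' I J := Subtype.ext (Ideal.map_mul _ _ _)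

theorem ideal_pow_left_injective {A : Type*} [CommRing A] [IsDedekindDomain A] {n : ℕ} (hn : n ≠ 0) :
    Function.Injective fun I : (Ideal A)⁰ => I ^ n := fun I J h =>
  Subtype.ext (pow_left_injective hn (congrArg Subtype.val h))

variable {K L : Type*} [Field K] [NumberField K] [Field L] [NumberField L] [Algebra K L]

theorem algebraMap_intNorm_eq_prod [IsGalois K L] (x : 𝓞 L) :
    algebraMap (𝓞 K) (𝓞 L) (Algebra.intNorm (𝓞 K) (𝓞 L) x) =
      ∏ σ : Gal(L/K), RingOfIntegers.mapRingEquiv (σ : L ≃+* L) x := by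
  apply RingOfIntegers.coe_injective
  have h1 := Algebra.algebraMap_intNorm (A := 𝓞 K) (K := K) (L := L) (B := 𝓞 L) x
  rw [← IsScalarTower.algebraMap_apply, IsScalarTower.algebraMap_apply (𝓞 K) K L, h1,
    Algebra.norm_eq_prod_automorphisms, map_prod]
  rfl

variable (K L) in
theorem finrank_ringOfIntegers : Module.finrank (𝓞 K) (𝓞 L) = Module.finrank K L :=
  (IsFractionRing.finrank_eq (𝓞 K) K (𝓞 L) L).symm

theorem idealNorm_idealExtend (I : (Ideal (𝓞 K))⁰) :
    idealNorm (𝓞 K) (𝓞 L) (idealExtend (𝓞 K) (𝓞 L) I) = I ^ Module.finrank K L := by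
  refine Subtype.ext ?_
  rw [← finrank_ringOfIntegers K L]
  exact Ideal.relNorm_algebraMap (𝓞 L) I.1

variable (K L) in
-- The norm of an extended ideal is a power of it, and ideals have unique roots. Extension of
-- classes need not be injective, so the identities between classes of K below are first proved for
-- ideals.
theorem idealExtend_injective : Function.Injective (idealExtend (𝓞 K) (𝓞 L)) := fun I J h => by
  have h1 := congrArg (idealNorm (𝓞 K) (𝓞 L)) h
  rw [idealNorm_idealExtend, idealNorm_idealExtend] at h1
  exact ideal_pow_left_injective Module.finrank_pos.ne' h1

theorem idealNorm_idealAut (σ : Gal(L/K)) (I : (Ideal (𝓞 L))⁰) :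
    idealNorm (𝓞 K) (𝓞 L) (idealAut (RingOfIntegers.mapRingEquiv (σ : L ≃+* L)) I) =
      idealNorm (𝓞 K) (𝓞 L) I :=
  Subtype.ext (Ideal.relNorm_map_algEquiv (RingOfIntegers.mapAlgEquiv σ) I.1)

/-- The ideal norm in a Galois extension is the product of the conjugates. -/
theorem idealExtend_idealNorm [IsGalois K L] (I : (Ideal (𝓞 L))⁰) :
    idealExtend (𝓞 K) (𝓞 L) (idealNorm (𝓞 K) (𝓞 L) I) =
      ∏ σ : Gal(L/K), idealAut (RingOfIntegers.mapRingEquiv (σ : L ≃+* L)) I := by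
  set P := ∏ σ : Gal(L/K), idealAut (RingOfIntegers.mapRingEquiv (σ : L ≃+* L)) I
  have hP : P.1 = ∏ σ : Gal(L/K), Ideal.map
      (RingOfIntegers.mapRingEquiv (σ : L ≃+* L) : 𝓞 L →+* 𝓞 L) I.1 := by
    rw [← Submonoid.coe_subtype]
    exact map_prod _ _ _
  have hle : Ideal.map (algebraMap (𝓞 K) (𝓞 L)) (Ideal.relNorm (𝓞 K) I.1) ≤ P.1 := by
    rw [Ideal.map_relNorm, Ideal.span_le, hP]
    rintro _ ⟨x, hx, rfl⟩
    change algebraMap _ _ (Algebra.intNorm _ _ x) ∈ _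
    rw [algebraMap_intNorm_eq_prod]
    exact Ideal.prod_mem_prod fun σ _ => Ideal.mem_map_of_mem _ hx
  obtain ⟨J, hJ⟩ := Ideal.dvd_iff_le.mpr hle
  have hJ0 : J ≠ 0 := by
    rintro rfl
    rw [mul_zero] at hJ
    exact nonZeroDivisors.ne_zero
      (idealExtend (𝓞 K) (𝓞 L) (idealNorm (𝓞 K) (𝓞 L) I)).2 hJ
  have hJ' : idealExtend (𝓞 K) (𝓞 L) (idealNorm (𝓞 K) (𝓞 L) I) =
      P * ⟨J, mem_nonZeroDivisors_iff_ne_zero.mpr hJ0⟩ := Subtype.ext hJ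
  -- The extended norm is divisible by the product P of the conjugates. Both have norm N(I)^[L:K],
  -- so the cofactor J has norm 1 and is trivial.
  have hn := congrArg (idealNorm (𝓞 K) (𝓞 L)) hJ'
  rw [idealNorm_idealExtend, map_mul, map_prod, Finset.prod_congr rfl fun σ _ =>
    idealNorm_idealAut σ I, Finset.prod_const, Finset.card_univ, ← Nat.card_eq_fintype_card,
    IsGalois.card_aut_eq_finrank] at hn
  have h1 : Ideal.relNorm (𝓞 K) J = ⊤ :=
    (congrArg Subtype.val (mul_eq_left.mp hn.symm)).trans Ideal.one_eq_top
  have h2 : J = 1 := by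
    rw [Ideal.one_eq_top, Ideal.eq_top_iff_one]
    have h3 := Ideal.relNorm_le_comap (𝓞 K) J (h1.symm ▸ Submodule.mem_top : (1 : 𝓞 K) ∈ Ideal.relNorm (𝓞 K) J)
    rwa [Ideal.mem_comap, map_one] at h3
  rw [hJ']
  conv_rhs => rw [← mul_one P]
  exact congrArg _ (Subtype.ext h2)

variable {F : Type*} [Field F] [NumberField F] [Algebra F K] [Algebra F L] [IsScalarTower F K L]

theorem idealExtend_idealExtend (I : (Ideal (𝓞 F))⁰) :
    idealExtend (𝓞 K) (𝓞 L) (idealExtend (𝓞 F) (𝓞 K) I) = idealExtend (𝓞 F) (𝓞 L) I :=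
  ClassGroup.extendedIdeal_extendedIdeal _ _ _ I

theorem idealNorm_idealNorm (I : (Ideal (𝓞 L))⁰) :
    idealNorm (𝓞 F) (𝓞 K) (idealNorm (𝓞 K) (𝓞 L) I) = idealNorm (𝓞 F) (𝓞 L) I :=
  Subtype.ext (Ideal.relNorm_relNorm (𝓞 F) (𝓞 K) I.1)

theorem classNorm_mk0 (I : (Ideal (𝓞 L))⁰) :
    classNorm (𝓞 K) (𝓞 L) (ClassGroup.mk0 I) = ClassGroup.mk0 (idealNorm (𝓞 K) (𝓞 L) I) :=
  classGroupLift_mk0 _ _ I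

theorem extendedHom_mk0 (I : (Ideal (𝓞 K))⁰) :
    ClassGroup.extendedHom (𝓞 K) (𝓞 L) (ClassGroup.mk0 I) =
      ClassGroup.mk0 (idealExtend (𝓞 K) (𝓞 L) I) :=
  ClassGroup.extendedHom_mk0 _ _ I

theorem classNorm_classNorm (x : ClassGroup (𝓞 L)) :
    classNorm (𝓞 F) (𝓞 K) (classNorm (𝓞 K) (𝓞 L) x) = classNorm (𝓞 F) (𝓞 L) x := by
  obtain ⟨I, rfl⟩ := ClassGroup.mk0_surjective x
  rw [classNorm_mk0, classNorm_mk0, classNorm_mk0, idealNorm_idealNorm]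

end IdealNorm

/-! ### The action of Γ on ideals of L -/

section GaloisAction

open scoped nonZeroDivisors

variable {Γ : Type u} [Group Γ] [Fintype Γ] {K₀ : Type u} [Field K₀] [NumberField K₀]

namespace GammaExt

variable (E : GammaExt Γ K₀) (Γ' : Subgroup Γ)

/-- The action of `g ∈ Γ` on the ideals of `L`. -/
def idealAct (g : Γ) : (Ideal (𝓞 E.L))⁰ →* (Ideal (𝓞 E.L))⁰ :=
  idealAut (RingOfIntegers.mapRingEquiv (E.τ.symm g : E.L ≃+* E.L))

/-- The action of `g ∈ Γ` on the ideal classes of `L`. -/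
def classAct (g : Γ) : ClassGroup (𝓞 E.L) →* ClassGroup (𝓞 E.L) :=
  classAut (RingOfIntegers.mapRingEquiv (E.τ.symm g : E.L ≃+* E.L))

theorem classAct_mk0 (g : Γ) (I : (Ideal (𝓞 E.L))⁰) :
    E.classAct g (ClassGroup.mk0 I) = ClassGroup.mk0 (E.idealAct g I) := classAut_mk0 _ I

theorem idealAct_mul (g h : Γ) (I : (Ideal (𝓞 E.L))⁰) :
    E.idealAct (g * h) I = E.idealAct g (E.idealAct h I) := by
  refine Subtype.ext ?_
  change Ideal.map _ I.1 = Ideal.map _ (Ideal.map _ I.1)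
  rw [Ideal.map_map, map_mul]
  rfl

theorem idealAct_one (I : (Ideal (𝓞 E.L))⁰) : E.idealAct 1 I = I := by
  refine Subtype.ext ?_
  change Ideal.map _ I.1 = I.1
  rw [map_one]
  exact Ideal.map_id I.1

theorem idealAct_idealExtend {g : Γ} (hg : g ∈ Γ') (J : (Ideal (𝓞 (E.fixedField Γ')))⁰) :
    E.idealAct g (idealExtend (𝓞 (E.fixedField Γ')) (𝓞 E.L) J) =
      idealExtend (𝓞 (E.fixedField Γ')) (𝓞 E.L) J := by
  refine Subtype.ext ?_
  change Ideal.map _ (Ideal.map _ J.1) = Ideal.map _ J.1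
  rw [Ideal.map_map]
  congr 1
  refine RingHom.ext fun x => RingOfIntegers.coe_injective ?_
  exact x.1.2 ⟨E.τ.symm g, by simpa using hg⟩

/-- The subgroup of the Galois group that corresponds to `Γ'`. -/
def comapEquiv : Γ'.comap E.τ.toMonoidHom ≃ Γ' where
  toFun s := ⟨E.τ s.1, s.2⟩
  invFun h := ⟨E.τ.symm h.1, by simp⟩
  left_inv s := Subtype.ext (E.τ.symm_apply_apply s.1)
  right_inv h := Subtype.ext (E.τ.apply_symm_apply h.1)

theorem idealExtend_idealNorm_fixedField [Fintype Γ'] (I : (Ideal (𝓞 E.L))⁰) :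
    idealExtend (𝓞 (E.fixedField Γ')) (𝓞 E.L) (idealNorm (𝓞 (E.fixedField Γ')) (𝓞 E.L) I) =
      ∏ h : Γ', E.idealAct h I := by
  rw [idealExtend_idealNorm]
  symm
  refine Fintype.prod_equiv ((E.comapEquiv Γ').symm.trans
    (IntermediateField.subgroupEquivAlgEquiv (Γ'.comap E.τ.toMonoidHom)).toEquiv) _ _ fun h => ?_
  unfold idealAct
  congr 3

theorem idealExtend_idealNorm_base (I : (Ideal (𝓞 E.L))⁰) :
    idealExtend (𝓞 K₀) (𝓞 E.L) (idealNorm (𝓞 K₀) (𝓞 E.L) I) = ∏ g : Γ, E.idealAct g I := by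
  rw [idealExtend_idealNorm]
  symm
  exact Fintype.prod_equiv E.τ.symm.toEquiv _ _ fun h => rfl

theorem finrank_fixedField : Module.finrank (E.fixedField Γ') E.L = Nat.card Γ' := by
  rw [IntermediateField.finrank_fixedField_eq_card]
  exact Nat.card_congr (E.comapEquiv Γ')

end GammaExt

end GaloisAction

/-! ### Sums of coefficients over cosets of Γ' -/

section CosetSums

variable {Γ : Type u} [Group Γ] [Fintype Γ] {Γ' : Subgroup Γ}

theorem sum_eq_sum_quotient [Fintype Γ'] [Fintype (Γ ⧸ Γ')] {M : Type*} [AddCommMonoid M]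
    (F : Γ → M) : ∑ g, F g = ∑ q : Γ ⧸ Γ', ∑ h : Γ', F (q.out * h) := by
  rw [← Fintype.sum_prod_type' (fun (q : Γ ⧸ Γ') (h : Γ') => F (q.out * h))]
  symm
  refine Fintype.sum_bijective (fun p : (Γ ⧸ Γ') × Γ' => p.1.out * (p.2 : Γ)) ⟨?_, ?_⟩ _ _
    fun _ => rfl
  · rintro ⟨q, h⟩ ⟨q', h'⟩ heq
    have hq : q = q' := by
      have h1 := congrArg (QuotientGroup.mk : Γ → Γ ⧸ Γ') heq
      simpa using h1
    subst hq
    exact Prod.ext rfl (Subtype.ext (mul_left_cancel heq))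
  · intro g
    have hg : ((g : Γ ⧸ Γ').out)⁻¹ * g ∈ Γ' := QuotientGroup.eq.mp (QuotientGroup.out_eq' _)
    exact ⟨⟨g, ⟨_, hg⟩⟩, mul_inv_cancel_left _ _⟩

/-- If the sums of `b` over the left cosets of `Γ'` are constant except for `Γ'` itself, and `f` is
constant on left cosets, then `∑ b(g) f(g)` only depends on `f(1)` and the sum of `f`. -/
theorem sum_smul_eq_of_coset_sums [Fintype Γ'] [Fintype (Γ ⧸ Γ')] [DecidablePred (· ∈ Γ')] {R M : Type*} [Semiring R] [AddCommMonoid M] [Module R M]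
    {b : Γ → R} {d t : R} (hb : ∀ σ, ∑ h : Γ', b (σ * h) = (if σ ∈ Γ' then d else 0) + t)
    {f : Γ → M} (hf : ∀ σ, ∀ h ∈ Γ', f (σ * h) = f σ) :
    ∑ g, b g • f g = d • f 1 + t • ∑ q : Γ ⧸ Γ', f q.out := by
  classical
  rw [sum_eq_sum_quotient (Γ' := Γ')]
  have h1 : ∀ q : Γ ⧸ Γ', ∑ h : Γ', b (q.out * h) • f (q.out * h) =
      (if q = ((1 : Γ) : Γ ⧸ Γ') then d • f 1 else 0) + t • f q.out := fun q => by
    rw [Finset.sum_congr rfl fun h _ => by rw [hf q.out h.1 h.2], ← Finset.sum_smul, hb, add_smul]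
    congr 1
    have hq : q = ((1 : Γ) : Γ ⧸ Γ') ↔ q.out ∈ Γ' := by
      conv_lhs => rw [← QuotientGroup.out_eq' q, eq_comm, QuotientGroup.eq, inv_one, one_mul]
    by_cases h : q.out ∈ Γ'
    · rw [if_pos h, if_pos (hq.mpr h)]
      congr 1
      simpa using hf 1 _ h
    · rw [if_neg h, if_neg (fun h' => h (hq.mp h')), zero_smul]
  rw [Finset.sum_congr rfl fun q _ => h1 q, Finset.sum_add_distrib, Finset.sum_ite_eq',
    if_pos (Finset.mem_univ _), Finset.smul_sum]

/-- The inner sum over Γ' is what N_{L/K} becomes in L. Substituting g ↦ k⁻¹g moves it onto the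
coefficients. -/
theorem sum_smul_sum_eq_of_coset_sums [Fintype Γ'] [Fintype (Γ ⧸ Γ')] [DecidablePred (· ∈ Γ')]
    {M : Type*} [AddCommMonoid M] {a : Γ → ℕ} {d t : ℕ}
    (ha : ∀ σ, ∑ h : Γ', ∑ k : Γ', a ((k : Γ)⁻¹ * (σ * h)) = (if σ ∈ Γ' then d else 0) + t)
    {f : Γ → M} (hf : ∀ σ, ∀ h ∈ Γ', f (σ * h) = f σ) :
    ∑ g, a g • ∑ k : Γ', f (k * g) = d • f 1 + t • ∑ q : Γ ⧸ Γ', f q.out := by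
  rw [← sum_smul_eq_of_coset_sums (b := fun g => ∑ k : Γ', a ((k : Γ)⁻¹ * g)) ha hf]
  simp only [Finset.smul_sum, Finset.sum_smul]
  rw [Finset.sum_comm]
  conv_rhs => rw [Finset.sum_comm]
  refine Finset.sum_congr rfl fun k _ => ?_
  exact Fintype.sum_equiv (Equiv.mulLeft (k : Γ)) _ _ fun g => by simp

theorem coeff_unitIdem [inst : DecidablePred (· ∈ Γ')] (σ : Γ) :
    (unitIdem Γ').coeff σ = if σ ∈ Γ' then (Nat.card Γ' : ℚ)⁻¹ else 0 := by
  obtain rfl : inst = fun a => Classical.propDecidable _ := Subsingleton.elim _ _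
  classical
  simp only [unitIdem, MonoidAlgebra.coeff_sum, Finsupp.finsetSum_apply, MonoidAlgebra.coeff_single,
    Finsupp.single_apply]
  split_ifs with h
  · rw [Finset.sum_eq_single (⟨σ, h⟩ : Γ')]
    · rw [if_pos rfl]
    · exact fun k _ hk => if_neg fun h' => hk (Subtype.ext h')
    · exact fun h' => absurd (Finset.mem_univ _) h'
  · exact Finset.sum_eq_zero fun k _ => if_neg fun (h' : (k : Γ) = σ) => h (h' ▸ k.2)

/-- The idempotent `e_1` acts trivially on the augmentation representation. -/
theorem cosetAction_unitIdem_top {w : MonoidAlgebra ℚ (Γ ⧸ Γ')} (hw : w ∈ augModule Γ') :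
    cosetAction Γ' (unitIdem ⊤) w = 0 := by
  set t := cosetAction Γ' (unitIdem ⊤) (MonoidAlgebra.single ((1 : Γ) : Γ ⧸ Γ') 1) with ht
  have h1 : ∀ q : Γ ⧸ Γ', cosetAction Γ' (unitIdem ⊤) (MonoidAlgebra.single q 1) = t := fun q => by
    obtain ⟨g, rfl⟩ := QuotientGroup.mk_surjective q
    have h2 : MonoidAlgebra.single ((g : Γ) : Γ ⧸ Γ') (1 : ℚ) =
        cosetAction Γ' (MonoidAlgebra.single g 1) (MonoidAlgebra.single ((1 : Γ) : Γ ⧸ Γ') 1) := by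
      rw [cosetAction_single]
      congr 1
      change _ = ((g * 1 : Γ) : Γ ⧸ Γ')
      rw [mul_one]
    rw [h2, ← Module.End.mul_apply, ← map_mul, unitIdem_top_mul_single]
  have h2 : ∀ w : MonoidAlgebra ℚ (Γ ⧸ Γ'),
      cosetAction Γ' (unitIdem ⊤) w = (w.coeff.sum fun _ c => c) • t := fun w => by
    induction w using MonoidAlgebra.induction_linear with
    | zero => simp
    | add a b ha hb =>
      rw [map_add, ha, hb, MonoidAlgebra.coeff_add, Finsupp.sum_add_index' (by simp) (by simp),
        add_smul]
    | single x r =>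
      have : MonoidAlgebra.single x r = r • MonoidAlgebra.single x (1 : ℚ) := by simp
      rw [this, map_smul, h1]
      simp
  rw [h2, show (w.coeff.sum fun _ c => c) = 0 from hw, zero_smul]

theorem ne_unitIdem_top_of_mem_components {i : IrrIdem Γ} (hi : i ∈ Components (augIdem Γ')) :
    i.1 ≠ unitIdem ⊤ := by
  obtain ⟨w, hw, hne⟩ := mem_components_augIdem.mp hi
  intro h
  rw [h, cosetAction_unitIdem_top hw] at hne
  exact hne rfl

theorem augIdem_mul_unitIdem_top : augIdem Γ' * unitIdem (⊤ : Subgroup Γ) = 0 := by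
  classical
  unfold augIdem
  rw [Finset.sum_mul]
  refine Finset.sum_eq_zero fun i _ => ?_
  split_ifs with h
  · exact IrrIdem.mul_unitIdem_top (ne_unitIdem_top_of_mem_components (mem_components_augIdem.mpr h))
  · exact zero_mul _

theorem coeff_cosetAction [Fintype Γ'] (x : MonoidAlgebra ℚ Γ) (σ : Γ) :
    (cosetAction Γ' x (MonoidAlgebra.single ((1 : Γ) : Γ ⧸ Γ') 1)).coeff (σ : Γ ⧸ Γ') =
      ∑ h : Γ', x.coeff (σ * h) := by
  classical
  induction x using MonoidAlgebra.induction_linear with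
  | zero => simp
  | add a b ha hb =>
    rw [map_add, LinearMap.add_apply, MonoidAlgebra.coeff_add, Finsupp.add_apply, ha, hb,
      ← Finset.sum_add_distrib]
    rfl
  | single g r =>
    have h1 : MonoidAlgebra.single g r = r • MonoidAlgebra.single g (1 : ℚ) := by simp
    have h2 : g • ((1 : Γ) : Γ ⧸ Γ') = (g : Γ ⧸ Γ') := by
      change ((g * 1 : Γ) : Γ ⧸ Γ') = _
      rw [mul_one]
    rw [h1, map_smul, LinearMap.smul_apply, cosetAction_single, h2]
    simp only [MonoidAlgebra.smul_single, smul_eq_mul, mul_one, MonoidAlgebra.coeff_single,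
      Finsupp.single_apply, QuotientGroup.eq]
    by_cases h : σ⁻¹ * g ∈ Γ'
    · rw [Finset.sum_eq_single (⟨σ⁻¹ * g, h⟩ : Γ')]
      · have h' : g⁻¹ * σ ∈ Γ' := by simpa using inv_mem h
        rw [if_pos h', if_pos (by simp)]
      · exact fun k _ hk => if_neg fun h' => hk (Subtype.ext (eq_inv_mul_of_mul_eq h'.symm))
      · exact fun h' => absurd (Finset.mem_univ _) h'
    · have h' : ¬ g⁻¹ * σ ∈ Γ' := fun h' => h (by simpa using inv_mem h')
      rw [if_neg h']
      refine (Finset.sum_eq_zero fun k _ => if_neg fun hk => h ?_).symm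
      rw [hk, inv_mul_cancel_left]
      exact k.2

/-- The sums of the coefficients of `e_{Γ/Γ'}` over the left cosets of `Γ'`. -/
theorem coset_sum_augIdem [DecidablePred (· ∈ Γ')] [Fintype Γ'] (σ : Γ) :
    ∑ h : Γ', (augIdem Γ').coeff (σ * h) =
      (if σ ∈ Γ' then 1 else 0) - (Nat.card Γ' : ℚ) / Nat.card Γ := by
  classical
  set w₀ : MonoidAlgebra ℚ (Γ ⧸ Γ') := MonoidAlgebra.single ((1 : Γ) : Γ ⧸ Γ') 1 with hw₀
  -- Removing the e₁-part of the base coset leaves an element of the augmentation module, which e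
  -- fixes; since ee₁ = 0, this computes the action of e on the base coset, whose coefficients are
  -- the coset sums.
  have hmem : w₀ - cosetAction Γ' (unitIdem ⊤) w₀ ∈ augModule Γ' := by
    change (MonoidAlgebra.coeff _).sum _ = (0 : ℚ)
    rw [Finsupp.sum_fintype _ _ fun _ => rfl]
    have h1 : w₀ - cosetAction Γ' (unitIdem ⊤) w₀ = cosetAction Γ' (1 - unitIdem ⊤) w₀ := by
      rw [map_sub, map_one]; rfl
    have h2 : ∀ q : Γ ⧸ Γ', (cosetAction Γ' (1 - unitIdem ⊤) w₀).coeff q =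
        ∑ h : Γ', (1 - unitIdem (⊤ : Subgroup Γ)).coeff (q.out * h) := fun q => by
      rw [← coeff_cosetAction (Γ' := Γ'), QuotientGroup.out_eq']
    rw [h1, Finset.sum_congr rfl fun q _ => h2 q, ← sum_eq_sum_quotient]
    have h3 : ∀ g : Γ, (1 - unitIdem (⊤ : Subgroup Γ)).coeff g =
        (if g = 1 then 1 else 0) - (Nat.card Γ : ℚ)⁻¹ := fun g => by
      rw [MonoidAlgebra.coeff_sub, Finsupp.sub_apply, coeff_unitIdem, if_pos (Subgroup.mem_top g),
        Subgroup.card_top, MonoidAlgebra.one_def, MonoidAlgebra.coeff_single, Finsupp.single_apply]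
      simp only [eq_comm]
    rw [Finset.sum_congr rfl fun g _ => h3 g, Finset.sum_sub_distrib, Finset.sum_ite_eq',
      if_pos (Finset.mem_univ _), Finset.sum_const, Finset.card_univ, ← Nat.card_eq_fintype_card,
      nsmul_eq_mul, mul_inv_cancel₀ (by exact_mod_cast Nat.card_pos.ne'), sub_self]
  have h1 := (augIdem_spec Γ').1 _ hmem
  rw [map_sub, ← Module.End.mul_apply, ← map_mul, augIdem_mul_unitIdem_top, map_zero,
    LinearMap.zero_apply, sub_zero] at h1
  have h2 := congrArg (fun z => z.coeff (σ : Γ ⧸ Γ')) h1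
  simp only [MonoidAlgebra.coeff_sub, Finsupp.sub_apply] at h2
  rw [coeff_cosetAction, coeff_cosetAction] at h2
  have h4 : w₀.coeff (σ : Γ ⧸ Γ') = if σ ∈ Γ' then 1 else 0 := by
    rw [hw₀, MonoidAlgebra.coeff_single, Finsupp.single_apply]
    refine if_congr ?_ rfl rfl
    rw [QuotientGroup.eq, inv_one, one_mul]
  have h5 : ∀ h : Γ', (unitIdem (⊤ : Subgroup Γ)).coeff (σ * h) = (Nat.card Γ : ℚ)⁻¹ := fun h => by
    rw [coeff_unitIdem, if_pos (Subgroup.mem_top _), Subgroup.card_top]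
  rw [h4, Finset.sum_congr rfl fun h _ => h5 h, Finset.sum_const, Finset.card_univ,
    ← Nat.card_eq_fintype_card, nsmul_eq_mul, ← div_eq_mul_inv] at h2
  exact h2

theorem coeff_eq_of_invariant {c : MonoidAlgebra ℚ Γ}
    (hγ : ∀ γ ∈ Γ', MonoidAlgebra.single γ (1 : ℚ) * c = c) {γ : Γ} (h : γ ∈ Γ') (g : Γ) :
    c.coeff (γ⁻¹ * g) = c.coeff g := by
  conv_rhs => rw [← hγ γ h, MonoidAlgebra.coeff_single_mul_apply, one_mul]

/-- The sums of the coefficients of `c` over the left cosets of `Γ'`, when `ce_1' = e_{Γ/Γ'}e_1'`. -/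
theorem coset_sum_eq_of_mul_unitIdem [DecidablePred (· ∈ Γ')] [Fintype Γ'] {c : MonoidAlgebra ℚ Γ}
    (hcu : c * unitIdem Γ' = augIdem Γ' * unitIdem Γ') (σ : Γ) :
    ∑ h : Γ', c.coeff (σ * h) = (if σ ∈ Γ' then 1 else 0) - (Nat.card Γ' : ℚ) / Nat.card Γ := by
  rw [← coset_sum_augIdem, ← coeff_cosetAction, ← coeff_cosetAction, ← cosetAction_unitIdem,
    ← Module.End.mul_apply, ← Module.End.mul_apply, ← map_mul, ← map_mul, hcu]

/-- There are non-negative integers `a(γ)` such that the elements `b(g) = ∑ a(γ⁻¹g)` have constant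
sums over the left cosets of `Γ'`, except for `Γ'` itself, where the sum exceeds the other sums by an
integer prime to `S`. -/
theorem exists_coset_weights {S : Set Nat.Primes} (hS : ∀ p ∈ S, IsGoodPrime p (augIdem Γ'))
    [DecidablePred (· ∈ Γ')] [Fintype Γ'] :
    ∃ (a : Γ → ℕ) (d t : ℕ), d ≠ 0 ∧ (∀ p ∈ S, ¬ (p : ℕ) ∣ d) ∧
      ∀ σ, ∑ h : Γ', ∑ k : Γ', a ((k : Γ)⁻¹ * (σ * h)) = (if σ ∈ Γ' then d else 0) + t := by
  classical
  obtain ⟨c, hcR, -, hγ, hcu⟩ := exists_localIdempotent (augIdem_central Γ') hS Γ'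
  -- The integral idempotent c is used, not ee₁', so the common denominator d is prime to S and z =
  -- d · c has integer coefficients.
  set d := ∏ g, (c.coeff g).den with hd
  have hd0 : d ≠ 0 := Finset.prod_ne_zero_iff.mpr fun g _ => (c.coeff g).den_nz
  have hdS : ∀ p ∈ S, ¬ (p : ℕ) ∣ d := fun p hp h => by
    obtain ⟨g, -, hg⟩ := (p.2.prime.dvd_finsetProd_iff _).mp h
    exact mem_intGroupRing.mp hcR g p hp hg
  have hz : ∀ g, ∃ z : ℤ, (z : ℚ) = d * c.coeff g := fun g => by
    obtain ⟨k, hk⟩ := Finset.dvd_prod_of_mem (fun g => (c.coeff g).den) (Finset.mem_univ g)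
    refine ⟨k * (c.coeff g).num, ?_⟩
    rw [hd, hk]
    push_cast
    rw [mul_comm ((c.coeff g).den : ℚ), mul_assoc, Rat.den_mul_eq_num]
  choose z hz using hz
  have hzγ : ∀ (k : Γ') (g : Γ), z ((k : Γ)⁻¹ * g) = z g := fun k g => by
    have : (z ((k : Γ)⁻¹ * g) : ℚ) = z g := by rw [hz, hz, coeff_eq_of_invariant hγ k.2]
    exact_mod_cast this
  -- The shift makes every coefficient nonnegative; the extra summand d makes every a(g) at least d,
  -- so that t below is a natural number.
  set m : ℕ := d + ∑ g, (z g).natAbs with hm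
  have hmz : ∀ g, 0 ≤ z g + ((m : ℤ) - d) := fun g => by
    have h1 : (z g).natAbs ≤ ∑ g, (z g).natAbs :=
      Finset.single_le_sum (f := fun g => (z g).natAbs) (fun _ _ => Nat.zero_le _) (Finset.mem_univ g)
    omega
  -- `rep` selects one element in each right coset of Γ'. As z is constant on these cosets, summing
  -- a(k⁻¹g) over k ∈ Γ' counts z(g) once.
  let rep : Γ → Prop := fun g => ((g⁻¹ : Γ) : Γ ⧸ Γ').out = g⁻¹
  let a : Γ → ℕ := fun g => ((if rep g then z g else 0) + m).toNat
  have ha : ∀ g, (a g : ℤ) = (if rep g then z g else 0) + m := fun g => by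
    refine Int.toNat_of_nonneg ?_
    have := hmz g
    split_ifs <;> omega
  have hb : ∀ g, ∑ k : Γ', (a ((k : Γ)⁻¹ * g) : ℤ) = z g + Nat.card Γ' * m := fun g => by
    have hr : ((g⁻¹ : Γ) : Γ ⧸ Γ').out⁻¹ * g⁻¹ ∈ Γ' :=
      QuotientGroup.eq.mp (QuotientGroup.out_eq' _)
    have hr' : g * ((g⁻¹ : Γ) : Γ ⧸ Γ').out ∈ Γ' := by simpa using inv_mem hr
    have hrep : ∀ k : Γ', rep ((k : Γ)⁻¹ * g) ↔ k = ⟨_, hr'⟩ := fun k => by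
      have h1 : (((k : Γ)⁻¹ * g)⁻¹ : Γ) = g⁻¹ * k := by rw [mul_inv_rev, inv_inv]
      have h2 : ((g⁻¹ * k : Γ) : Γ ⧸ Γ') = (g⁻¹ : Γ) := QuotientGroup.mk_mul_of_mem _ k.2
      change (((((k : Γ)⁻¹ * g)⁻¹ : Γ)) : Γ ⧸ Γ').out = ((k : Γ)⁻¹ * g)⁻¹ ↔ _
      rw [h1, h2, Subtype.ext_iff, eq_inv_mul_iff_mul_eq]
      exact eq_comm
    rw [Finset.sum_congr rfl fun k _ => by rw [ha, hzγ, if_congr (hrep k) rfl rfl],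
      Finset.sum_add_distrib, Finset.sum_ite_eq', if_pos (Finset.mem_univ _), Finset.sum_const,
      Finset.card_univ, ← Nat.card_eq_fintype_card, nsmul_eq_mul]
  have hsum : ∀ σ, ((∑ h : Γ', ∑ k : Γ', a ((k : Γ)⁻¹ * (σ * h)) : ℕ) : ℚ) =
      (if σ ∈ Γ' then (d : ℚ) else 0) +
        ((Nat.card Γ' : ℚ) * (Nat.card Γ' * m) - d * (Nat.card Γ' / Nat.card Γ)) := fun σ => by
    have h1 : ∀ h : Γ', ((∑ k : Γ', a ((k : Γ)⁻¹ * (σ * h)) : ℕ) : ℚ) =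
        d * c.coeff (σ * h) + Nat.card Γ' * m := fun h => by
      rw [← hz]
      exact_mod_cast hb (σ * h)
    rw [Nat.cast_sum, Finset.sum_congr rfl fun h _ => h1 h, Finset.sum_add_distrib, ← Finset.mul_sum,
      coset_sum_eq_of_mul_unitIdem hcu, Finset.sum_const, Finset.card_univ, ← Nat.card_eq_fintype_card,
      nsmul_eq_mul]
    split_ifs <;> ring
  obtain ⟨t, ht⟩ : ∃ t : ℕ, (t : ℚ) =
      (Nat.card Γ' : ℚ) * (Nat.card Γ' * m) - d * (Nat.card Γ' / Nat.card Γ) := by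
    have h1 := hsum 1
    rw [if_pos (one_mem Γ')] at h1
    have hle : d ≤ ∑ h : Γ', ∑ k : Γ', a ((k : Γ)⁻¹ * (1 * h)) := by
      have h2 : d ≤ a (((1 : Γ') : Γ)⁻¹ * (1 * (1 : Γ'))) := by
        have h3 := ha (((1 : Γ') : Γ)⁻¹ * (1 * (1 : Γ')))
        have h4 := hmz (((1 : Γ') : Γ)⁻¹ * (1 * (1 : Γ')))
        split_ifs at h3 <;> omega
      refine h2.trans ((Finset.single_le_sum (f := fun k : Γ' => a ((k : Γ)⁻¹ * (1 * (1 : Γ'))))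
        (fun _ _ => Nat.zero_le _) (Finset.mem_univ (1 : Γ'))).trans ?_)
      exact Finset.single_le_sum (f := fun h : Γ' => ∑ k : Γ', a ((k : Γ)⁻¹ * (1 * h)))
        (fun _ _ => Nat.zero_le _) (Finset.mem_univ (1 : Γ'))
    refine ⟨(∑ h : Γ', ∑ k : Γ', a ((k : Γ)⁻¹ * (1 * h))) - d, ?_⟩
    rw [Nat.cast_sub hle, h1, add_sub_cancel_left]
  refine ⟨a, d, t, hd0, hdS, fun σ => ?_⟩
  have h1 := hsum σ
  rw [← ht] at h1
  split_ifs at h1 ⊢ <;> exact_mod_cast h1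

end CosetSums

/-! ### Norm identities for ideals and ideal classes of K = L^{Γ'} -/

section RelativeClassGroups

open scoped nonZeroDivisors

variable {Γ : Type u} [Group Γ] [Fintype Γ] {K₀ : Type u} [Field K₀] [NumberField K₀]
  {Γ' : Subgroup Γ}

namespace GammaExt

variable (E : GammaExt Γ K₀)

theorem classAct_mul (g h : Γ) (x : ClassGroup (𝓞 E.L)) :
    E.classAct (g * h) x = E.classAct g (E.classAct h x) := by
  obtain ⟨I, rfl⟩ := ClassGroup.mk0_surjective x
  rw [classAct_mk0, classAct_mk0, classAct_mk0, idealAct_mul]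

theorem classAct_one (x : ClassGroup (𝓞 E.L)) : E.classAct 1 x = x := by
  obtain ⟨I, rfl⟩ := ClassGroup.mk0_surjective x
  rw [classAct_mk0, idealAct_one]

theorem classAct_extendedHom {g : Γ} (hg : g ∈ Γ') (x : ClassGroup (𝓞 (E.fixedField Γ'))) :
    E.classAct g (ClassGroup.extendedHom (𝓞 (E.fixedField Γ')) (𝓞 E.L) x) =
      ClassGroup.extendedHom (𝓞 (E.fixedField Γ')) (𝓞 E.L) x := by
  obtain ⟨I, rfl⟩ := ClassGroup.mk0_surjective x
  rw [extendedHom_mk0, classAct_mk0, E.idealAct_idealExtend Γ' hg]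

theorem classNorm_classAct (g : Γ) (x : ClassGroup (𝓞 E.L)) :
    classNorm (𝓞 K₀) (𝓞 E.L) (E.classAct g x) = classNorm (𝓞 K₀) (𝓞 E.L) x := by
  obtain ⟨I, rfl⟩ := ClassGroup.mk0_surjective x
  rw [classAct_mk0, classNorm_mk0, classNorm_mk0]
  exact congrArg _ (idealNorm_idealAut _ I)

theorem extendedHom_classNorm [Fintype Γ'] (x : ClassGroup (𝓞 E.L)) :
    ClassGroup.extendedHom (𝓞 (E.fixedField Γ')) (𝓞 E.L)
      (classNorm (𝓞 (E.fixedField Γ')) (𝓞 E.L) x) = ∏ h : Γ', E.classAct h x := by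
  obtain ⟨I, rfl⟩ := ClassGroup.mk0_surjective x
  rw [classNorm_mk0, extendedHom_mk0, idealExtend_idealNorm_fixedField, map_prod]
  exact Finset.prod_congr rfl fun h _ => (E.classAct_mk0 h I).symm

/-- Splitting the product over Γ that gives the norm from L to K₀ into cosets of Γ' yields the
asserted equality raised to the power |Γ'|, and ideals have unique roots. -/
theorem prod_idealAct_out [Fintype Γ'] [Fintype (Γ ⧸ Γ')] (J : (Ideal (𝓞 (E.fixedField Γ')))⁰) :
    ∏ q : Γ ⧸ Γ', E.idealAct q.out (idealExtend (𝓞 (E.fixedField Γ')) (𝓞 E.L) J) =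
      idealExtend (𝓞 K₀) (𝓞 E.L) (idealNorm (𝓞 K₀) (𝓞 (E.fixedField Γ')) J) := by
  apply ideal_pow_left_injective (Nat.card_pos (α := Γ')).ne'
  have h1 := E.idealExtend_idealNorm_base (idealExtend (𝓞 (E.fixedField Γ')) (𝓞 E.L) J)
  have h2 : ∏ g, E.idealAct g (idealExtend (𝓞 (E.fixedField Γ')) (𝓞 E.L) J) = ∏ q : Γ ⧸ Γ', ∏ h : Γ',
      E.idealAct (q.out * h) (idealExtend (𝓞 (E.fixedField Γ')) (𝓞 E.L) J) :=
    sum_eq_sum_quotient (M := Additive (Ideal (𝓞 E.L))⁰)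
      fun g => Additive.ofMul (E.idealAct g (idealExtend (𝓞 (E.fixedField Γ')) (𝓞 E.L) J))
  rw [h2, ← idealNorm_idealNorm (K := E.fixedField Γ'),
    idealNorm_idealExtend, finrank_fixedField, map_pow, map_pow] at h1
  refine Eq.trans ?_ h1.symm
  refine (Finset.prod_pow _ _ _).symm.trans ?_
  refine Finset.prod_congr rfl fun q _ => ?_
  rw [Finset.prod_congr rfl fun h _ => by rw [idealAct_mul, E.idealAct_idealExtend Γ' h.2],
    Finset.prod_const, Finset.card_univ, ← Nat.card_eq_fintype_card]

theorem prod_classAct_out [Fintype Γ'] [Fintype (Γ ⧸ Γ')] (x : ClassGroup (𝓞 (E.fixedField Γ'))) :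
    ∏ q : Γ ⧸ Γ', E.classAct q.out (ClassGroup.extendedHom (𝓞 (E.fixedField Γ')) (𝓞 E.L) x) =
      ClassGroup.extendedHom (𝓞 K₀) (𝓞 E.L) (classNorm (𝓞 K₀) (𝓞 (E.fixedField Γ')) x) := by
  obtain ⟨J, rfl⟩ := ClassGroup.mk0_surjective x
  rw [extendedHom_mk0, classNorm_mk0, extendedHom_mk0, ← prod_idealAct_out, map_prod]
  exact Finset.prod_congr rfl fun h _ => E.classAct_mk0 _ _

variable {a : Γ → ℕ} {d t : ℕ}

/-- After extension to L both sides become products of conjugates of J, which the coset sums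
compare. Extension is injective on ideals, so the identity already holds in K and passes to classes
of K. -/
theorem prod_idealNorm_pow [Fintype Γ'] [Fintype (Γ ⧸ Γ')] [DecidablePred (· ∈ Γ')]
    (ha : ∀ σ, ∑ h : Γ', ∑ k : Γ', a ((k : Γ)⁻¹ * (σ * h)) = (if σ ∈ Γ' then d else 0) + t)
    (J : (Ideal (𝓞 (E.fixedField Γ')))⁰) :
    ∏ g, idealNorm (𝓞 (E.fixedField Γ')) (𝓞 E.L)
      (E.idealAct g (idealExtend (𝓞 (E.fixedField Γ')) (𝓞 E.L) J)) ^ a g =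
    J ^ d * idealExtend (𝓞 K₀) (𝓞 (E.fixedField Γ'))
      (idealNorm (𝓞 K₀) (𝓞 (E.fixedField Γ')) J) ^ t := by
  apply idealExtend_injective (E.fixedField Γ') E.L
  rw [map_prod, map_mul, map_pow, map_pow, idealExtend_idealExtend, ← prod_idealAct_out]
  have h1 := sum_smul_sum_eq_of_coset_sums (M := Additive (Ideal (𝓞 E.L))⁰) ha
    (f := fun g => Additive.ofMul (E.idealAct g (idealExtend (𝓞 (E.fixedField Γ')) (𝓞 E.L) J)))
    fun σ h hh => by rw [idealAct_mul, E.idealAct_idealExtend Γ' hh]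
  rw [idealAct_one] at h1
  refine Eq.trans (Finset.prod_congr rfl fun g _ => ?_) h1
  rw [map_pow, idealExtend_idealNorm_fixedField]
  refine congrArg (fun I => I ^ a g) (Finset.prod_congr rfl fun k _ => ?_)
  exact (E.idealAct_mul k g _).symm

theorem prod_classNorm_pow [Fintype Γ'] [Fintype (Γ ⧸ Γ')] [DecidablePred (· ∈ Γ')]
    (ha : ∀ σ, ∑ h : Γ', ∑ k : Γ', a ((k : Γ)⁻¹ * (σ * h)) = (if σ ∈ Γ' then d else 0) + t)
    (x : ClassGroup (𝓞 (E.fixedField Γ'))) :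
    ∏ g, classNorm (𝓞 (E.fixedField Γ')) (𝓞 E.L)
      (E.classAct g (ClassGroup.extendedHom (𝓞 (E.fixedField Γ')) (𝓞 E.L) x)) ^ a g =
    x ^ d * ClassGroup.extendedHom (𝓞 K₀) (𝓞 (E.fixedField Γ'))
      (classNorm (𝓞 K₀) (𝓞 (E.fixedField Γ')) x) ^ t := by
  obtain ⟨J, rfl⟩ := ClassGroup.mk0_surjective x
  have h1 := congrArg ClassGroup.mk0 (E.prod_idealNorm_pow ha J)
  rw [map_prod, map_mul, map_pow, map_pow] at h1
  rw [extendedHom_mk0, classNorm_mk0, extendedHom_mk0, ← h1]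
  refine Finset.prod_congr rfl fun g _ => ?_
  rw [classAct_mk0, classNorm_mk0, map_pow]

/-- Here y is only a Γ'-fixed class of L and need not come from K. The same coset sums apply, but
the identity lives in the class group of L. -/
theorem extendedHom_prod_classNorm_pow [Fintype Γ'] [Fintype (Γ ⧸ Γ')] [DecidablePred (· ∈ Γ')]
    (ha : ∀ σ, ∑ h : Γ', ∑ k : Γ', a ((k : Γ)⁻¹ * (σ * h)) = (if σ ∈ Γ' then d else 0) + t)
    {y : ClassGroup (𝓞 E.L)} (hy : ∀ h ∈ Γ', E.classAct h y = y) :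
    ClassGroup.extendedHom (𝓞 (E.fixedField Γ')) (𝓞 E.L)
      (∏ g, classNorm (𝓞 (E.fixedField Γ')) (𝓞 E.L) (E.classAct g y) ^ a g) =
    y ^ d * (∏ q : Γ ⧸ Γ', E.classAct q.out y) ^ t := by
  have h1 := sum_smul_sum_eq_of_coset_sums (M := Additive (ClassGroup (𝓞 E.L))) ha
    (f := fun g => Additive.ofMul (E.classAct g y))
    fun σ h hh => by rw [classAct_mul, hy h hh]
  rw [classAct_one] at h1
  rw [map_prod]
  refine Eq.trans (Finset.prod_congr rfl fun g _ => ?_) h1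
  rw [map_pow, extendedHom_classNorm]
  refine congrArg (fun I => I ^ a g) (Finset.prod_congr rfl fun k _ => ?_)
  exact (E.classAct_mul k g _).symm

end GammaExt

end RelativeClassGroups

/-! ### The group ring action on Cl_L^S and its fixed part -/

section ExtendIso

variable {Γ : Type u} [Group Γ] [Fintype Γ]

theorem intGroupRing_smul_eq_sum {R : Subring ℚ} {M : Type*} [AddCommGroup M] [Module R M]
    (ρ : Representation R Γ M) (x : intGroupRing Γ R) (m : M) :
    letI := intGroupRingModule ρ
    x • m = ∑ g, (⟨x.1.coeff g, mem_intGroupRing.mp x.2 g⟩ : R) • ρ g m := by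
  let _ := intGroupRingModule ρ
  obtain ⟨y, rfl⟩ := (groupRingEquiv Γ R).surjective x
  change ρ.asAlgebraHom ((groupRingEquiv Γ R).symm (groupRingEquiv Γ R y)) m = _
  rw [RingEquiv.symm_apply_apply, Representation.asAlgebraHom_def, MonoidAlgebra.lift_apply,
    Finsupp.sum_fintype _ _ (fun g => zero_smul R (ρ g)), LinearMap.sum_apply]
  refine Finset.sum_congr rfl fun g _ => ?_
  rw [LinearMap.smul_apply]
  congr 1

theorem natCast_inv_mem_ZS {S : Set Nat.Primes} {d : ℕ} (hd : d ≠ 0)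
    (hdS : ∀ p ∈ S, ¬ (p : ℕ) ∣ d) : ((d : ℚ))⁻¹ ∈ ZS S := fun p hp h =>
  hdS p hp (by rwa [Rat.inv_natCast_den_of_pos (Nat.pos_of_ne_zero hd)] at h)

theorem inv_smul_nsmul {S : Set Nat.Primes} {d : ℕ} (hd : d ≠ 0) (h : ((d : ℚ))⁻¹ ∈ ZS S)
    {M : Type*} [AddCommGroup M] [Module (ZS S) M] (x : M) : (⟨_, h⟩ : ZS S) • d • x = x := by
  rw [← Nat.cast_smul_eq_nsmul (ZS S), smul_smul]
  have : (⟨_, h⟩ : ZS S) * d = 1 := Subtype.ext (inv_mul_cancel₀ (by exact_mod_cast hd))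
  rw [this, one_smul]

variable {K₀ : Type u} [Field K₀] [NumberField K₀] {S : Set Nat.Primes} {Γ' : Subgroup Γ}

namespace GammaExt

variable (E : GammaExt Γ K₀)

theorem groupElt_smul (γ : Γ) (z : E.ClS S) : groupElt (ZS S) γ • z = E.clAction S γ z := by
  refine (intGroupRing_smul_eq_sum (E.clAction S) _ z).trans ?_
  rw [Finset.sum_eq_single γ]
  · have : (⟨(groupElt (ZS S) γ).1.coeff γ, mem_intGroupRing.mp (groupElt (ZS S) γ).2 γ⟩ : ZS S) = 1 :=
      Subtype.ext (by simp [groupElt])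
    rw [this, one_smul]
  · intro g _ hg
    have : (⟨(groupElt (ZS S) γ).1.coeff g, mem_intGroupRing.mp (groupElt (ZS S) γ).2 g⟩ : ZS S) = 0 :=
      Subtype.ext (by simp [groupElt, hg.symm])
    rw [this, zero_smul]
  · exact fun h => absurd (Finset.mem_univ _) h

theorem mem_fixedCl {e : MonoidAlgebra ℚ Γ} (heS : e ∈ intGroupRing Γ (ZS S))
    (he : IsCentralIdempotent e) {z : E.ClS S} :
    z ∈ E.fixedCl heS he Γ' ↔
      (⟨e, heS⟩ : intGroupRing Γ (ZS S)) • z = z ∧ ∀ γ ∈ Γ', E.clAction S γ z = z := by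
  let _ := idemPartModule heS he (E.ClS S)
  have hee : (⟨e, heS⟩ : intGroupRing Γ (ZS S)) * ⟨e, heS⟩ = ⟨e, heS⟩ := Subtype.ext he.idem.eq
  have hidem : ∀ m : E.ClS S, m ∈ idemPart heS (E.ClS S) ↔
      (⟨e, heS⟩ : intGroupRing Γ (ZS S)) • m = m := fun m => by
    constructor
    · rintro ⟨m, rfl⟩
      change (⟨e, heS⟩ : intGroupRing Γ (ZS S)) • (⟨e, heS⟩ : intGroupRing Γ (ZS S)) • m =
        (⟨e, heS⟩ : intGroupRing Γ (ZS S)) • m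
      rw [smul_smul, hee]
    · exact fun h => ⟨m, h⟩
  have hg : ∀ (γ : Γ) (m : idemPart heS (E.ClS S)),
      (toIdemOrder (ZS S) he (groupElt (ZS S) γ) • m).1 = E.clAction S γ m.1 := fun γ m => by
    change toGroupRing heS (toIdemOrder (ZS S) he (groupElt (ZS S) γ)) • m.1 = _
    have h1 : toGroupRing heS (toIdemOrder (ZS S) he (groupElt (ZS S) γ)) =
        groupElt (ZS S) γ * ⟨e, heS⟩ := Subtype.ext (he.central _)
    rw [h1, mul_smul, (hidem m.1).mp m.2, groupElt_smul]
  constructor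
  · rintro ⟨m, hm, rfl⟩
    refine ⟨(hidem _).mp m.2, fun γ hγ => ?_⟩
    exact (hg γ m).symm.trans (congrArg Subtype.val (hm γ hγ))
  · rintro ⟨h1, h2⟩
    refine ⟨⟨z, (hidem z).mpr h1⟩, fun γ hγ => Subtype.ext ?_, rfl⟩
    exact (hg γ _).trans (h2 γ hγ)

end GammaExt

end ExtendIso

/-! ### The isomorphism i_* -/

section ExtendIsoProof

variable {Γ : Type u} [Group Γ] [Fintype Γ]
variable {K₀ : Type u} [Field K₀] [NumberField K₀] {S : Set Nat.Primes} {Γ' : Subgroup Γ}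

namespace GammaExt

variable (E : GammaExt Γ K₀)

/-- On elements fixed by `Γ'` the idempotent `e_{Γ/Γ'}` is the identity minus the mean over the
cosets of `Γ'`. -/
theorem augIdem_smul_eq_iff [Fintype (Γ ⧸ Γ')] (heS : augIdem Γ' ∈ intGroupRing Γ (ZS S))
    {z : E.ClS S} (hz : ∀ γ ∈ Γ', E.clAction S γ z = z) :
    (⟨augIdem Γ', heS⟩ : intGroupRing Γ (ZS S)) • z = z ↔
      ∑ q : Γ ⧸ Γ', E.clAction S q.out z = 0 := by
  classical
  let b : Γ → ZS S := fun g => ⟨(augIdem Γ').coeff g, mem_intGroupRing.mp heS g⟩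
  have hcoe : ∀ σ, ((∑ h : Γ', b (σ * h) : ZS S) : ℚ) = ∑ h : Γ', (augIdem Γ').coeff (σ * h) :=
    fun σ => by rw [AddSubmonoidClass.coe_finsetSum]
  obtain ⟨t, ht⟩ : ∃ t : ZS S, (t : ℚ) = -((Nat.card Γ' : ℚ) / Nat.card Γ) :=
    ⟨∑ h : Γ', b (1 * h) - 1, by
      rw [AddSubgroupClass.coe_sub, hcoe, coset_sum_augIdem, if_pos (one_mem Γ'), Subring.coe_one]
      ring⟩
  have hb : ∀ σ, ∑ h : Γ', b (σ * h) = (if σ ∈ Γ' then 1 else 0) + t := fun σ => by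
    refine Subtype.ext ?_
    rw [hcoe, coset_sum_augIdem, Subring.coe_add, ht]
    split_ifs <;> simp [sub_eq_add_neg]
  have h1 : (⟨augIdem Γ', heS⟩ : intGroupRing Γ (ZS S)) • z =
      z + t • ∑ q : Γ ⧸ Γ', E.clAction S q.out z := by
    refine (intGroupRing_smul_eq_sum (E.clAction S) _ z).trans ?_
    refine (sum_smul_eq_of_coset_sums hb (f := fun g => E.clAction S g z) fun σ h hh => ?_).trans ?_
    · rw [map_mul, Module.End.mul_apply, hz h hh]
    · rw [one_smul, map_one, Module.End.one_apply]
  rw [h1, add_eq_left]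
  refine ⟨fun h => ?_, fun h => by rw [h, smul_zero]⟩
  -- The coset sum t = -|Γ'|/|Γ| is a unit of ℤ_S with inverse -[Γ : Γ']; its integrality comes from
  -- that of e.
  have h2 : (-(Γ'.index : ZS S)) * t = 1 := by
    refine Subtype.ext ?_
    have hi : (Γ'.index : ℚ) * Nat.card Γ' = Nat.card Γ := by exact_mod_cast Γ'.index_mul_card
    have hn : (Nat.card Γ : ℚ) ≠ 0 := by exact_mod_cast Nat.card_pos.ne'
    rw [Subring.coe_mul, ht, Subring.coe_neg, Subring.coe_one, neg_mul_neg, ← mul_div_assoc]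
    change (Γ'.index : ℚ) * _ / _ = 1
    rw [hi, div_self hn]
  rw [← one_smul (ZS S) (∑ q : Γ ⧸ Γ', E.clAction S q.out z), ← h2, mul_smul, h, smul_zero]

theorem coe_sum_clAction [Fintype (Γ ⧸ Γ')] (z : E.ClS S) :
    Additive.toMul (∑ q : Γ ⧸ Γ', E.clAction S q.out z).1 =
      ∏ q : Γ ⧸ Γ', E.classAct q.out (Additive.toMul z.1) := by
  rw [AddSubmonoidClass.coe_finsetSum]
  rfl

theorem coe_extend (x : E.RelClS S Γ') :
    Additive.toMul (E.extend S Γ' x).1 =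
      ClassGroup.extendedHom (𝓞 (E.fixedField Γ')) (𝓞 E.L) (Additive.toMul x.1).1 := rfl

/-- If x becomes trivial in L, then the left side of `prod_classNorm_pow` is trivial, and so is the
factor coming from K₀ since x has trivial norm. So x^d = 1 with d invertible in ℤ_S. -/
theorem extend_injective (hS : ∀ p ∈ S, IsGoodPrime p (augIdem Γ')) :
    Function.Injective (E.extend S Γ') := by
  classical
  obtain ⟨a, d, t, hd, hdS, ha⟩ := exists_coset_weights hS
  refine (injective_iff_map_eq_zero _).mpr fun x hx => ?_
  have h0 : ClassGroup.extendedHom (𝓞 (E.fixedField Γ')) (𝓞 E.L) (Additive.toMul x.1).1 = 1 := by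
    rw [← coe_extend, hx]
    rfl
  have h1 := E.prod_classNorm_pow ha (Additive.toMul x.1).1
  have h2 : classNorm (𝓞 K₀) (𝓞 (E.fixedField Γ')) (Additive.toMul x.1).1 = 1 :=
    MonoidHom.mem_ker.mp (Additive.toMul x.1).2
  rw [h0, h2, map_one, one_pow, mul_one, Finset.prod_eq_one fun g _ => by
    rw [map_one, map_one, one_pow]] at h1
  have h3 : d • x = 0 := Subtype.ext (congrArg Additive.ofMul (Subtype.ext h1.symm))
  rw [← inv_smul_nsmul hd (natCast_inv_mem_ZS hd hdS) x, h3, smul_zero]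

/-- The sum of the coset conjugates of an extended class is the extension of its norm to K₀, which
is trivial for relative classes; this is the criterion for e to act as the identity. -/
theorem extend_mem_fixedCl (heS : augIdem Γ' ∈ intGroupRing Γ (ZS S)) (x : E.RelClS S Γ') :
    E.extend S Γ' x ∈ E.fixedCl heS (augIdem_central Γ') Γ' := by
  classical
  have hfix : ∀ γ ∈ Γ', E.clAction S γ (E.extend S Γ' x) = E.extend S Γ' x := fun γ hγ =>
    Subtype.ext (congrArg Additive.ofMul (E.classAct_extendedHom hγ (Additive.toMul x.1).1))
  refine (E.mem_fixedCl heS _).mpr ⟨(E.augIdem_smul_eq_iff heS hfix).mpr ?_, hfix⟩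
  refine Subtype.ext (Additive.toMul.injective ?_)
  have h2 : classNorm (𝓞 K₀) (𝓞 (E.fixedField Γ')) (Additive.toMul x.1).1 = 1 :=
    MonoidHom.mem_ker.mp (Additive.toMul x.1).2
  rw [coe_sum_clAction, coe_extend, prod_classAct_out, h2, map_one]
  rfl

/-- The preimage is, up to the unit d, the class ξ = ∏ N_{L/K}(gy)^{a(g)}. It extends to y^d because
the product of the coset conjugates of y is trivial. -/
theorem exists_extend_eq (hS : ∀ p ∈ S, IsGoodPrime p (augIdem Γ')) {y : E.ClS S}
    (hy : y ∈ E.fixedCl (mem_of_good hS) (augIdem_central Γ') Γ') :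
    ∃ x : E.RelClS S Γ', E.extend S Γ' x = y := by
  classical
  obtain ⟨a, d, t, hd, hdS, ha⟩ := exists_coset_weights hS
  obtain ⟨hey, hfix⟩ := (E.mem_fixedCl (mem_of_good hS) _).mp hy
  have hsum := (E.augIdem_smul_eq_iff (mem_of_good hS) hfix).mp hey
  have hprod := congrArg (fun z => Additive.toMul z.1) hsum
  simp only [coe_sum_clAction] at hprod
  set η := Additive.toMul y.1 with hη
  -- Norms to K₀ do not see the action of Γ, and the coefficients of e add up to 0, so the norm of y
  -- = ey is trivial. This puts ξ into the relative class group.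
  have hnorm : classNorm (𝓞 K₀) (𝓞 E.L) η = 1 := by
    let N : E.ClS S →+ SPart S (Additive (ClassGroup (𝓞 K₀))) :=
      SPart.map (MonoidHom.toAdditive (classNorm (𝓞 K₀) (𝓞 E.L)))
    have hN : ∀ g, N (E.clAction S g y) = N y := fun g =>
      Subtype.ext (congrArg Additive.ofMul (E.classNorm_classAct g η))
    have h1 : ∑ g, (⟨(augIdem Γ').coeff g, mem_intGroupRing.mp (mem_of_good hS) g⟩ : ZS S) =
        0 := by
      refine Subtype.ext ?_
      rw [AddSubmonoidClass.coe_finsetSum]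
      simpa using coeff_sum_of_mul_unitIdem augIdem_mul_unitIdem_top (1 : Γ)
    have h2 : N y = 0 := by
      conv_lhs => rw [← hey]
      rw [intGroupRing_smul_eq_sum (E.clAction S), map_sum, ← zero_smul (ZS S) (N y), ← h1,
        Finset.sum_smul]
      refine Finset.sum_congr rfl fun g _ => ?_
      rw [← hN g]
      exact SPart.map_smul _ _ _
    exact congrArg (fun z => Additive.toMul z.1) h2
  obtain ⟨n, hn, hnS, hny⟩ := y.2
  have hny' : η ^ n = 1 := hny
  let ξ := ∏ g, classNorm (𝓞 (E.fixedField Γ')) (𝓞 E.L) (E.classAct g η) ^ a g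
  have hξ : ξ ∈ E.RelCl Γ' := by
    refine MonoidHom.mem_ker.mpr ?_
    rw [map_prod]
    refine Finset.prod_eq_one fun g _ => ?_
    rw [map_pow, classNorm_classNorm, classNorm_classAct, hnorm, one_pow]
  have hξn : ξ ^ n = 1 := by
    rw [← Finset.prod_pow]
    refine Finset.prod_eq_one fun g _ => ?_
    have h1 : classNorm (𝓞 (E.fixedField Γ')) (𝓞 E.L) (E.classAct g η) ^ n = 1 := by
      rw [← map_pow, ← map_pow, hny', map_one, map_one]
    rw [← pow_mul, mul_comm, pow_mul, h1, one_pow]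
  let x : E.RelClS S Γ' := ⟨Additive.ofMul ⟨ξ, hξ⟩, n, hn, hnS,
    congrArg Additive.ofMul (Subtype.ext hξn)⟩
  have hx : E.extend S Γ' x = d • y := by
    refine Subtype.ext (Additive.toMul.injective ?_)
    refine (E.extendedHom_prod_classNorm_pow ha (y := η) fun h hh => ?_).trans ?_
    · exact congrArg (fun z => Additive.toMul z.1) (hfix h hh)
    · rw [hprod]
      change η ^ d * 1 ^ t = η ^ d
      rw [one_pow, mul_one]
  refine ⟨(⟨_, natCast_inv_mem_ZS hd hdS⟩ : ZS S) • x, ?_⟩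
  exact (SPart.map_smul _ _ _).trans ((congrArg _ hx).trans (inv_smul_nsmul hd _ y))

/-- Extension of ideals is an isomorphism from the `S`-part of the relative class group onto the
`Γ'`-fixed part of `eCl_L^S`. -/
theorem extendIso (hS : ∀ p ∈ S, IsGoodPrime p (augIdem Γ')) :
    E.ExtendIso (mem_of_good hS) (augIdem_central Γ') Γ' := by
  refine ⟨E.extend_injective hS, le_antisymm ?_ fun y hy => E.exists_extend_eq hS hy⟩
  rintro _ ⟨x, rfl⟩
  exact E.extend_mem_fixedCl (mem_of_good hS) x

variable {e : MonoidAlgebra ℚ Γ}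

theorem relClass_eq_fixedClass (heS : e ∈ intGroupRing Γ (ZS S))
    (he : IsCentralIdempotent e) (Γ' : Subgroup Γ) (h : E.ExtendIso heS he Γ') :
    E.relClass heS he Γ' = fixedClass heS he Γ' (E.clClass heS he) := by
  unfold GammaExt.relClass
  rw [dif_pos h]
  let _ := idemPartModule heS he (E.ClS S)
  let _ := fixedPartModule heS Γ' (idemPart heS (E.ClS S))
  let _ := (E.extendEquiv heS he Γ' h).module (heckeOrder (ZS S) he Γ')
  exact Quotient.sound ⟨(E.extendEquiv heS he Γ' h).linearEquiv (heckeOrder (ZS S) he Γ')⟩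

end GammaExt

end ExtendIsoProof

end CohenMartinet

end

/-! ### The theorem -/

theorem mainTheorem11 {Γ : Type u} [Group Γ] [Fintype Γ] (Γ' : Subgroup Γ)
    {K₀ : Type u} [Field K₀] [NumberField K₀] (S : Set Nat.Primes)
    (hS : ∀ p ∈ S, IsGoodPrime p (augIdem Γ'))
    (φ : IrrIdem Γ → Γ → ℂ) (hφ : ∀ i, IsConstituent i (φ i))
    (w v : IrrIdem Γ → ℚ)
    (hw : ∃ L : GammaExt Γ K₀, L.HasRankOn φ {i | i.1 ≠ unitIdem ⊤} w)
    (hv : IsFixedFieldRank φ Γ' w v)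
    (hpos : S.Finite ∨ ∀ i ∈ Components (augIdem Γ'), 0 < w i)
    (f : FinModClass (heckeOrder (ZS S) (augIdem_central Γ') Γ') → ℝ≥0) :
    (∀ L : GammaExt Γ K₀, L.ExtendIso (mem_of_good hS) (augIdem_central Γ') Γ') ∧
    ∀ I : Set (IrrIdem Γ), Components (augIdem Γ') ⊆ I → (∀ i ∈ I, i.1 ≠ unitIdem ⊤) →
      CohenMartinetPrediction K₀ φ (augIdem Γ') S (mem_of_good hS) (augIdem_central Γ') I w
        (fun c => f (fixedClass (mem_of_good hS) (augIdem_central Γ') Γ' c)) →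
      Tendsto (average (fun L : GammaExt Γ K₀ => L.HasRankOn φ I w)
        (fun L => (f (L.relClass (mem_of_good hS) (augIdem_central Γ') Γ') : ℝ≥0∞)))
        atTop (𝓝 (expectationY S (augIdem_central Γ') Γ' v f)) := by
  have hiso : ∀ L : GammaExt Γ K₀, L.ExtendIso (mem_of_good hS) (augIdem_central Γ') Γ' :=
    fun L => L.extendIso hS
  refine ⟨hiso, fun I hIc hIne hCM => ?_⟩
  unfold CohenMartinetPrediction at hCM
  -- The limits agree by the transfer from X to Y. The averages agree extension by extension, since
  -- i_* transports the 𝔬-structure of the fixed part.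
  rw [expectation_fixedClass hS hφ (fun i hi => hIne i (hIc hi)) hv f] at hCM
  have hF : (fun L : GammaExt Γ K₀ =>
      (f (L.relClass (mem_of_good hS) (augIdem_central Γ') Γ') : ℝ≥0∞)) = fun L =>
      (f (fixedClass (mem_of_good hS) (augIdem_central Γ') Γ'
        (L.clClass (mem_of_good hS) (augIdem_central Γ'))) : ℝ≥0∞) :=
    funext fun L => by rw [L.relClass_eq_fixedClass _ _ _ (hiso L)]
  rw [hF]
  exact hCM
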